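/- **Definitions.** A *chord diagram* consists of a circle with $k+1$ ($k\ge 1$) matched points $Q_0,Q_1,\dots,Q_k$, numbered in the cyclic order along the circle, of chords that join different points among $Q_1,\dots,Q_k$, at most one chord ending at each point, and of a coloring of the $k+1$ arcs between consecutive matched points in two colors (black, grey) such that the two arcs adjacent to any matched point other than $Q_0$ have different colors. A matched point is *free* if no chord ends at it. A *full way* from $Q_0$ to a free point $Q_e\neq Q_0$ is a path from $Q_0$ to $Q_e$ that passes through every matched point exactly once, runs alternately along arcs and chords, beginning with an arc, and runs through all its arcs in the same direction of the circle. For a compact smooth surface $M$ with boundary let $\Omega(M)$ be the set of $C^\infty$ functions $f\colon M\to\mathbb R$ all of whose critical points are isolated and lie on $\partial M$, and whose set of critical points is equal to the set of critical points of $f|_{\partial M}$. A function $f\in\Omega(M)$ is *optimal* if it has the minimum number of critical points among all functions in $\Omega(M)$, and *simple* if it has at most one critical point on each level. A critical point is a *saddle* if it is neither a local minimum nor a local maximum. Let $p_0\in\partial M$ be a saddle critical point of a simple function $f\in\Omega(M)$. Take a homeomorphism from a neighborhood of $p_0$ in $M$ onto a neighborhood of $0$ in $\{y\ge0\}$ that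 takes $p_0$ to $0$ and in which $f=f(p_0)\pm\operatorname{Re}(x+iy)^k$, and a closed half-disk centered at $0$ in its image. The *chord diagram of the saddle critical level* has the boundary circle of this half-disk as its circle; its matched points are $Q_0=p_0$ and the $k$ points $Q_1,\dots,Q_k$ of the half-circle at which $f=f(p_0)$, numbered consecutively along the half-circle in one of the two directions (i.e. for one of the two orientations of the boundary); $Q_i$ and $Q_j$ ($i\ne j$) are joined by a chord if and only if they can be joined by a path in $f^{-1}(f(p_0))\setminus\{p_0\}$; an arc is black if $f>f(p_0)$ inside it and grey if $f<f(p_0)$ inside it. **Theorem 4.4 (realization).** Let $D$ be a chord diagram such that 1) every chord divides the circle into two arcs, each of which contains an even number of matched points (the ends of the chord not being counted); 2) $D$ has $k+1=4n+2$ matched points for some integer $n\ge1$, and exactly two free points, one of which is $Q_0$; 3) there exist two different full ways from $Q_0$ to the other free point. Then there exist a compact connected orientable smooth surface $M$ whose boundary is connected and non-empty, and a simple optimal function $f\in\Omega(M)$ whose set of critical values is $\{-1,0,1\}$, such that $f$ has a saddle critical point on the level $f=0$ and the chord diagram of this saddle critical level is $D$. -/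

import Mathlib

open scoped Manifold ContDiff Topology

/-! ### Chord diagrams -/

/-- A chord diagram: a circle with `k + 1` matched points `Q_0, …, Q_k` numbered in the cyclic order,
some pairs of the points `Q_1, …, Q_k` being joined by pairwise disjoint chords (recorded by the
gluing substitution), and a two-coloring of the `k + 1` arcs. Everything is read up to
homeomorphisms of the circle that respect the numbering. -/
structure ChordDiagram where
  /-- the number of the last matched point -/
  k : ℕ
  one_le_k : 1 ≤ k
  /-- the gluing substitution: `subst i = j ≠ i` if and only if there is a chord joining
  `Q_i` and `Q_j`, and `subst i = i` if and only if no chord ends at `Q_i` -/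
  subst : Fin (k + 1) → Fin (k + 1)
  subst_subst : ∀ i, subst (subst i) = i
  /-- the base point `Q_0` is not the end of a chord -/
  subst_zero : subst 0 = 0
  /-- the color of the arc from `Q_i` to `Q_{i+1}` (from `Q_k` to `Q_0` when `i = k`);
  `true` is black (positive), `false` is grey (negative) -/
  color : Fin (k + 1) → Bool
  /-- the two arcs adjacent to a matched point other than `Q_0` have different colors -/
  color_ne : ∀ i, i ≠ 0 → color (i - 1) ≠ color i

namespace ChordDiagram

/-- There is a chord joining the matched points `Q_i` and `Q_j`. -/
def IsChord (D : ChordDiagram) (i j : Fin (D.k + 1)) : Prop :=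
  i ≠ j ∧ D.subst i = j

/-- A matched point is free if no chord ends at it. -/
def IsFree (D : ChordDiagram) (i : Fin (D.k + 1)) : Prop :=
  ∀ j, ¬ D.IsChord i j

/-- Every chord divides the circle into two arcs, each of which contains an even number of
matched points. -/
def ChordsSplitEvenly (D : ChordDiagram) : Prop :=
  ∀ i j : Fin (D.k + 1), i < j → D.IsChord i j →
    Even {m : Fin (D.k + 1) | i < m ∧ m < j}.ncard ∧
    Even {m : Fin (D.k + 1) | m < i ∨ j < m}.ncard

/-- The number of matched points is `4 n + 2` with `n ≥ 1`, and there are exactly two free points,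
one of which is `Q_0`. -/
def HasTwoFreePoints (D : ChordDiagram) : Prop :=
  (∃ n : ℕ, 1 ≤ n ∧ D.k + 1 = 4 * n + 2) ∧
    ∃ i : Fin (D.k + 1), i ≠ 0 ∧ {m | D.IsFree m} = {0, i}

/-- A full way from `Q_0` to the free point `Q_e`, recorded by the sequence
`w 0, w 1, …, w k` of matched points through which it passes. It visits every matched point exactly
once (injectivity of `w`), it runs alternately along arcs and along chords, beginning with an arc,
and all its arcs are run through in one and the same direction of the circle. -/
def IsFullWay (D : ChordDiagram) (e : Fin (D.k + 1)) (w : Fin (D.k + 1) → Fin (D.k + 1)) : Prop :=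
  Function.Injective w ∧ w 0 = 0 ∧ w (Fin.last D.k) = e ∧
    ∃ d : Fin (D.k + 1), (d = 1 ∨ d = -1) ∧
      ∀ t : Fin D.k,
        (Even (t : ℕ) → w t.succ = w t.castSucc + d) ∧
        (Odd (t : ℕ) → D.IsChord (w t.castSucc) (w t.succ))

/-- There are two different full ways between `Q_0` and another free point. -/
def HasTwoFullWays (D : ChordDiagram) : Prop :=
  ∃ e : Fin (D.k + 1), e ≠ 0 ∧ D.IsFree e ∧
    ∃ w₁ w₂ : Fin (D.k + 1) → Fin (D.k + 1),
      w₁ ≠ w₂ ∧ D.IsFullWay e w₁ ∧ D.IsFullWay e w₂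

end ChordDiagram

/-! ### Functions on surfaces with boundary

A surface is a manifold modelled on the half-plane `EuclideanHalfSpace 2 = {(u₀, u₁) : 0 ≤ u₀}`. -/

section Surface

variable {M : Type*} [TopologicalSpace M] [ChartedSpace (EuclideanHalfSpace 2) M]

variable (M) in
/-- `M` is orientable: it is covered by smooth charts whose transition maps all have
positive Jacobian determinant. -/
def IsOrientableSurface : Prop :=
  ∃ A : Set (OpenPartialHomeomorph M (EuclideanHalfSpace 2)),
    A ⊆ IsManifold.maximalAtlas (𝓡∂ 2) ∞ M ∧
    (∀ x : M, ∃ φ ∈ A, x ∈ φ.source) ∧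
    ∀ φ ∈ A, ∀ ψ ∈ A, ∀ x ∈ φ.source ∩ ψ.source,
      0 < (fderivWithin ℝ (ψ.extend (𝓡∂ 2) ∘ (φ.extend (𝓡∂ 2)).symm)
        (Set.range (𝓡∂ 2)) (φ.extend (𝓡∂ 2) x)).det

/-- The critical points of `f`: the points where the differential vanishes. -/
def criticalPoints (f : M → ℝ) : Set M :=
  {p | mfderiv (𝓡∂ 2) 𝓘(ℝ, ℝ) f p = 0}

/-- The critical points of the restriction of `f` to the boundary: the boundary points `p` at which
the differential of `f` vanishes on the vectors tangent to the boundary. In Mathlib the tangent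
space at `p` is the model space `ℝ²`, through the preferred chart at `p`; that chart takes the
boundary to the line `u₀ = 0`. -/
def boundaryCriticalPoints (f : M → ℝ) : Set M :=
  {p | p ∈ (𝓡∂ 2).boundary M ∧
    ∀ v : EuclideanSpace ℝ (Fin 2), v 0 = 0 → mfderiv (𝓡∂ 2) 𝓘(ℝ, ℝ) f p v = 0}

/-- The isolated points of a set. -/
def isolatedPoints (S : Set M) : Set M :=
  {p | p ∈ S ∧ ∃ U ∈ 𝓝 p, U ∩ S = {p}}

variable (M) in
/-- The class `Ω(M)`: smooth functions whose critical points are isolated, lie on the boundary, and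
are precisely the critical points of the restriction to the boundary (so that the latter are
isolated too). -/
def OmegaClass : Set (M → ℝ) :=
  {f | ContMDiff (𝓡∂ 2) 𝓘(ℝ, ℝ) ∞ f ∧
    criticalPoints f = isolatedPoints (criticalPoints f) ∧
    criticalPoints f = boundaryCriticalPoints f}

/-- `f` has the least number of critical points among all functions of the class `Ω(M)`. -/
def IsOptimal (f : M → ℝ) : Prop :=
  f ∈ OmegaClass M ∧
    ∀ g ∈ OmegaClass M, (criticalPoints f).encard ≤ (criticalPoints g).encard

/-- `f` has at most one critical point on each level. -/
def IsSimpleFunction (f : M → ℝ) : Prop :=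
  Set.InjOn f (criticalPoints f)

/-- A saddle critical point: a critical point that is neither a local minimum nor a local
maximum. -/
def IsSaddle (f : M → ℝ) (p : M) : Prop :=
  p ∈ criticalPoints f ∧ ¬ IsLocalMin f p ∧ ¬ IsLocalMax f p

/-- The complex coordinate `x + i y`, `y ≥ 0`, on the half-plane, with `x = u₁` and `y = u₀`. -/
noncomputable def halfPlaneCoord (u : EuclideanHalfSpace 2) : ℂ :=
  ⟨u.val 1, u.val 0⟩

/-- The angle `(2 j - 1) π / (2 k)`. For `1 ≤ j ≤ k` it is the argument of the `j`-th ray of the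
zero level of `Re (x + i y) ^ k` in the half-plane `y ≥ 0`. -/
noncomputable def rayAngle (k j : ℕ) : ℝ :=
  (2 * (j : ℝ) - 1) * Real.pi / (2 * (k : ℝ))

/-- A polygon neighborhood of `p₀`: the preimage of a half-disk under a topological chart in which
`f` takes the form `f p₀ ± Re (x + i y) ^ k`, `y ≥ 0`. The boundary of the
half-disk is the circle of the chord diagram, and the points where it meets the level of `p₀` are
the matched points: `Q_0 = p₀` at the middle of the diameter and `Q_1, …, Q_k` on the
half-circle, in the order in which they follow each other. Charts reversing the order along
the boundary are allowed: they correspond to the other choice of an orientation of the boundary. -/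
structure PolygonNeighborhood (f : M → ℝ) (p₀ : M) (k : ℕ) where
  chart : OpenPartialHomeomorph M (EuclideanHalfSpace 2)
  mem_source : p₀ ∈ chart.source
  coord_center : halfPlaneCoord (chart p₀) = 0
  sign : ℝ
  sign_eq : sign = 1 ∨ sign = -1
  eq_re : ∀ x ∈ chart.source, f x = f p₀ + sign * (halfPlaneCoord (chart x) ^ k).re
  radius : ℝ
  radius_pos : 0 < radius
  halfDisk_subset : ∀ u, ‖halfPlaneCoord u‖ ≤ radius → u ∈ chart.target
  matched : Fin (k + 1) → M
  matched_zero : matched 0 = p₀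
  matched_mem : ∀ j, matched j ∈ chart.source
  coord_matched : ∀ j, j ≠ 0 → halfPlaneCoord (chart (matched j)) =
    radius * Complex.exp (rayAngle k j * Complex.I)

/-- `D` is the chord diagram of the critical level of the saddle critical point `p₀` of `f` (with
respect to one of the two orientations of the boundary). For a suitable polygon neighborhood of
`p₀`, two matched points are joined by a chord if and only if they are joined by the rest of the
critical level, that is, if and only if the sides of the polygon through them become glued when the
polygon is extended along the level; and an arc is black if `f > f p₀` on it and grey if
`f < f p₀` on it. The arc from `Q_j` to `Q_{j+1}` is seen on the half-circle as its part between
the angles `rayAngle k j` and `rayAngle k (j + 1)`. -/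
def IsChordDiagramOfLevel (D : ChordDiagram) (f : M → ℝ) (p₀ : M) : Prop :=
  ∃ P : PolygonNeighborhood f p₀ D.k,
    (∀ i j : Fin (D.k + 1), i ≠ 0 → j ≠ 0 → i ≠ j →
      (D.IsChord i j ↔ JoinedIn (f ⁻¹' {f p₀} \ {p₀}) (P.matched i) (P.matched j))) ∧
    (∀ j : Fin (D.k + 1), ∀ x ∈ P.chart.source,
      ‖halfPlaneCoord (P.chart x)‖ = P.radius →
      rayAngle D.k j < (halfPlaneCoord (P.chart x)).arg →
      (halfPlaneCoord (P.chart x)).arg < rayAngle D.k ((j : ℕ) + 1) →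
      (D.color j = true → f p₀ < f x) ∧ (D.color j = false → f x < f p₀))

end Surface

/-!
The surface is glued from `k` triangles, one for each matched point other than the base point, the
triangle of `Q_{s + 1}` having the label `s`. All triangles have the same three vertices: `0`, the
future saddle, and `1` and `2`, the future extrema. Two triangles have a common side joining `0` to
`1` or to `2` if their matched points are the ends of an arc, and a common side joining `1` and `2`
if they are the ends of a chord. Around the vertex `0` the triangles therefore follow each other
along the circle; around the vertices `1` and `2` they follow the two full ways, one of them run
through backwards. A full way meets all matched points, so the triangles around each vertex form a
single half-disk: the vertices lie on the boundary, the boundary is one circle, and no further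
vertices arise. That every chord splits the circle evenly means that its ends have different
parity (`ChordDiagram.even_iff_of_isChord`); hence the parity alternates along the full ways, which
makes the gluing compatible with the orientations (`FullWayPair.gluing`).

For the smooth structure, the triangles are alternately mapped to the two hemispheres of the
Riemann sphere, with the vertices on the equator. This gives a map from the surface to the sphere
that is `w ↦ w ^ k` on the half-disk around each vertex. The three half-disks are charts whose
transition functions are branches of `k`-th roots of rational functions, hence holomorphic
(`TriangleGluing.exists_transition`), so the surface is smooth and oriented. For a round metric in
which `1` and `2` are antipodal and `0` is half-way between them, the linear function on the sphere
with the extrema `1` and `2` pulls back to the function `TriangleGluing.height`: its critical points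
are the three vertices, and at the vertex `0` it is, up to a sign and a radial change of the
coordinate (`stretch`), the real part of `w ^ k`. Its
zero level consists of arcs that cross the sides joining `1` and `2`, so two matched points are
joined without passing through the saddle if and only if their triangles have such a side in common
(`TriangleGluing.joinedIn_matched_iff`), that is, if and only if they are joined by a chord
(`FullWayPair.adjacent_iff`).

The height has three critical points, so optimality means that no function in `Ω(M)` has fewer. If
there are only two, they are the minimum and the maximum, every sublevel set is connected, and the part of the
surface below a level is connected near each point of this level. A lift to the line of a function
from the surface to the circle then extends from smaller to larger sublevel sets, so every such
function lifts (`hasLiftOn_of_encard_criticalPoints_lt`). But there is one that does not lift: its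
increments along the sides of the triangles are given by an integral cochain that jumps at the free
point (`FullWayPair.not_hasLiftOn_jump`).
-/

/-! ### Wedges and sectors of the half-disk -/

/-- The involution `η ↦ (1 - η) / (1 + 3 η)`. It exchanges `0` and `1`, fixes `-1`, and reverses
the two half-planes. -/
noncomputable def sideFlip (η : ℂ) : ℂ := (1 - η) / (1 + 3 * η)

/-- The intersection of the unit disk with its image under `sideFlip`. -/
def lens : Set ℂ := {η | Complex.normSq η < 1 ∧ 0 < Complex.normSq η + η.re}

lemma isOpen_lens : IsOpen lens :=
  (isOpen_lt Complex.continuous_normSq continuous_const).inter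
    (isOpen_lt continuous_const (Complex.continuous_normSq.add Complex.continuous_re))

lemma lens_subset_slitPlane : lens ⊆ Complex.slitPlane := by
  intro η ⟨h1, h2⟩
  rw [Complex.mem_slitPlane_iff]
  by_contra! h
  rw [Complex.normSq_apply, h.2] at h1 h2
  nlinarith [h.1]

lemma normSq_one_add_three_mul (η : ℂ) :
    Complex.normSq (1 + 3 * η) = 1 + 6 * η.re + 9 * Complex.normSq η := by
  simp [Complex.normSq_apply]; ring

lemma normSq_one_sub (η : ℂ) :
    Complex.normSq (1 - η) = 1 - 2 * η.re + Complex.normSq η := by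
  simp [Complex.normSq_apply]; ring

lemma normSq_one_add_three_mul_pos {η : ℂ} (h : η ∈ lens) :
    0 < 1 + 6 * η.re + 9 * Complex.normSq η := by
  obtain ⟨h1, h2⟩ := h
  rw [Complex.normSq_apply] at *
  nlinarith [sq_nonneg (3 * η.re + 1)]

lemma one_add_three_mul_ne_zero {η : ℂ} (h : η ∈ lens) : 1 + 3 * η ≠ 0 := by
  have := normSq_one_add_three_mul_pos h
  rw [← normSq_one_add_three_mul] at this
  exact Complex.normSq_pos.1 this

lemma normSq_sideFlip (η : ℂ) : Complex.normSq (sideFlip η) =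
    (1 - 2 * η.re + Complex.normSq η) / (1 + 6 * η.re + 9 * Complex.normSq η) := by
  rw [sideFlip, Complex.normSq_div, normSq_one_sub, normSq_one_add_three_mul]

lemma re_sideFlip (η : ℂ) : (sideFlip η).re =
    (1 + 2 * η.re - 3 * Complex.normSq η) / (1 + 6 * η.re + 9 * Complex.normSq η) := by
  rw [sideFlip, Complex.div_re, normSq_one_add_three_mul, ← add_div]
  congr 1
  simp [Complex.normSq_apply]; ring

lemma im_sideFlip (η : ℂ) : (sideFlip η).im =
    (-4 * η.im) / (1 + 6 * η.re + 9 * Complex.normSq η) := by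
  rw [sideFlip, Complex.div_im, normSq_one_add_three_mul, ← sub_div]
  congr 1
  simp; ring

lemma sideFlip_mem_lens {η : ℂ} (h : η ∈ lens) : sideFlip η ∈ lens := by
  have hp := normSq_one_add_three_mul_pos h
  obtain ⟨h1, h2⟩ := h
  refine ⟨?_, ?_⟩
  · rw [normSq_sideFlip, div_lt_one hp]; linarith
  · rw [normSq_sideFlip, re_sideFlip, ← add_div]
    apply div_pos _ hp; linarith

lemma sideFlip_sideFlip {η : ℂ} (h : η ∈ lens) : sideFlip (sideFlip η) = η := by
  have h1 := one_add_three_mul_ne_zero h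
  have h2 : (4 : ℂ) ≠ 0 := by norm_num
  have e1 : 1 - sideFlip η = 4 * η / (1 + 3 * η) := by
    rw [sideFlip, eq_div_iff h1, sub_mul, div_mul_cancel₀ _ h1]; ring
  have e2 : 1 + 3 * sideFlip η = 4 / (1 + 3 * η) := by
    rw [sideFlip, eq_div_iff h1, add_mul, mul_assoc, div_mul_cancel₀ _ h1]; ring
  rw [sideFlip, e1, e2, div_div_div_cancel_right₀ h1, mul_div_cancel_left₀ _ h2]

/-- The open wedge of the nonzero complex numbers whose argument is less than `π / k` in absolute
value. The `k`-th power maps it bijectively onto the slit plane. -/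
def wedge (k : ℕ) : Set ℂ := {ξ | ξ ≠ 0 ∧ |ξ.arg| < Real.pi / k}

/-- The rotation by `c π / k`. -/
noncomputable def ray (k c : ℕ) : ℂ := Complex.exp (((c * Real.pi / k : ℝ) : ℂ) * Complex.I)

section wedge
variable {k : ℕ}

lemma ray_ne_zero (c : ℕ) : ray k c ≠ 0 := Complex.exp_ne_zero _

lemma norm_ray (c : ℕ) : ‖ray k c‖ = 1 := Complex.norm_exp_ofReal_mul_I _

lemma ray_zero : ray k 0 = 1 := by simp [ray]

lemma ray_self (hk : 0 < k) : ray k k = -1 := by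
  have : ((k : ℝ) * Real.pi / k : ℝ) = Real.pi := by field_simp
  rw [ray, this, Complex.exp_pi_mul_I]

lemma ray_pow (hk : 0 < k) (c : ℕ) : ray k c ^ k = (-1) ^ c := by
  rw [ray, ← Complex.exp_nat_mul, ← Complex.exp_pi_mul_I, ← Complex.exp_nat_mul]
  congr 1
  push_cast
  have : (k : ℂ) ≠ 0 := by exact_mod_cast hk.ne'
  field_simp

lemma wedge_subset_slitPlane (hk : 0 < k) : wedge k ⊆ Complex.slitPlane := by
  intro ξ ⟨h0, h⟩
  rw [Complex.mem_slitPlane_iff_arg]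
  refine ⟨fun h' => ?_, h0⟩
  rw [h', abs_of_pos Real.pi_pos] at h
  have : Real.pi / k ≤ Real.pi := div_le_self Real.pi_pos.le (by exact_mod_cast hk)
  linarith

lemma isOpen_wedge (hk : 0 < k) : IsOpen (wedge k) := by
  have : wedge k = Complex.slitPlane ∩ {ξ | |ξ.arg| < Real.pi / k} := by
    ext ξ
    exact ⟨fun h => ⟨wedge_subset_slitPlane hk h, h.2⟩, fun h => ⟨Complex.slitPlane_ne_zero h.1, h.2⟩⟩
  rw [this]
  have hc : ContinuousOn (fun ξ : ℂ => |ξ.arg|) Complex.slitPlane :=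
    fun x hx => ((Complex.continuousAt_arg hx).abs).continuousWithinAt
  exact hc.isOpen_inter_preimage Complex.isOpen_slitPlane (isOpen_Iio (a := Real.pi / k))

lemma pow_cpow_of_mem_wedge (hk : 0 < k) {ξ : ℂ} (h : ξ ∈ wedge k) :
    (ξ ^ k) ^ ((k : ℂ)⁻¹) = ξ :=
  Complex.pow_cpow_nat_inv hk.ne' (abs_lt.1 h.2).1 (abs_lt.1 h.2).2.le

lemma pow_eq_polar (z : ℂ) : z ^ k = ((‖z‖ ^ k : ℝ) : ℂ) *
    (Complex.exp (((k * z.arg : ℝ) : ℂ) * Complex.I)) := by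
  conv_lhs => rw [← Complex.norm_mul_exp_arg_mul_I z]
  rw [mul_pow, ← Complex.exp_nat_mul]
  push_cast; congr 2; ring

lemma arg_pow_of_mem_wedge (hk : 0 < k) {ξ : ℂ} (h : ξ ∈ wedge k) :
    (ξ ^ k).arg = k * ξ.arg := by
  have hk' : (0 : ℝ) < k := by exact_mod_cast hk
  have h2 := h.2
  rw [abs_lt, ← neg_div, div_lt_iff₀ hk', lt_div_iff₀ hk'] at h2
  rw [pow_eq_polar, Complex.arg_real_mul _ (pow_pos (norm_pos_iff.2 h.1) k),
    Complex.arg_exp_mul_I, toIocMod_eq_self]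
  constructor <;> linarith

lemma root_mem_wedge (hk : 0 < k) {η : ℂ} (h : η ∈ Complex.slitPlane) :
    η ^ ((k : ℂ)⁻¹) ∈ wedge k := by
  have hk' : (0 : ℝ) < k := by exact_mod_cast hk
  have h0 := Complex.slitPlane_ne_zero h
  have hk1 : (1 : ℝ) ≤ k := by exact_mod_cast hk
  obtain ⟨h1, h2⟩ := Complex.arg_mem_Ioc η
  have h3 : η.arg < Real.pi := lt_of_le_of_ne h2 (Complex.mem_slitPlane_iff_arg.1 h).1
  refine ⟨by simp [Complex.cpow_eq_zero_iff, h0], ?_⟩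
  have e : Complex.log η * (k : ℂ)⁻¹ = ((Real.log ‖η‖ / k : ℝ) : ℂ) +
      ((η.arg / k : ℝ) : ℂ) * Complex.I := by
    apply Complex.ext <;> simp [Complex.log, div_eq_mul_inv, ← Complex.ofReal_natCast, ← Complex.ofReal_inv]
  rw [Complex.cpow_def_of_ne_zero h0, e, Complex.exp_add, ← Complex.ofReal_exp,
    Complex.arg_real_mul _ (Real.exp_pos _), Complex.arg_exp_mul_I,
    (toIocMod_eq_self Real.two_pi_pos).2, abs_div, abs_of_pos hk', div_lt_div_iff_of_pos_right hk', abs_lt]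
  · exact ⟨h1, h3⟩
  · constructor
    · rw [lt_div_iff₀ hk']; nlinarith [Real.pi_pos]
    · rw [div_le_iff₀ hk']; nlinarith [Real.pi_pos]

lemma root_pow (hk : 0 < k) (η : ℂ) : (η ^ ((k : ℂ)⁻¹)) ^ k = η :=
  Complex.cpow_nat_inv_pow η hk.ne'

lemma pow_mem_slitPlane (hk : 0 < k) {ξ : ℂ} (h : ξ ∈ wedge k) : ξ ^ k ∈ Complex.slitPlane := by
  rw [Complex.mem_slitPlane_iff_arg, arg_pow_of_mem_wedge hk h]
  have hk' : (0 : ℝ) < k := by exact_mod_cast hk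
  have h2 := (abs_lt.1 h.2).2
  rw [lt_div_iff₀ hk'] at h2
  exact ⟨by linarith, pow_ne_zero _ h.1⟩

lemma arg_nonneg_iff_of_mem_wedge (hk : 0 < k) {ξ : ℂ} (h : ξ ∈ wedge k) :
    0 ≤ ξ.arg ↔ 0 ≤ (ξ ^ k).im := by
  have hk' : (0 : ℝ) < k := by exact_mod_cast hk
  rw [← Complex.arg_nonneg_iff, arg_pow_of_mem_wedge hk h, mul_nonneg_iff_of_pos_left hk']

lemma arg_nonpos_iff_of_mem_wedge (hk : 0 < k) {ξ : ℂ} (h : ξ ∈ wedge k) :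
    ξ.arg ≤ 0 ↔ (ξ ^ k).im ≤ 0 := by
  have hk' : (0 : ℝ) < k := by exact_mod_cast hk
  have hs := pow_mem_slitPlane hk h
  have : ξ.arg ≤ 0 ↔ (ξ ^ k).arg ≤ 0 := by
    rw [arg_pow_of_mem_wedge hk h]
    constructor <;> intro h' <;> nlinarith
  rw [this]
  constructor
  · intro h1
    by_contra! h2
    have := Complex.arg_of_im_pos h2
    have h3 : (ξ ^ k).arg ≠ 0 := fun h0 => by
      rw [Complex.arg_eq_zero_iff] at h0; linarith [h0.2]
    have h4 : 0 ≤ (ξ ^ k).arg := Complex.arg_nonneg_iff.2 h2.le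
    exact h3 (le_antisymm h1 h4)
  · intro h1
    rcases h1.lt_or_eq with h2 | h2
    · exact (Complex.arg_neg_iff.2 h2).le
    · rw [Complex.mem_slitPlane_iff] at hs
      have : (ξ ^ k).arg = 0 := by
        rw [Complex.arg_eq_zero_iff]; exact ⟨(hs.resolve_right (by simpa using h2)).le, h2⟩
      exact this.le

lemma arg_ray_mul (c : ℕ) {ξ : ℂ} (h : ξ ≠ 0)
    (h1 : c * Real.pi / k + ξ.arg ∈ Set.Ioc (-Real.pi) Real.pi) :
    (ray k c * ξ).arg = c * Real.pi / k + ξ.arg := by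
  have : ray k c * ξ = ((‖ξ‖ : ℝ) : ℂ) *
      Complex.exp (((c * Real.pi / k + ξ.arg : ℝ) : ℂ) * Complex.I) := by
    conv_lhs => rw [← Complex.norm_mul_exp_arg_mul_I ξ]
    rw [ray, mul_left_comm, ← Complex.exp_add]
    push_cast; congr 2; ring
  rw [this, Complex.arg_real_mul _ (norm_pos_iff.2 h), Complex.arg_exp_mul_I, toIocMod_eq_self]
  rw [show -Real.pi + 2 * Real.pi = Real.pi by ring]
  exact h1

/-- The closed half-disk without its half-circle. -/
def halfDisk : Set ℂ := {w | 0 ≤ w.im ∧ Complex.normSq w < 1}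

/-- The numbers `s < k` of the closed sectors `s π / k ≤ arg w ≤ (s + 1) π / k` that contain `w`;
the vertex `0` belongs to all of them. -/
def sectors (k : ℕ) (w : ℂ) : Set ℕ :=
  {s | s < k ∧ (w = 0 ∨ (s * Real.pi / k ≤ w.arg ∧ w.arg ≤ (s + 1) * Real.pi / k))}

lemma sectors_nonempty (hk : 0 < k) {w : ℂ} (h : 0 ≤ w.im) : (sectors k w).Nonempty := by
  have hk' : (0 : ℝ) < k := by exact_mod_cast hk
  have h0 : 0 ≤ w.arg := Complex.arg_nonneg_iff.2 h
  have h1 : w.arg ≤ Real.pi := Complex.arg_le_pi w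
  by_cases hw : w.arg = Real.pi
  · refine ⟨k - 1, by omega, Or.inr ?_⟩
    rw [hw, Nat.cast_sub (by omega : 1 ≤ k)]
    constructor
    · rw [div_le_iff₀ hk']; push_cast; nlinarith [Real.pi_pos]
    · rw [le_div_iff₀ hk']; push_cast; nlinarith [Real.pi_pos]
  · have h2 : w.arg < Real.pi := lt_of_le_of_ne h1 hw
    have h3 : 0 ≤ k * w.arg / Real.pi := by positivity
    refine ⟨⌊k * w.arg / Real.pi⌋₊, ?_, Or.inr ⟨?_, ?_⟩⟩
    · rw [Nat.floor_lt h3, div_lt_iff₀ Real.pi_pos]; nlinarith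
    · have := Nat.floor_le h3
      rw [le_div_iff₀ Real.pi_pos] at this
      rw [div_le_iff₀ hk']; linarith
    · have := (Nat.lt_floor_add_one (k * w.arg / Real.pi)).le
      rw [div_le_iff₀ Real.pi_pos] at this
      rw [le_div_iff₀ hk']; linarith

/-- On the sector number `s` the sign of `Im w ^ k` is that of `(-1) ^ s`. -/
lemma im_pow_of_mem_sectors (hk : 0 < k) {w : ℂ} {s : ℕ} (h : s ∈ sectors k w) :
    0 ≤ (-1) ^ s * (w ^ k).im := by
  have hk' : (0 : ℝ) < k := by exact_mod_cast hk
  rcases h.2 with rfl | ⟨h1, h2⟩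
  · simp [hk.ne']
  rw [pow_eq_polar, Complex.im_ofReal_mul, Complex.exp_ofReal_mul_I_im]
  have h4 : (-1) ^ s * Real.sin (k * w.arg) = Real.sin (k * w.arg - s * Real.pi) := by
    rw [Real.sin_sub_nat_mul_pi]
  rw [mul_left_comm, h4]
  apply mul_nonneg (by positivity)
  rw [div_le_iff₀ hk'] at h1
  rw [le_div_iff₀ hk'] at h2
  apply Real.sin_nonneg_of_nonneg_of_le_pi <;> linarith

/-- The power map is injective on each sector. -/
lemma eq_of_pow_eq_of_mem_sectors (hk : 0 < k) {w w' : ℂ} {s : ℕ} (h : s ∈ sectors k w)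
    (h' : s ∈ sectors k w') (hpow : w ^ k = w' ^ k) : w = w' := by
  have hk' : (0 : ℝ) < k := by exact_mod_cast hk
  rcases h.2 with rfl | ⟨h1, h2⟩
  · rw [zero_pow hk.ne'] at hpow
    exact (pow_eq_zero_iff hk.ne').1 hpow.symm |>.symm
  rcases h'.2 with rfl | ⟨h1', h2'⟩
  · rw [zero_pow hk.ne'] at hpow
    exact (pow_eq_zero_iff hk.ne').1 hpow
  by_cases hw : w = 0
  · subst hw
    rw [zero_pow hk.ne'] at hpow
    exact (pow_eq_zero_iff hk.ne').1 hpow.symm |>.symm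
  have hw' : w' ≠ 0 := fun h => hw (by
    subst h; rw [zero_pow hk.ne'] at hpow; exact (pow_eq_zero_iff hk.ne').1 hpow)
  have hn : ‖w‖ = ‖w'‖ := by
    have := congrArg norm hpow
    rw [norm_pow, norm_pow] at this
    exact (pow_left_inj₀ (norm_nonneg _) (norm_nonneg _) hk.ne').1 this
  rw [pow_eq_polar w, pow_eq_polar w', hn] at hpow
  have h5 : ((‖w'‖ ^ k : ℝ) : ℂ) ≠ 0 := by
    exact_mod_cast (pow_pos (norm_pos_iff.2 hw') k).ne'
  have h6 := mul_left_cancel₀ h5 hpow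
  rw [Complex.exp_eq_exp_iff_exists_int] at h6
  obtain ⟨n, hn'⟩ := h6
  have h7 : (k : ℝ) * w.arg = k * w'.arg + n * (2 * Real.pi) := by
    have := congrArg Complex.im hn'
    simpa using this
  rw [div_le_iff₀ hk'] at h1 h1'
  rw [le_div_iff₀ hk'] at h2 h2'
  have hn0 : n = 0 := by
    have a1 : (n : ℝ) < 1 := by
      by_contra! hc
      nlinarith [Real.pi_pos]
    have a2 : (-1 : ℝ) < n := by
      by_contra! hc
      nlinarith [Real.pi_pos]
    have b1 : n < 1 := by exact_mod_cast a1
    have b2 : -1 < n := by exact_mod_cast a2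
    omega
  rw [hn0] at h7
  have h8 : w.arg = w'.arg := by
    have : (k : ℝ) * w.arg = k * w'.arg := by simpa using h7
    exact mul_left_cancel₀ hk'.ne' this
  rw [← Complex.norm_mul_exp_arg_mul_I w, ← Complex.norm_mul_exp_arg_mul_I w', hn, h8]

/-- A nonzero point of the closed half-plane at which `(-1) ^ p * w ^ k` is not a negative number is
close to one of the rays with the parity of `p`. -/
lemma exists_eq_ray_mul (hk : 1 < k) {w : ℂ} (hw : w ≠ 0) (him : 0 ≤ w.im) {p : ℕ}
    (hp : (-1) ^ p * w ^ k ∈ Complex.slitPlane) :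
    ∃ c ≤ k, (Even c ↔ Even p) ∧ ∃ ξ ∈ wedge k, w = ray k c * ξ := by
  have hk' : (0 : ℝ) < k := by exact_mod_cast (by omega : 0 < k)
  have hk1 : (1 : ℝ) < k := by exact_mod_cast hk
  obtain ⟨s, hs, h⟩ := sectors_nonempty (by omega : 0 < k) him
  have h := h.resolve_left hw
  obtain ⟨c, hck, hcp, hc1, hc2⟩ : ∃ c ≤ k, (Even c ↔ Even p) ∧
      (c - 1 : ℝ) ≤ s ∧ (s : ℝ) ≤ c := by
    by_cases hsp : Even s ↔ Even p
    · exact ⟨s, hs.le, hsp, by linarith, le_rfl⟩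
    · refine ⟨s + 1, hs, ?_, by push_cast; linarith, by push_cast; linarith⟩
      rw [Nat.even_add_one]; tauto
  have h1 := h.1
  have h2 := h.2
  rw [div_le_iff₀ hk'] at h1
  rw [le_div_iff₀ hk'] at h2
  set a : ℝ := w.arg - c * Real.pi / k with ha
  have hka : k * a = k * w.arg - c * Real.pi := by rw [ha]; field_simp
  set ξ : ℂ := ((‖w‖ : ℝ) : ℂ) * Complex.exp ((a : ℂ) * Complex.I) with hξ
  have hwξ : w = ray k c * ξ := by
    conv_lhs => rw [← Complex.norm_mul_exp_arg_mul_I w]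
    rw [hξ, ray, mul_left_comm, ← Complex.exp_add, ha]
    push_cast; congr 2; ring
  have hn : 0 < ‖w‖ := norm_pos_iff.2 hw
  have hbd : |k * a| ≤ Real.pi := by
    -- on the sector number `s` the index `c` is either `s` or `s + 1`
    have hcs : c = s ∨ c = s + 1 := by
      have e1 : c ≤ s + 1 := by
        have : (c : ℝ) ≤ ((s + 1 : ℕ) : ℝ) := by push_cast; linarith
        exact_mod_cast this
      have e2 : s ≤ c := by exact_mod_cast hc2
      omega
    rw [abs_le, hka]
    rcases hcs with rfl | rfl
    · constructor <;> nlinarith [Real.pi_pos]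
    · push_cast; constructor <;> nlinarith [Real.pi_pos]
  have hmem : a ∈ Set.Ioc (-Real.pi) (-Real.pi + 2 * Real.pi) := by
    rw [abs_le] at hbd
    constructor <;> nlinarith [Real.pi_pos]
  have harg : ξ.arg = a := by
    rw [hξ, Complex.arg_real_mul _ hn, Complex.arg_exp_mul_I, toIocMod_eq_self]
    exact hmem
  have hξ0 : ξ ≠ 0 := fun h0 => hw (by rw [hwξ, h0, mul_zero])
  refine ⟨c, hck, hcp, ξ, ⟨hξ0, ?_⟩, hwξ⟩
  have hpc : (-1 : ℂ) ^ p = (-1) ^ c := by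
    rcases Nat.even_or_odd p with h' | h'
    · rw [h'.neg_one_pow, (hcp.2 h').neg_one_pow]
    · rw [h'.neg_one_pow, Odd.neg_one_pow]
      rw [← Nat.not_even_iff_odd] at h' ⊢; tauto
  rw [hpc, hwξ, mul_pow, ray_pow (by omega), ← mul_assoc, ← mul_pow] at hp
  rw [neg_one_mul, neg_neg, one_pow, one_mul, pow_eq_polar, harg] at hp
  rw [harg, lt_div_iff₀ hk', ← abs_of_pos hk', ← abs_mul, mul_comm]
  refine lt_of_le_of_ne hbd fun he => ?_
  have hsin : Real.sin (k * a) = 0 := by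
    rcases eq_or_eq_neg_of_abs_eq he with h' | h' <;> simp [h']
  have hcos : Real.cos (k * a) = -1 := by
    rcases eq_or_eq_neg_of_abs_eq he with h' | h' <;> simp [h']
  rw [Complex.mem_slitPlane_iff, Complex.re_ofReal_mul, Complex.im_ofReal_mul,
    Complex.exp_ofReal_mul_I_re, Complex.exp_ofReal_mul_I_im, hsin, hcos] at hp
  rcases hp with hp | hp
  · have : 0 < ‖ξ‖ ^ k := pow_pos (norm_pos_iff.2 hξ0) k
    linarith
  · simp at hp

lemma wedge_arg_le (hk : 0 < k) {ξ : ℂ} (h : ξ ∈ wedge k) : |ξ.arg| < Real.pi := by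
  refine h.2.trans_le (div_le_self Real.pi_pos.le (by exact_mod_cast hk))

lemma arg_nonpos_of_im_nonpos (hk : 0 < k) {ξ : ℂ} (h : ξ ∈ wedge k) (h1 : ξ.im ≤ 0) :
    ξ.arg ≤ 0 := by
  rcases h1.lt_or_eq with h2 | h2
  · exact (Complex.arg_neg_iff.2 h2).le
  · have hs := wedge_subset_slitPlane hk h
    rw [Complex.mem_slitPlane_iff] at hs
    exact (Complex.arg_eq_zero_iff.2 ⟨(hs.resolve_right (by simpa using h2)).le, h2⟩).le

/-- The argument of a point of the half-disk close to the ray number `c`. -/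
lemma arg_ray_mul_of_mem_wedge (hk : 0 < k) {c : ℕ} (hc : c ≤ k) {ξ : ℂ} (h : ξ ∈ wedge k)
    (h0 : c = k → ξ.arg ≤ 0) :
    (ray k c * ξ).arg = c * Real.pi / k + ξ.arg := by
  have hk' : (0 : ℝ) < k := by exact_mod_cast hk
  apply arg_ray_mul c h.1
  have h1 := abs_lt.1 (wedge_arg_le hk h)
  have h2 := (abs_lt.1 h.2).2
  have h3 : 0 ≤ c * Real.pi / k := by positivity
  refine ⟨by linarith, ?_⟩
  rcases hc.eq_or_lt with rfl | hlt
  · have := h0 rfl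
    rw [mul_div_cancel_left₀ _ hk'.ne']; linarith
  · have h4 : (c + 1 : ℝ) * Real.pi / k ≤ Real.pi := by
      rw [div_le_iff₀ hk']
      have : (c + 1 : ℝ) ≤ k := by exact_mod_cast hlt
      nlinarith [Real.pi_pos]
    rw [add_mul, one_mul, add_div] at h4
    linarith

lemma im_ray_mul_nonneg_iff (hk : 0 < k) {c : ℕ} (hc : c ≤ k) {ξ : ℂ} (h : ξ ∈ wedge k) :
    0 ≤ (ray k c * ξ).im ↔ (c = 0 → 0 ≤ ξ.arg) ∧ (c = k → ξ.arg ≤ 0) := by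
  have hk' : (0 : ℝ) < k := by exact_mod_cast hk
  have hlast : 0 ≤ (ray k c * ξ).im → c = k → ξ.arg ≤ 0 := by
    rintro h1 rfl
    rw [ray_self hk] at h1
    exact arg_nonpos_of_im_nonpos hk h (by simpa using h1)
  constructor
  · intro h1
    refine ⟨?_, hlast h1⟩
    rintro rfl
    rw [ray_zero, one_mul] at h1
    exact Complex.arg_nonneg_iff.2 h1
  · rintro ⟨h1, h2⟩
    rw [← Complex.arg_nonneg_iff, arg_ray_mul_of_mem_wedge hk hc h h2]
    rcases Nat.eq_zero_or_pos c with h3 | h3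
    · have := h1 h3; positivity
    · have h4 := (abs_lt.1 h.2).1
      have : Real.pi / k ≤ c * Real.pi / k := by
        rw [div_le_div_iff_of_pos_right hk']
        have : (1 : ℝ) ≤ c := by exact_mod_cast h3
        nlinarith [Real.pi_pos]
      linarith

/-- A point near the ray `c` lies in the sector before it or in the sector after it. -/
lemma mem_sectors_ray_mul (hk : 0 < k) {c : ℕ} (hc : c ≤ k) {ξ : ℂ} (h : ξ ∈ wedge k)
    (him : 0 ≤ (ray k c * ξ).im) (s : ℕ) :
    s ∈ sectors k (ray k c * ξ) ↔
      s < k ∧ ((s = c ∧ 0 ≤ ξ.arg) ∨ (s + 1 = c ∧ ξ.arg ≤ 0)) := by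
  have hk' : (0 : ℝ) < k := by exact_mod_cast hk
  have h0 : ray k c * ξ ≠ 0 := mul_ne_zero (ray_ne_zero c) h.1
  have hlt := abs_lt.1 h.2
  rw [lt_div_iff₀ hk', ← neg_div, div_lt_iff₀ hk'] at hlt
  rw [sectors, Set.mem_ofPred_eq, arg_ray_mul_of_mem_wedge hk hc h
    ((im_ray_mul_nonneg_iff hk hc h).1 him).2]
  simp only [h0, false_or]
  refine and_congr_right fun _ => ?_
  have e : c * Real.pi / k + ξ.arg = (c * Real.pi + ξ.arg * k) / k := by field_simp
  rw [e, div_le_div_iff_of_pos_right hk', div_le_div_iff_of_pos_right hk']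
  have hpi := Real.pi_pos
  constructor
  · rintro ⟨h1, h2⟩
    have a1 : s < c + 1 := by
      have : (s : ℝ) < (c + 1 : ℕ) := by push_cast; nlinarith
      exact_mod_cast this
    have a2 : c < s + 2 := by
      have : (c : ℝ) < (s + 2 : ℕ) := by push_cast; nlinarith
      exact_mod_cast this
    have : s = c ∨ s + 1 = c := by omega
    rcases this with rfl | rfl
    · left; exact ⟨rfl, by nlinarith⟩
    · right; refine ⟨rfl, ?_⟩
      push_cast at *; nlinarith
  · rintro (⟨rfl, h1⟩ | ⟨rfl, h1⟩)
    · constructor <;> nlinarith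
    · push_cast; constructor <;> nlinarith

/-- The transition function between two half-disks, in coordinates rotated so that the common
ray is the positive real axis. -/
noncomputable def sideRoot (k : ℕ) (ξ : ℂ) : ℂ := sideFlip (ξ ^ k) ^ ((k : ℂ)⁻¹)

lemma sideRoot_mem_wedge (hk : 0 < k) {ξ : ℂ} (h : ξ ^ k ∈ lens) : sideRoot k ξ ∈ wedge k :=
  root_mem_wedge hk (lens_subset_slitPlane (sideFlip_mem_lens h))

lemma sideRoot_pow (hk : 0 < k) (ξ : ℂ) : sideRoot k ξ ^ k = sideFlip (ξ ^ k) := root_pow hk _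

lemma sideRoot_arg_nonneg_iff (hk : 0 < k) {ξ : ℂ} (h : ξ ∈ wedge k) (hl : ξ ^ k ∈ lens) :
    0 ≤ (sideRoot k ξ).arg ↔ ξ.arg ≤ 0 := by
  have hp := normSq_one_add_three_mul_pos hl
  rw [arg_nonneg_iff_of_mem_wedge hk (sideRoot_mem_wedge hk hl), sideRoot_pow hk,
    arg_nonpos_iff_of_mem_wedge hk h, im_sideFlip, le_div_iff₀ hp]
  constructor <;> intro <;> linarith

lemma sideRoot_arg_nonpos_iff (hk : 0 < k) {ξ : ℂ} (h : ξ ∈ wedge k) (hl : ξ ^ k ∈ lens) :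
    (sideRoot k ξ).arg ≤ 0 ↔ 0 ≤ ξ.arg := by
  have hp := normSq_one_add_three_mul_pos hl
  rw [arg_nonpos_iff_of_mem_wedge hk (sideRoot_mem_wedge hk hl), sideRoot_pow hk,
    arg_nonneg_iff_of_mem_wedge hk h, im_sideFlip, div_le_iff₀ hp]
  constructor <;> intro <;> linarith

lemma normSq_ray_mul_lt_one_iff (hk : 0 < k) (c : ℕ) (ξ : ℂ) :
    Complex.normSq (ray k c * ξ) < 1 ↔ Complex.normSq (ξ ^ k) < 1 := by
  rw [map_mul, map_pow, Complex.normSq_eq_norm_sq (ray k c), norm_ray, one_pow, one_mul]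
  exact (pow_lt_one_iff_of_nonneg (Complex.normSq_nonneg _) hk.ne').symm

end wedge

/-! ### Gluing data and the surface as a set -/

/-- Combinatorial data for a surface glued from `k` triangles with three common vertices `0, 1, 2`.
The triangles around the vertex `v` form a half-disk, in which they are listed in counterclockwise
order as `tri v 0, …, tri v (k - 1)`; they are separated by the rays `0, …, k`, the rays `0` and `k`
lying on the boundary. The even rays at `v` go to the vertex `v + 1`, the odd ones to `v + 2`.
The field `link` says that a ray `c` at `v` is a ray `c'` at the other end, with the
same triangles on its two sides. -/
structure TriangleGluing where
  /-- the number of triangles -/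
  k : ℕ
  odd_k : Odd k
  three_le_k : 3 ≤ k
  /-- the triangle in the sector number `s` at the vertex `v` -/
  tri : Fin 3 → ℕ → ℕ
  injOn_tri : ∀ v, Set.InjOn (tri v) (Set.Iio k)
  link : ∀ v c, c ≤ k → ∃ c' ≤ k, (Even c' ↔ ¬ Even c) ∧ (c < k ↔ 0 < c') ∧ (0 < c ↔ c' < k) ∧
    (c < k → tri v c = tri (if Even c then v + 1 else v + 2) (c' - 1)) ∧
    (0 < c → tri v (c - 1) = tri (if Even c then v + 1 else v + 2) c')

/-- Three functions on the Riemann sphere, in the coordinate `b` in which the vertices `v`, `v + 1`,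
`v + 2` are `0, 1, -1`. If the vertices are equidistant points of the equator of the round sphere,
then the value at `v` is `(1 + ⟪x, v⟫) / 2`. -/
noncomputable def weights (v : Fin 3) (b : ℂ) (j : Fin 3) : ℝ :=
  if j = v then 1 / (1 + 3 * Complex.normSq b)
  else if j = v + 1 then
    3 / 4 - 1 / (1 + 3 * Complex.normSq b) / 2 + 3 / 2 * b.re * (1 / (1 + 3 * Complex.normSq b))
  else 3 / 4 - 1 / (1 + 3 * Complex.normSq b) / 2 - 3 / 2 * b.re * (1 / (1 + 3 * Complex.normSq b))

section weights
variable (v : Fin 3) (b : ℂ)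

lemma weights_self : weights v b v = 1 / (1 + 3 * Complex.normSq b) := by simp [weights]

lemma weights_add_one : weights v b (v + 1) =
    3 / 4 - 1 / (1 + 3 * Complex.normSq b) / 2 +
      3 / 2 * b.re * (1 / (1 + 3 * Complex.normSq b)) := by
  have : v + 1 ≠ v := by fin_cases v <;> decide
  simp [weights]

lemma weights_add_two : weights v b (v + 2) =
    3 / 4 - 1 / (1 + 3 * Complex.normSq b) / 2 -
      3 / 2 * b.re * (1 / (1 + 3 * Complex.normSq b)) := by
  have : v + 2 ≠ v := by fin_cases v <;> decide
  have : v + 2 ≠ v + 1 := by fin_cases v <;> decide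
  simp [weights]

lemma one_add_three_normSq_pos : 0 < 1 + 3 * Complex.normSq b := by
  have := Complex.normSq_nonneg b; positivity

lemma quarter_lt_weights_self : 1 / 4 < weights v b v ↔ Complex.normSq b < 1 := by
  rw [weights_self, div_lt_div_iff₀ (by norm_num) (one_add_three_normSq_pos b)]
  constructor <;> intro <;> linarith

lemma quarter_lt_weights_add_one :
    1 / 4 < weights v b (v + 1) ↔ 0 < Complex.normSq b + b.re := by
  have h := one_add_three_normSq_pos b
  have e : weights v b (v + 1) - 1 / 4 =
      3 / 2 * (Complex.normSq b + b.re) / (1 + 3 * Complex.normSq b) := by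
    rw [weights_add_one]; field_simp; ring
  rw [← sub_pos, e, div_pos_iff_of_pos_right h]
  constructor <;> intro <;> linarith

lemma quarter_lt_weights_add_two :
    1 / 4 < weights v b (v + 2) ↔ 0 < Complex.normSq b - b.re := by
  have h := one_add_three_normSq_pos b
  have e : weights v b (v + 2) - 1 / 4 =
      3 / 2 * (Complex.normSq b - b.re) / (1 + 3 * Complex.normSq b) := by
    rw [weights_add_two]; field_simp; ring
  rw [← sub_pos, e, div_pos_iff_of_pos_right h]
  constructor <;> intro <;> linarith

lemma sum_weights : weights v b 0 + weights v b 1 + weights v b 2 = 3 / 2 := by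
  have : weights v b v + weights v b (v + 1) + weights v b (v + 2) = 3 / 2 := by
    rw [weights_self, weights_add_one, weights_add_two]; ring
  fin_cases v <;> simp at this ⊢ <;> linarith

lemma continuous_weights (j : Fin 3) : Continuous fun b => weights v b j := by
  have h : ∀ b : ℂ, 1 + 3 * Complex.normSq b ≠ 0 := fun b => (one_add_three_normSq_pos b).ne'
  have hd : Continuous fun b : ℂ => 1 / (1 + 3 * Complex.normSq b) :=
    continuous_const.div (continuous_const.add
      (continuous_const.mul Complex.continuous_normSq)) h
  unfold weights
  split_ifs
  · exact hd
  · have := Complex.continuous_re; fun_prop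
  · have := Complex.continuous_re; fun_prop

/-- The weights are compatible with the change of the coordinate from `v` to `v + 1`. -/
lemma weights_sideFlip {η : ℂ} (h : η ∈ lens) :
    weights (v + 1) (-sideFlip η) = weights v η := by
  have hp := normSq_one_add_three_mul_pos h
  have hq := one_add_three_normSq_pos η
  have e : 1 + 3 * Complex.normSq (-sideFlip η) =
      4 * (1 + 3 * Complex.normSq η) / (1 + 6 * η.re + 9 * Complex.normSq η) := by
    rw [Complex.normSq_neg, normSq_sideFlip]
    generalize hP : 1 + 6 * η.re + 9 * Complex.normSq η = P at *
    have := hp.ne'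
    field_simp; rw [← hP]; ring
  have h1 : weights (v + 1) (-sideFlip η) (v + 1) = weights v η (v + 1) := by
    rw [weights_self, weights_add_one, e]; field_simp; ring
  have h2 : weights (v + 1) (-sideFlip η) (v + 1 + 1) = weights v η (v + 2) := by
    rw [weights_add_one, weights_add_two, e, Complex.neg_re, re_sideFlip]
    generalize hP : 1 + 6 * η.re + 9 * Complex.normSq η = P at *
    have := hp.ne'
    field_simp; rw [← hP]; ring
  have h3 : weights (v + 1) (-sideFlip η) (v + 1 + 2) = weights v η v := by
    rw [weights_add_two, weights_self, e, Complex.neg_re, re_sideFlip]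
    generalize hP : 1 + 6 * η.re + 9 * Complex.normSq η = P at *
    have := hp.ne'
    field_simp; rw [← hP]; ring
  funext j
  fin_cases v <;> fin_cases j <;> first | exact h1 | exact h2 | exact h3

/-- The weights are compatible with the change of the coordinate from `v` to `v + 2`. -/
lemma weights_sideFlip' {η : ℂ} (h : η ∈ lens) :
    weights (v + 2) (sideFlip η) = weights v (-η) := by
  have := weights_sideFlip (v + 2) (sideFlip_mem_lens h)
  rw [sideFlip_sideFlip h] at this
  rw [← this]
  congr 1
  fin_cases v <;> rfl

end weights

lemma weights_injective {v : Fin 3} {b b' : ℂ} (h : weights v b = weights v b') :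
    Complex.normSq b = Complex.normSq b' ∧ b.re = b'.re := by
  have h0 := congrFun h v
  have h1 := congrFun h (v + 1)
  rw [weights_self, weights_self] at h0
  have hn : Complex.normSq b = Complex.normSq b' := by
    have := one_add_three_normSq_pos b
    have := one_add_three_normSq_pos b'
    rw [one_div, one_div, inv_inj] at h0
    linarith
  refine ⟨hn, ?_⟩
  rw [weights_add_one, weights_add_one, hn] at h1
  have hp : 0 < 1 / (1 + 3 * Complex.normSq b') := one_div_pos.2 (one_add_three_normSq_pos b')
  have h2 : b.re * (1 / (1 + 3 * Complex.normSq b')) = b'.re * (1 / (1 + 3 * Complex.normSq b')) := by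
    linarith
  exact mul_right_cancel₀ hp.ne' h2

namespace TriangleGluing
variable (G : TriangleGluing)

lemma k_pos : 0 < G.k := lt_of_lt_of_le (by norm_num) G.three_le_k

/-- The invariants of the point with the coordinate `w` in the half-disk at the vertex `v`: its
position on the sphere (up to reflection in the equator) and the set of triangles that contain
it. -/
noncomputable def key (v : Fin 3) (w : ℂ) : (Fin 3 → ℝ) × Set ℕ :=
  (weights v (w ^ G.k), G.tri v '' sectors G.k w)

/-- The surface glued from the triangles. Its points are represented by their invariants. -/
@[ext] structure Surface where
  /-- the invariants of the point -/
  inv : (Fin 3 → ℝ) × Set ℕ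
  exists_key : ∃ v, ∃ w ∈ halfDisk, inv = G.key v w

lemma zero_mem_halfDisk : (0 : ℂ) ∈ halfDisk := by simp [halfDisk]

open Classical in
/-- The point with the coordinate `w` in the half-disk at the vertex `v` (the vertex itself if `w`
is outside the half-disk). -/
noncomputable def point (v : Fin 3) (w : ℂ) : G.Surface :=
  if h : w ∈ halfDisk then ⟨G.key v w, v, w, h, rfl⟩
  else ⟨G.key v 0, v, 0, zero_mem_halfDisk, rfl⟩

/-- The three weights of a point of the surface. -/
def weight (P : G.Surface) (j : Fin 3) : ℝ := P.inv.1 j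

/-- The set of triangles that contain a point of the surface. -/
def triangles (P : G.Surface) : Set ℕ := P.inv.2

variable {G}

lemma point_val {v : Fin 3} {w : ℂ} (h : w ∈ halfDisk) : (G.point v w).inv = G.key v w := by
  rw [point, dif_pos h]

lemma exists_eq_point (P : G.Surface) : ∃ v, ∃ w ∈ halfDisk, P = G.point v w := by
  obtain ⟨v, w, h, hP⟩ := P.exists_key
  exact ⟨v, w, h, Surface.ext (by rw [hP, point_val h])⟩

lemma weight_point {v : Fin 3} {w : ℂ} (h : w ∈ halfDisk) :
    G.weight (G.point v w) = weights v (w ^ G.k) := by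
  funext j; rw [weight, point_val h]; rfl

lemma triangles_point {v : Fin 3} {w : ℂ} (h : w ∈ halfDisk) :
    G.triangles (G.point v w) = G.tri v '' sectors G.k w := by
  rw [triangles, point_val h]; rfl

lemma point_ext_iff {v v' : Fin 3} {w w' : ℂ} (h : w ∈ halfDisk) (h' : w' ∈ halfDisk) :
    G.point v w = G.point v' w' ↔ weights v (w ^ G.k) = weights v' (w' ^ G.k) ∧
      G.tri v '' sectors G.k w = G.tri v' '' sectors G.k w' := by
  rw [Surface.ext_iff, point_val h, point_val h', key, key, Prod.mk_inj]

lemma injOn_point (v : Fin 3) : Set.InjOn (G.point v) halfDisk := by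
  intro w h w' h' heq
  obtain ⟨h1, h2⟩ := (point_ext_iff h h').1 heq
  obtain ⟨hn, hre⟩ := weights_injective h1
  obtain ⟨s, hs⟩ := sectors_nonempty G.k_pos h.1
  obtain ⟨s', hs', hss⟩ : G.tri v s ∈ G.tri v '' sectors G.k w' := h2 ▸ ⟨s, hs, rfl⟩
  have := G.injOn_tri v hs'.1 hs.1 hss
  subst this
  refine eq_of_pow_eq_of_mem_sectors G.k_pos hs hs' (Complex.ext hre ?_)
  have i1 := im_pow_of_mem_sectors G.k_pos hs
  have i2 := im_pow_of_mem_sectors G.k_pos hs'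
  rw [Complex.normSq_apply, Complex.normSq_apply, hre] at hn
  have hsq : (w ^ G.k).im * (w ^ G.k).im = (w' ^ G.k).im * (w' ^ G.k).im := by linarith
  rcases mul_self_eq_mul_self_iff.1 hsq with h3 | h3
  · exact h3
  · rcases Nat.even_or_odd s' with he | he
    · rw [he.neg_one_pow] at i1 i2; linarith
    · rw [he.neg_one_pow] at i1 i2; linarith

/-- The vertex at the other end of the ray number `c` at the vertex `v`. -/
def opposite (v : Fin 3) (c : ℕ) : Fin 3 := if Even c then v + 1 else v + 2

lemma pow_mul_pow_ray (G : TriangleGluing) (c : ℕ) (ξ : ℂ) :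
    (ray G.k c * ξ) ^ G.k = (-1) ^ c * ξ ^ G.k := by
  rw [mul_pow, ray_pow G.k_pos]

/-- The change of coordinates along a ray. -/
lemma exists_ray_transition (v : Fin 3) {c : ℕ} (hc : c ≤ G.k) :
    ∃ c' ≤ G.k, (Even c' ↔ ¬ Even c) ∧ (0 < c ↔ c' < G.k) ∧ (c < G.k ↔ 0 < c') ∧
      ∀ ξ ∈ wedge G.k, ξ ^ G.k ∈ lens →
      ray G.k c * ξ ∈ halfDisk → ray G.k c' * sideRoot G.k ξ ∈ halfDisk ∧
        G.point v (ray G.k c * ξ) = G.point (opposite v c) (ray G.k c' * sideRoot G.k ξ) := by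
  obtain ⟨c', hc', hpar, hl1, hl2, ht1, ht2⟩ := G.link v c hc
  refine ⟨c', hc', hpar, hl2, hl1, fun ξ hξ hlens hw => ?_⟩
  have hk := G.k_pos
  have hξ' := sideRoot_mem_wedge hk hlens
  have a1 := sideRoot_arg_nonneg_iff hk hξ hlens
  have a2 := sideRoot_arg_nonpos_iff hk hξ hlens
  have him := (im_ray_mul_nonneg_iff hk hc hξ).1 hw.1
  have him' : 0 ≤ (ray G.k c' * sideRoot G.k ξ).im := by
    rw [im_ray_mul_nonneg_iff hk hc' hξ', a1, a2]
    exact ⟨fun h => him.2 (by omega), fun h => him.1 (by omega)⟩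
  have hw' : ray G.k c' * sideRoot G.k ξ ∈ halfDisk := by
    refine ⟨him', ?_⟩
    rw [normSq_ray_mul_lt_one_iff hk, sideRoot_pow hk]
    exact (sideFlip_mem_lens hlens).1
  refine ⟨hw', (point_ext_iff hw hw').2 ⟨?_, ?_⟩⟩
  · rw [pow_mul_pow_ray, pow_mul_pow_ray, sideRoot_pow hk, opposite]
    by_cases he : Even c
    · have ho : Odd c' := Nat.not_even_iff_odd.1 fun h => hpar.1 h he
      rw [if_pos he, he.neg_one_pow, ho.neg_one_pow, one_mul, neg_one_mul, weights_sideFlip v hlens]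
    · have ho : Odd c := Nat.not_even_iff_odd.1 he
      rw [if_neg he, ho.neg_one_pow, (hpar.2 he).neg_one_pow, one_mul, neg_one_mul,
        weights_sideFlip' v hlens]
  · have hv : (if Even c then v + 1 else v + 2) = opposite v c := rfl
    rw [hv] at ht1 ht2
    ext t
    simp only [Set.mem_image, mem_sectors_ray_mul hk hc hξ hw.1,
      mem_sectors_ray_mul hk hc' hξ' him', a1, a2]
    constructor
    · rintro ⟨s, ⟨hs, ⟨rfl, h⟩ | ⟨hsc, h⟩⟩, rfl⟩
      · have h0 := hl1.1 hs
        exact ⟨c' - 1, ⟨by omega, Or.inr ⟨by omega, h⟩⟩, (ht1 hs).symm⟩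
      · subst hsc
        exact ⟨c', ⟨hl2.1 (by omega), Or.inl ⟨rfl, h⟩⟩, (ht2 (by omega)).symm⟩
    · rintro ⟨s, ⟨hs, ⟨rfl, h⟩ | ⟨hsc, h⟩⟩, rfl⟩
      · have h0 := hl2.2 hs
        exact ⟨c - 1, ⟨by omega, Or.inr ⟨by omega, h⟩⟩, ht2 h0⟩
      · subst hsc
        exact ⟨c, ⟨hl1.2 (by omega), Or.inl ⟨rfl, h⟩⟩, ht1 (hl1.2 (by omega))⟩

/-- A point of the half-disk at `v` that also belongs to the half-disk at another vertex is close
to one of the rays between the two vertices. -/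
lemma exists_ray_of_weight {v v' : Fin 3} (hv : v' ≠ v) {w : ℂ} (hw : w ∈ halfDisk)
    (h : 1 / 4 < weights v (w ^ G.k) v') :
    ∃ c ≤ G.k, opposite v c = v' ∧ ∃ ξ ∈ wedge G.k, ξ ^ G.k ∈ lens ∧ w = ray G.k c * ξ := by
  have hk := G.k_pos
  have hn : Complex.normSq (w ^ G.k) < 1 := by
    rw [map_pow]; exact pow_lt_one₀ (Complex.normSq_nonneg _) hw.2 hk.ne'
  have hw0 : w ≠ 0 := by
    rintro rfl
    rw [zero_pow hk.ne'] at h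
    have : v' = v + 1 ∨ v' = v + 2 := by revert hv; fin_cases v <;> fin_cases v' <;> decide
    rcases this with rfl | rfl
    · rw [quarter_lt_weights_add_one] at h; simp at h
    · rw [quarter_lt_weights_add_two] at h; simp at h
  obtain ⟨p, hp, hop⟩ : ∃ p : ℕ, (-1) ^ p * w ^ G.k ∈ lens ∧
      (∀ c, (Even c ↔ Even p) → opposite v c = v') := by
    have : v' = v + 1 ∨ v' = v + 2 := by revert hv; fin_cases v <;> fin_cases v' <;> decide
    rcases this with rfl | rfl
    · rw [quarter_lt_weights_add_one] at h
      exact ⟨0, by rw [pow_zero, one_mul]; exact ⟨hn, h⟩, fun c hc => by simp [opposite, hc]⟩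
    · rw [quarter_lt_weights_add_two] at h
      refine ⟨1, ?_, fun c hc => by simp [opposite, hc]⟩
      rw [pow_one, neg_one_mul]
      exact ⟨by rwa [Complex.normSq_neg], by rw [Complex.normSq_neg, Complex.neg_re]; linarith⟩
  obtain ⟨c, hc, hcp, ξ, hξ, rfl⟩ := exists_eq_ray_mul (by have := G.three_le_k; omega) hw0 hw.1
    (lens_subset_slitPlane hp)
  refine ⟨c, hc, hop c hcp, ξ, hξ, ?_, rfl⟩
  have : (-1 : ℂ) ^ p * (-1) ^ c = 1 := by
    rcases Nat.even_or_odd p with h' | h'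
    · rw [h'.neg_one_pow, (hcp.2 h').neg_one_pow, one_mul]
    · have h'' : Odd c := by
        rw [← Nat.not_even_iff_odd] at h' ⊢; tauto
      rw [h'.neg_one_pow, h''.neg_one_pow]; norm_num
  rwa [pow_mul_pow_ray, ← mul_assoc, this, one_mul] at hp

lemma quarter_lt_weight_point_self {v : Fin 3} {w : ℂ} (h : w ∈ halfDisk) :
    1 / 4 < G.weight (G.point v w) v := by
  rw [weight_point h, quarter_lt_weights_self, map_pow]
  exact pow_lt_one₀ (Complex.normSq_nonneg _) h.2 G.k_pos.ne'

/-- The half-disk at `v` consists of the points whose weight at `v` exceeds `1 / 4`. -/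
lemma exists_point_eq {P : G.Surface} {v : Fin 3} (h : 1 / 4 < G.weight P v) :
    ∃ w ∈ halfDisk, G.point v w = P := by
  obtain ⟨v', w, hw, rfl⟩ := exists_eq_point P
  by_cases hv : v = v'
  · subst hv; exact ⟨w, hw, rfl⟩
  rw [weight_point hw] at h
  obtain ⟨c, hc, rfl, ξ, hξ, hl, rfl⟩ := exists_ray_of_weight hv hw h
  obtain ⟨c', -, -, -, -, ht⟩ := exists_ray_transition (G := G) v' hc
  obtain ⟨h1, h2⟩ := ht ξ hξ hl hw
  exact ⟨_, h1, h2.symm⟩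

lemma exists_half_le_weight (P : G.Surface) : ∃ v, 1 / 2 ≤ G.weight P v := by
  obtain ⟨v', w, hw, rfl⟩ := exists_eq_point P
  by_contra! h
  have := sum_weights v' (w ^ G.k)
  rw [weight_point hw] at h
  linarith [h 0, h 1, h 2]

/-- The coordinate in the half-disk at `v`. -/
noncomputable def coord (v : Fin 3) (P : G.Surface) : ℂ := Function.invFunOn (G.point v) halfDisk P

lemma coord_mem {P : G.Surface} {v : Fin 3} (h : 1 / 4 < G.weight P v) : coord v P ∈ halfDisk :=
  Function.invFunOn_mem (exists_point_eq h)

lemma point_coord {P : G.Surface} {v : Fin 3} (h : 1 / 4 < G.weight P v) :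
    G.point v (coord v P) = P :=
  Function.invFunOn_eq (exists_point_eq h)

lemma coord_point {v : Fin 3} {w : ℂ} (h : w ∈ halfDisk) : coord v (G.point v w) = w :=
  injOn_point v (coord_mem (quarter_lt_weight_point_self h)) h
    (point_coord (quarter_lt_weight_point_self h))

lemma hasDerivAt_sideRoot {k : ℕ} (hk : 0 < k) {ξ : ℂ} (h : ξ ∈ wedge k) (hl : ξ ^ k ∈ lens) :
    ∃ d, d ≠ 0 ∧ HasDerivAt (sideRoot k) d ξ := by
  have h1 := one_add_three_mul_ne_zero hl
  have hf : HasDerivAt sideFlip (-4 / (1 + 3 * ξ ^ k) ^ 2) (ξ ^ k) := by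
    have a : HasDerivAt (fun η : ℂ => 1 - η) (-1) (ξ ^ k) := by
      simpa using (hasDerivAt_id (ξ ^ k)).const_sub 1
    have b : HasDerivAt (fun η : ℂ => 1 + 3 * η) 3 (ξ ^ k) := by
      simpa using ((hasDerivAt_id (ξ ^ k)).const_mul (3 : ℂ)).const_add 1
    have := a.div b h1
    rw [show -1 * (1 + 3 * ξ ^ k) - (1 - ξ ^ k) * 3 = -4 by ring] at this
    exact this
  have hg : HasDerivAt (fun ξ => sideFlip (ξ ^ k)) _ ξ := hf.comp ξ (hasDerivAt_pow k ξ)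
  have hs := lens_subset_slitPlane (sideFlip_mem_lens hl)
  have hr := hg.cpow_const (c := (k : ℂ)⁻¹) hs
  refine ⟨_, ?_, hr⟩
  have hk0 : (k : ℂ) ≠ 0 := by exact_mod_cast hk.ne'
  have h3 : sideFlip (ξ ^ k) ≠ 0 := Complex.slitPlane_ne_zero hs
  refine mul_ne_zero (mul_ne_zero (inv_ne_zero hk0) ?_) (mul_ne_zero ?_ (mul_ne_zero hk0 ?_))
  · simp [Complex.cpow_eq_zero_iff, h3]
  · exact div_ne_zero (by norm_num) (pow_ne_zero _ h1)
  · exact pow_ne_zero _ h.1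

lemma isOpen_pow_preimage_lens {k : ℕ} : IsOpen {ξ : ℂ | ξ ^ k ∈ lens} :=
  isOpen_lens.preimage (continuous_pow k)

lemma isOpen_ray_wedge {k : ℕ} (hk : 0 < k) (c : ℕ) :
    IsOpen {z : ℂ | (ray k c)⁻¹ * z ∈ wedge k ∧ ((ray k c)⁻¹ * z) ^ k ∈ lens} :=
  ((isOpen_wedge hk).inter isOpen_pow_preimage_lens).preimage (continuous_const_mul _)

/-- The transition functions between the half-disks are holomorphic with nonzero derivative. -/
lemma exists_transition {v v' : Fin 3} {w : ℂ} (hw : w ∈ halfDisk)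
    (h : 1 / 4 < G.weight (G.point v w) v') :
    ∃ F : ℂ → ℂ, (∀ᶠ z in 𝓝 w, DifferentiableAt ℂ F z) ∧ deriv F w ≠ 0 ∧
      ∀ᶠ z in 𝓝 w, z ∈ halfDisk → coord v' (G.point v z) = F z := by
  have hk := G.k_pos
  by_cases hv : v' = v
  · subst hv
    exact ⟨id, .of_forall fun z => differentiableAt_id, by simp,
      .of_forall fun z hz => coord_point hz⟩
  rw [weight_point hw] at h
  obtain ⟨c, hc, rfl, ξ, hξ, hl, rfl⟩ := exists_ray_of_weight hv hw h
  obtain ⟨c', -, -, -, -, ht⟩ := exists_ray_transition (G := G) v hc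
  have hr := ray_ne_zero (k := G.k) c
  have hd : ∀ z, (ray G.k c)⁻¹ * z ∈ wedge G.k ∧ ((ray G.k c)⁻¹ * z) ^ G.k ∈ lens →
      ∃ d, d ≠ 0 ∧
        HasDerivAt (fun z => ray G.k c' * sideRoot G.k ((ray G.k c)⁻¹ * z)) d z := by
    rintro z ⟨h1, h2⟩
    obtain ⟨d, hd0, hd⟩ := hasDerivAt_sideRoot hk h1 h2
    have hm : HasDerivAt (fun z : ℂ => (ray G.k c)⁻¹ * z) (ray G.k c)⁻¹ z := by
      simpa using (hasDerivAt_id z).const_mul (ray G.k c)⁻¹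
    exact ⟨_, mul_ne_zero (ray_ne_zero c') (mul_ne_zero hd0 (inv_ne_zero hr)),
      (hd.comp z hm).const_mul _⟩
  have hmem : (ray G.k c)⁻¹ * (ray G.k c * ξ) ∈ wedge G.k ∧
      ((ray G.k c)⁻¹ * (ray G.k c * ξ)) ^ G.k ∈ lens := by
    rw [inv_mul_cancel_left₀ hr]; exact ⟨hξ, hl⟩
  have hev := (isOpen_ray_wedge hk c).mem_nhds hmem
  refine ⟨fun z => ray G.k c' * sideRoot G.k ((ray G.k c)⁻¹ * z), ?_, ?_, ?_⟩
  · filter_upwards [hev] with z hz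
    obtain ⟨d, -, hd⟩ := hd z hz
    exact hd.differentiableAt
  · obtain ⟨d, h0, hd⟩ := hd _ hmem
    rwa [hd.deriv]
  · filter_upwards [hev] with z hz hzd
    have e : ray G.k c * ((ray G.k c)⁻¹ * z) = z := mul_inv_cancel_left₀ hr z
    obtain ⟨h1, h2⟩ := ht _ hz.1 hz.2 (by rwa [e])
    rw [e] at h2
    rw [h2, coord_point h1]

end TriangleGluing

/-! ### The smooth structure -/

/-- The identification of the plane with `ℂ` that extends `halfPlaneCoord`. -/
noncomputable def planeCoord : EuclideanSpace ℝ (Fin 2) ≃L[ℝ] ℂ :=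
  LinearEquiv.toContinuousLinearEquiv
    { toFun := fun u => ⟨u 1, u 0⟩
      invFun := fun z => !₂[z.im, z.re]
      map_add' := fun _ _ => rfl
      map_smul' := fun a u => by apply Complex.ext <;> simp
      left_inv := fun u => by ext i; fin_cases i <;> rfl
      right_inv := fun z => rfl }

lemma planeCoord_val (u : EuclideanHalfSpace 2) : planeCoord u.val = halfPlaneCoord u := rfl

lemma halfPlaneCoord_im_nonneg (u : EuclideanHalfSpace 2) : 0 ≤ (halfPlaneCoord u).im := u.2

/-- The inverse of `halfPlaneCoord` (points of the lower half-plane are moved to the real line). -/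
noncomputable def ofHalfPlane (z : ℂ) : EuclideanHalfSpace 2 :=
  ⟨planeCoord.symm ⟨z.re, max z.im 0⟩, le_max_right z.im 0⟩

lemma halfPlaneCoord_ofHalfPlane {z : ℂ} (h : 0 ≤ z.im) : halfPlaneCoord (ofHalfPlane z) = z :=
  Complex.ext rfl (max_eq_left h)

lemma halfPlaneCoord_injective : Function.Injective halfPlaneCoord := fun _ _ h =>
  EuclideanHalfSpace.ext _ _ (planeCoord.injective h)

lemma ofHalfPlane_halfPlaneCoord (u : EuclideanHalfSpace 2) : ofHalfPlane (halfPlaneCoord u) = u :=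
  halfPlaneCoord_injective (halfPlaneCoord_ofHalfPlane (halfPlaneCoord_im_nonneg u))

lemma continuous_halfPlaneCoord : Continuous halfPlaneCoord :=
  planeCoord.continuous.comp continuous_subtype_val

lemma continuous_ofHalfPlane : Continuous ofHalfPlane := by
  refine Continuous.subtype_mk (planeCoord.symm.continuous.comp ?_) _
  have h : (fun z : ℂ => (⟨z.re, max z.im 0⟩ : ℂ)) =
      fun z => ((z.re : ℝ) : ℂ) + ((max z.im 0 : ℝ) : ℂ) * Complex.I := by
    funext z; apply Complex.ext <;> simp
  rw [h]
  fun_prop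

lemma halfPlaneCoord_mem_halfDisk {u : EuclideanHalfSpace 2} :
    halfPlaneCoord u ∈ halfDisk ↔ Complex.normSq (halfPlaneCoord u) < 1 :=
  and_iff_right (halfPlaneCoord_im_nonneg u)

lemma model_symm_eq {x : EuclideanSpace ℝ (Fin 2)} (hx : x ∈ Set.range (𝓡∂ 2)) :
    halfPlaneCoord ((𝓡∂ 2).symm x) = planeCoord x := by
  rw [← planeCoord_val]
  congr 1
  exact (𝓡∂ 2).right_inv hx

lemma model_apply (u : EuclideanHalfSpace 2) : (𝓡∂ 2) u = planeCoord.symm (halfPlaneCoord u) := by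
  rw [← planeCoord_val, ContinuousLinearEquiv.symm_apply_apply]; rfl

namespace TriangleGluing
variable {G : TriangleGluing}

/-- The chart at the vertex `v`, whose image is the half-disk. -/
noncomputable def chartEquiv (G : TriangleGluing) (v : Fin 3) :
    PartialEquiv G.Surface (EuclideanHalfSpace 2) where
  toFun P := ofHalfPlane (coord v P)
  invFun u := G.point v (halfPlaneCoord u)
  source := {P | 1 / 4 < G.weight P v}
  target := {u | halfPlaneCoord u ∈ halfDisk}
  map_source' P hP := by
    have := coord_mem (show 1 / 4 < G.weight P v from hP)
    rwa [Set.mem_ofPred_eq, halfPlaneCoord_ofHalfPlane this.1]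
  map_target' u hu := quarter_lt_weight_point_self hu
  left_inv' P hP := by
    have := coord_mem (show 1 / 4 < G.weight P v from hP)
    rw [halfPlaneCoord_ofHalfPlane this.1, point_coord hP]
  right_inv' u hu := by
    rw [coord_point hu, ofHalfPlane_halfPlaneCoord]

lemma chartEquiv_trans_source (v v' : Fin 3) :
    ((G.chartEquiv v).symm.trans (G.chartEquiv v')).source =
      {u | halfPlaneCoord u ∈ halfDisk ∧ 1 / 4 < weights v (halfPlaneCoord u ^ G.k) v'} := by
  ext u
  rw [PartialEquiv.trans_source]
  constructor
  · rintro ⟨h1, h2⟩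
    have h1 : halfPlaneCoord u ∈ halfDisk := h1
    have h2 : 1 / 4 < G.weight (G.point v (halfPlaneCoord u)) v' := h2
    rw [weight_point h1] at h2
    exact ⟨h1, h2⟩
  · rintro ⟨h1, h2⟩
    rw [← weight_point h1] at h2
    exact ⟨h1, h2⟩

lemma isOpen_halfPlaneCoord_mem : IsOpen {u | halfPlaneCoord u ∈ halfDisk} := by
  simp only [halfPlaneCoord_mem_halfDisk]
  exact isOpen_lt (Complex.continuous_normSq.comp continuous_halfPlaneCoord) continuous_const

lemma exists_chart_mem (P : G.Surface) : ∃ v, 1 / 4 < G.weight P v := by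
  obtain ⟨v, hv⟩ := exists_half_le_weight P
  exact ⟨v, by linarith⟩

/-- The three charts at the vertices. -/
noncomputable def chartCore (G : TriangleGluing) :
    ChartedSpaceCore (EuclideanHalfSpace 2) G.Surface where
  atlas := Set.range G.chartEquiv
  chartAt P := G.chartEquiv (exists_chart_mem P).choose
  mem_chart_source P := (exists_chart_mem P).choose_spec
  chart_mem_atlas P := ⟨_, rfl⟩
  open_source := by
    rintro _ _ ⟨v, rfl⟩ ⟨v', rfl⟩
    rw [chartEquiv_trans_source]
    exact isOpen_halfPlaneCoord_mem.inter (isOpen_lt continuous_const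
      ((continuous_weights v v').comp (continuous_halfPlaneCoord.pow _)))
  continuousOn_toFun := by
    rintro _ _ ⟨v, rfl⟩ ⟨v', rfl⟩
    rw [chartEquiv_trans_source]
    rintro u ⟨h1, h2⟩
    rw [← weight_point h1] at h2
    obtain ⟨F, hF, -, he⟩ := exists_transition h1 h2
    have hc : ContinuousWithinAt (fun u => ofHalfPlane (F (halfPlaneCoord u)))
        {u | halfPlaneCoord u ∈ halfDisk ∧ 1 / 4 < weights v (halfPlaneCoord u ^ G.k) v'} u :=
      (continuous_ofHalfPlane.continuousAt.comp (hF.self_of_nhds.continuousAt.comp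
        continuous_halfPlaneCoord.continuousAt)).continuousWithinAt
    refine hc.congr_of_eventuallyEq_of_mem ?_ ⟨h1, by rwa [← weight_point h1]⟩
    have he' := (continuous_halfPlaneCoord.tendsto u).eventually he
    filter_upwards [nhdsWithin_le_nhds he', self_mem_nhdsWithin] with u' hu' hm
    exact congrArg ofHalfPlane (hu' hm.1)

noncomputable instance : TopologicalSpace G.Surface := G.chartCore.toTopologicalSpace

noncomputable instance : ChartedSpace (EuclideanHalfSpace 2) G.Surface :=
  G.chartCore.toChartedSpace

/-- The chart at the vertex `v` as a homeomorphism. -/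
noncomputable def chart (G : TriangleGluing) (v : Fin 3) :
    OpenPartialHomeomorph G.Surface (EuclideanHalfSpace 2) :=
  G.chartCore.openPartialHomeomorph (G.chartEquiv v) ⟨v, rfl⟩

lemma chart_mem_atlas_surface (v : Fin 3) : G.chart v ∈ atlas (EuclideanHalfSpace 2) G.Surface :=
  Set.mem_iUnion₂.2 ⟨G.chartEquiv v, ⟨v, rfl⟩, rfl⟩

lemma exists_eq_chart_of_mem_atlas {e : OpenPartialHomeomorph G.Surface (EuclideanHalfSpace 2)}
    (h : e ∈ atlas (EuclideanHalfSpace 2) G.Surface) : ∃ v, e = G.chart v := by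
  obtain ⟨_, ⟨v, rfl⟩, h⟩ := Set.mem_iUnion₂.1 h
  exact ⟨v, h⟩

lemma exists_chartAt_eq (P : G.Surface) : ∃ v, chartAt (EuclideanHalfSpace 2) P = G.chart v :=
  exists_eq_chart_of_mem_atlas (ChartedSpace.chart_mem_atlas P)

lemma mem_chart_source {v : Fin 3} {P : G.Surface} :
    P ∈ (G.chart v).source ↔ 1 / 4 < G.weight P v := Iff.rfl

lemma mem_chart_target {v : Fin 3} {u : EuclideanHalfSpace 2} :
    u ∈ (G.chart v).target ↔ halfPlaneCoord u ∈ halfDisk := Iff.rfl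

lemma halfPlaneCoord_chart {v : Fin 3} {P : G.Surface} (h : 1 / 4 < G.weight P v) :
    halfPlaneCoord (G.chart v P) = coord v P :=
  halfPlaneCoord_ofHalfPlane (coord_mem h).1

/-- In the charts, the transition functions are restrictions of holomorphic functions. -/
lemma exists_chart_transition {v v' : Fin 3} {u : EuclideanHalfSpace 2}
    (h1 : halfPlaneCoord u ∈ halfDisk) (h2 : 1 / 4 < G.weight (G.point v (halfPlaneCoord u)) v') :
    ∃ F : ℂ → ℂ, (∀ᶠ z in 𝓝 (halfPlaneCoord u), DifferentiableAt ℂ F z) ∧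
      deriv F (halfPlaneCoord u) ≠ 0 ∧
      ((𝓡∂ 2) ∘ ((G.chart v).symm.trans (G.chart v')) ∘ (𝓡∂ 2).symm)
        =ᶠ[𝓝[Set.range (𝓡∂ 2)] ((𝓡∂ 2) u)] (planeCoord.symm ∘ F ∘ planeCoord) := by
  obtain ⟨F, hF, hd, he⟩ := exists_transition h1 h2
  refine ⟨F, hF, hd, ?_⟩
  have e0 : planeCoord ((𝓡∂ 2) u) = halfPlaneCoord u := rfl
  rw [← e0] at he
  have he' := (planeCoord.continuous.tendsto _).eventually he
  have hs : ∀ᶠ x in 𝓝[Set.range (𝓡∂ 2)] ((𝓡∂ 2) u),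
      (𝓡∂ 2).symm x ∈ ((G.chart v).symm.trans (G.chart v')).source := by
    have hc : ContinuousAt (𝓡∂ 2).symm ((𝓡∂ 2) u) := (𝓡∂ 2).continuous_symm.continuousAt
    refine nhdsWithin_le_nhds (hc.eventually ?_)
    refine ((G.chart v).symm.trans (G.chart v')).open_source.mem_nhds ?_
    rw [(𝓡∂ 2).left_inv]
    have := chartEquiv_trans_source (G := G) v v'
    exact this ▸ ⟨h1, by rwa [← weight_point h1]⟩
  filter_upwards [nhdsWithin_le_nhds he', self_mem_nhdsWithin, hs] with x hx hxr hxs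
  have hxs' : halfPlaneCoord ((𝓡∂ 2).symm x) ∈ halfDisk ∧ _ :=
    (chartEquiv_trans_source (G := G) v v').subset hxs
  obtain ⟨hx1, hx2⟩ := hxs'
  rw [← weight_point hx1] at hx2
  rw [model_symm_eq hxr] at hx1 hx2
  show (𝓡∂ 2) (G.chart v' (G.point v (halfPlaneCoord ((𝓡∂ 2).symm x)))) =
    planeCoord.symm (F (planeCoord x))
  rw [model_symm_eq hxr, model_apply, halfPlaneCoord_chart hx2, hx hx1]

instance isManifold : IsManifold (𝓡∂ 2) ∞ G.Surface := by
  apply isManifold_of_contDiffOn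
  intro e e' he he'
  obtain ⟨v, rfl⟩ := exists_eq_chart_of_mem_atlas he
  obtain ⟨v', rfl⟩ := exists_eq_chart_of_mem_atlas he'
  rintro x ⟨hx, hxr⟩
  obtain ⟨u, rfl⟩ := hxr
  rw [Set.mem_preimage, (𝓡∂ 2).left_inv] at hx
  obtain ⟨h1, h2⟩ := (chartEquiv_trans_source (G := G) v v').subset hx
  rw [← weight_point h1] at h2
  obtain ⟨F, hF, -, he⟩ := exists_chart_transition h1 h2
  have hF' : ContDiffAt ℂ ∞ F (planeCoord ((𝓡∂ 2) u)) :=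
    (Complex.analyticAt_iff_eventually_differentiableAt.2 hF).contDiffAt
  have h4 : ContDiffWithinAt ℝ ∞ (planeCoord.symm ∘ F ∘ planeCoord) (Set.range (𝓡∂ 2))
      ((𝓡∂ 2) u) :=
    (planeCoord.symm.contDiff.contDiffAt.comp _
      ((hF'.restrict_scalars ℝ).comp _ planeCoord.contDiff.contDiffAt)).contDiffWithinAt
  exact (h4.congr_of_eventuallyEq he (he.self_of_nhdsWithin ⟨u, rfl⟩)).mono
    Set.inter_subset_right

lemma isOrientableSurface (G : TriangleGluing) : IsOrientableSurface G.Surface := by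
  refine ⟨Set.range G.chart, ?_, ?_, ?_⟩
  · rintro _ ⟨v, rfl⟩
    exact IsManifold.subset_maximalAtlas (chart_mem_atlas_surface v)
  · intro P
    obtain ⟨v, hv⟩ := exists_chart_mem P
    exact ⟨_, ⟨v, rfl⟩, hv⟩
  · rintro _ ⟨v, rfl⟩ _ ⟨v', rfl⟩ P ⟨h1, h2⟩
    have h1 : 1 / 4 < G.weight P v := h1
    have h2 : 1 / 4 < G.weight P v' := h2
    set u := G.chart v P with hu
    have hc : halfPlaneCoord u = coord v P := halfPlaneCoord_chart h1
    have hm : halfPlaneCoord u ∈ halfDisk := hc ▸ coord_mem h1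
    obtain ⟨F, hF, hd, he⟩ := exists_chart_transition (G := G) (v := v) (v' := v') hm
      (by rw [hc, point_coord h1]; exact h2)
    have e : fderivWithin ℝ (((G.chart v').extend (𝓡∂ 2)) ∘ ((G.chart v).extend (𝓡∂ 2)).symm)
        (Set.range (𝓡∂ 2)) ((G.chart v).extend (𝓡∂ 2) P) =
        fderivWithin ℝ (planeCoord.symm ∘ F ∘ planeCoord) (Set.range (𝓡∂ 2)) ((𝓡∂ 2) u) :=
      Filter.EventuallyEq.fderivWithin_eq he (he.self_of_nhdsWithin ⟨u, rfl⟩)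
    rw [e]
    have hF1 : HasFDerivAt F (ContinuousLinearMap.restrictScalars ℝ
        (ContinuousLinearMap.toSpanSingleton ℂ (deriv F (halfPlaneCoord u))))
        (planeCoord ((𝓡∂ 2) u)) :=
      (hF.self_of_nhds.hasDerivAt.hasFDerivAt).restrictScalars ℝ
    have hF2 := (planeCoord.symm.hasFDerivAt.comp _
      (hF1.comp _ planeCoord.hasFDerivAt)).hasFDerivWithinAt (s := Set.range (𝓡∂ 2))
    rw [hF2.fderivWithin ((𝓡∂ 2).uniqueDiffOn _ ⟨u, rfl⟩)]
    have hdet : LinearMap.det ((planeCoord.symm.toLinearEquiv : ℂ →ₗ[ℝ] EuclideanSpace ℝ (Fin 2)) ∘ₗ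
        (LinearMap.mul ℝ ℂ (deriv F (halfPlaneCoord u))) ∘ₗ
        (planeCoord.symm.toLinearEquiv.symm : EuclideanSpace ℝ (Fin 2) →ₗ[ℝ] ℂ)) = Complex.normSq (deriv F (halfPlaneCoord u)) := by
      rw [LinearMap.det_conj, ← Algebra.norm_complex_apply]; rfl
    have hpos := Complex.normSq_pos.2 hd
    rw [← hdet] at hpos
    convert hpos using 1
    rw [ContinuousLinearMap.det]
    congr 1
    ext x i
    simp [mul_comm]

end TriangleGluing

/-! ### Topology of the surface -/

lemma isPreconnected_iUnion_fin_three {X : Type*} [TopologicalSpace X] {S : Fin 3 → Set X}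
    (h : ∀ v, IsPreconnected (S v)) (h' : ∀ v, (S v ∩ S (v + 1)).Nonempty) :
    IsPreconnected (⋃ v, S v) := by
  have e : ⋃ v, S v = S 0 ∪ S 1 ∪ S 2 := by
    ext x; simp only [Set.mem_iUnion, Fin.exists_fin_succ, Set.mem_union]
    simp [or_assoc]
  rw [e]
  refine ((h 0).union' (h' 0) (h 1)).union' ?_ (h 2)
  obtain ⟨x, h1, h2⟩ := h' 1
  exact ⟨x, Or.inr h1, h2⟩

lemma convex_halfDisk : Convex ℝ halfDisk := by
  have e : halfDisk = {w : ℂ | 0 ≤ w.im} ∩ Metric.ball 0 1 := by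
    ext w
    rw [halfDisk, Set.mem_inter_iff, mem_ball_zero_iff, Set.mem_ofPred_eq, Set.mem_ofPred_eq,
      Complex.normSq_eq_norm_sq, sq_lt_one_iff₀ (norm_nonneg _)]
  rw [e]
  exact (convex_halfSpace_im_ge 0).inter (convex_ball 0 1)

namespace TriangleGluing
variable {G : TriangleGluing}

lemma continuousOn_point (v : Fin 3) : ContinuousOn (G.point v) halfDisk := by
  have h : ContinuousOn (fun w => (G.chart v).symm (ofHalfPlane w)) halfDisk :=
    (G.chart v).continuousOn_symm.comp continuous_ofHalfPlane.continuousOn fun w hw => by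
      rw [mem_chart_target, halfPlaneCoord_ofHalfPlane hw.1]; exact hw
  refine h.congr fun w hw => ?_
  show _ = G.point v (halfPlaneCoord (ofHalfPlane w))
  rw [halfPlaneCoord_ofHalfPlane hw.1]

lemma continuousOn_coord (v : Fin 3) :
    ContinuousOn (coord (G := G) v) (G.chart v).source := by
  have h : ContinuousOn (fun P => halfPlaneCoord (G.chart v P)) (G.chart v).source :=
    continuous_halfPlaneCoord.comp_continuousOn (G.chart v).continuousOn
  exact h.congr fun P hP => (halfPlaneCoord_chart hP).symm

/-- A function on the surface is continuous if it is continuous on the three half-disks. -/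
lemma continuous_of_continuousOn {X : Type*} [TopologicalSpace X] {g : G.Surface → X}
    (h : ∀ v, ContinuousOn (fun w => g (G.point v w)) halfDisk) : Continuous g := by
  rw [continuous_iff_continuousAt]
  intro P
  obtain ⟨v, hv⟩ := exists_chart_mem P
  have h1 : ContinuousOn (fun P => g (G.point v (coord v P))) (G.chart v).source :=
    (h v).comp (continuousOn_coord v) fun P hP => coord_mem hP
  have h2 : ContinuousOn g (G.chart v).source := h1.congr fun P hP => by
    show g P = g (G.point v (coord v P))
    rw [point_coord hP]
  exact h2.continuousAt ((G.chart v).open_source.mem_nhds hv)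

lemma continuous_weight (j : Fin 3) : Continuous fun P : G.Surface => G.weight P j := by
  refine continuous_of_continuousOn fun v => ?_
  have h : Continuous fun w : ℂ => weights v (w ^ G.k) j :=
    (continuous_weights v j).comp (continuous_pow _)
  exact h.continuousOn.congr fun w hw => by rw [weight_point hw]

/-- The part of the half-disk at `v` whose coordinate lies in an open set is open. -/
lemma isOpen_coord_preimage (v : Fin 3) {U : Set ℂ} (hU : IsOpen U) :
    IsOpen {P : G.Surface | 1 / 4 < G.weight P v ∧ coord v P ∈ U} :=
  (continuousOn_coord v).isOpen_inter_preimage (G.chart v).open_source hU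

instance : T2Space G.Surface := by
  refine ⟨fun P Q hPQ => ?_⟩
  by_cases h : G.weight P = G.weight Q
  · obtain ⟨v, hv⟩ := exists_chart_mem P
    have hv' : 1 / 4 < G.weight Q v := h ▸ hv
    have hne : coord v P ≠ coord v Q := fun he =>
      hPQ (by rw [← point_coord hv, he, point_coord hv'])
    obtain ⟨U, V, hU, hV, hPU, hQV, hd⟩ := t2_separation hne
    refine ⟨_, _, isOpen_coord_preimage v hU, isOpen_coord_preimage v hV, ⟨hv, hPU⟩, ⟨hv', hQV⟩, ?_⟩
    exact Set.disjoint_left.2 fun R h1 h2 => Set.disjoint_left.1 hd h1.2 h2.2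
  · obtain ⟨j, hj⟩ := Function.ne_iff.1 h
    obtain ⟨U, V, hU, hV, hPU, hQV, hd⟩ := t2_separation hj
    exact ⟨_, _, hU.preimage (continuous_weight j), hV.preimage (continuous_weight j), hPU, hQV,
      hd.preimage _⟩

instance : CompactSpace G.Surface := by
  refine ⟨?_⟩
  have e : (Set.univ : Set G.Surface) =
      ⋃ v, G.point v '' {w | 0 ≤ w.im ∧ Complex.normSq (w ^ G.k) ≤ 1 / 3} := by
    refine (Set.eq_univ_of_forall fun P => ?_).symm
    obtain ⟨v, hv⟩ := exists_half_le_weight P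
    obtain ⟨w, hw, rfl⟩ := exists_point_eq (show 1 / 4 < G.weight P v by linarith)
    refine Set.mem_iUnion.2 ⟨v, w, ⟨hw.1, ?_⟩, rfl⟩
    rw [weight_point hw, weights_self, div_le_div_iff₀ (by norm_num)
      (one_add_three_normSq_pos _)] at hv
    linarith
  rw [e]
  refine isCompact_iUnion fun v => IsCompact.image_of_continuousOn ?_
    ((continuousOn_point v).mono ?_)
  · refine Metric.isCompact_of_isClosed_isBounded ?_ ?_
    · exact (isClosed_le continuous_const Complex.continuous_im).inter
        (isClosed_le (Complex.continuous_normSq.comp (continuous_pow _)) continuous_const)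
    · refine (Metric.isBounded_ball (x := (0 : ℂ)) (r := 1)).subset ?_
      rintro w ⟨-, hw⟩
      rw [map_pow, Complex.normSq_eq_norm_sq, ← pow_mul] at hw
      rw [mem_ball_zero_iff]
      by_contra! h1
      linarith [one_le_pow₀ h1 (n := 2 * G.k)]
  · rintro w ⟨h0, hw⟩
    refine ⟨h0, ?_⟩
    rw [map_pow] at hw
    by_contra! h1
    linarith [one_le_pow₀ h1 (n := G.k)]

instance : SecondCountableTopology G.Surface :=
  have : SecondCountableTopology (EuclideanHalfSpace 2) :=
    TopologicalSpace.Subtype.secondCountableTopology _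
  ChartedSpace.secondCountable_of_sigmaCompact (EuclideanHalfSpace 2) G.Surface

lemma half_mem_halfDisk : (1 / 2 : ℂ) ∈ halfDisk := by
  refine ⟨by norm_num [Complex.div_im], by norm_num [Complex.normSq_apply]⟩

/-- The point `1 / 2` of the half-disk at `v` also belongs to the half-disk at `v + 1`. -/
lemma quarter_lt_weight_half (v : Fin 3) : 1 / 4 < G.weight (G.point v (1 / 2)) (v + 1) := by
  rw [weight_point half_mem_halfDisk, quarter_lt_weights_add_one]
  have e : (1 / 2 : ℂ) ^ G.k = (((1 / 2) ^ G.k : ℝ) : ℂ) := by push_cast; rfl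
  rw [e, Complex.ofReal_re, Complex.normSq_ofReal]
  positivity

instance : ConnectedSpace G.Surface := by
  have : PreconnectedSpace G.Surface := by
    refine ⟨?_⟩
    have e : (Set.univ : Set G.Surface) = ⋃ v, G.point v '' halfDisk :=
      (Set.eq_univ_of_forall fun P => by
        obtain ⟨v, w, hw, rfl⟩ := exists_eq_point P
        exact Set.mem_iUnion.2 ⟨v, w, hw, rfl⟩).symm
    rw [e]
    refine isPreconnected_iUnion_fin_three
      (fun v => convex_halfDisk.isPreconnected.image _ (continuousOn_point v)) fun v => ?_
    exact ⟨_, ⟨_, half_mem_halfDisk, rfl⟩, exists_point_eq (quarter_lt_weight_half v)⟩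
  exact { toPreconnectedSpace := this, toNonempty := ⟨G.point 0 0⟩ }

lemma mem_boundary_iff {P : G.Surface} {v : Fin 3} (h : 1 / 4 < G.weight P v) :
    P ∈ (𝓡∂ 2).boundary G.Surface ↔ (coord v P).im = 0 := by
  have h1 := (𝓡∂ 2).isInteriorPoint_iff_of_mem_atlas (n := ∞) (M := G.Surface)
    (by simp) (chart_mem_atlas_surface v) (mem_chart_source.2 h)
  have h2 : (G.chart v).extend (𝓡∂ 2) P ∈ interior ((G.chart v).extend (𝓡∂ 2)).target ↔
      (𝓡∂ 2) (G.chart v P) ∈ interior (Set.range (𝓡∂ 2)) :=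
    ⟨fun h' => (G.chart v).interior_extend_target_subset_interior_range h',
      fun h' => (G.chart v).mem_interior_extend_target ((G.chart v).map_source h) h'⟩
  have h3 : (𝓡∂ 2) (G.chart v P) ∈ interior (Set.range (𝓡∂ 2)) ↔ 0 < (coord v P).im := by
    rw [interior_range_modelWithCornersEuclideanHalfSpace, ← halfPlaneCoord_chart h]; exact Iff.rfl
  rw [ModelWithCorners.boundary, Set.mem_ofPred_eq,
    ModelWithCorners.isBoundaryPoint_iff_not_isInteriorPoint, h1, h2, h3, not_lt]
  exact ⟨fun h' => le_antisymm h' (coord_mem h).1, fun h' => h'.le⟩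

lemma isConnected_boundary : IsConnected ((𝓡∂ 2).boundary G.Surface) := by
  have e : (𝓡∂ 2).boundary G.Surface = ⋃ v, G.point v '' (halfDisk ∩ {w | w.im = 0}) := by
    ext P
    constructor
    · intro hP
      obtain ⟨v, hv⟩ := exists_chart_mem P
      exact Set.mem_iUnion.2 ⟨v, coord v P, ⟨coord_mem hv, (mem_boundary_iff hv).1 hP⟩,
        point_coord hv⟩
    · intro hP
      obtain ⟨v, w, ⟨hw, hw0⟩, rfl⟩ := Set.mem_iUnion.1 hP
      rw [mem_boundary_iff (quarter_lt_weight_point_self hw), coord_point hw]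
      exact hw0
  have hhalf : (1 / 2 : ℂ) ∈ halfDisk ∩ {w | w.im = 0} :=
    ⟨half_mem_halfDisk, by norm_num [Complex.div_im]⟩
  rw [e]
  refine ⟨⟨_, Set.mem_iUnion.2 ⟨0, _, hhalf, rfl⟩⟩, ?_⟩
  refine isPreconnected_iUnion_fin_three (fun v => IsPreconnected.image ?_ _
    ((continuousOn_point v).mono Set.inter_subset_left)) fun v => ?_
  · refine (convex_halfDisk.inter ?_).isPreconnected
    exact (convex_hyperplane (𝕜 := ℝ) (f := fun w : ℂ => w.im) ⟨Complex.add_im, by simp⟩ 0)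
  · have hq := quarter_lt_weight_half (G := G) v
    refine ⟨_, ⟨_, hhalf, rfl⟩, coord (v + 1) (G.point v (1 / 2)), ⟨coord_mem hq, ?_⟩,
      point_coord hq⟩
    rw [Set.mem_ofPred_eq, ← mem_boundary_iff hq,
      mem_boundary_iff (quarter_lt_weight_point_self half_mem_halfDisk),
      coord_point half_mem_halfDisk]
    exact hhalf.2

end TriangleGluing

/-! ### The height function -/

lemma contDiff_normSq : ContDiff ℝ ∞ Complex.normSq := by
  have h : (Complex.normSq : ℂ → ℝ) = fun z => Complex.reCLM z * Complex.reCLM z +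
      Complex.imCLM z * Complex.imCLM z := by
    funext z; exact Complex.normSq_apply z
  rw [h]
  exact (Complex.reCLM.contDiff.mul Complex.reCLM.contDiff).add
    (Complex.imCLM.contDiff.mul Complex.imCLM.contDiff)

lemma contDiff_weights (v j : Fin 3) : ContDiff ℝ ∞ fun b => weights v b j := by
  have h : ∀ b : ℂ, 1 + 3 * Complex.normSq b ≠ 0 := fun b => (one_add_three_normSq_pos b).ne'
  have hd : ContDiff ℝ ∞ fun b : ℂ => 1 / (1 + 3 * Complex.normSq b) :=
    contDiff_const.div (contDiff_const.add (contDiff_const.mul contDiff_normSq)) h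
  have hre : ContDiff ℝ ∞ fun b : ℂ => b.re := Complex.reCLM.contDiff
  unfold weights
  split_ifs
  · exact hd
  · exact (contDiff_const.sub (hd.div_const 2)).add ((contDiff_const.mul hre).mul hd)
  · exact (contDiff_const.sub (hd.div_const 2)).sub ((contDiff_const.mul hre).mul hd)

lemma weights_nonneg (v : Fin 3) (b : ℂ) (j : Fin 3) : 0 ≤ weights v b j := by
  have hp := one_add_three_normSq_pos b
  have e : weights v b j = 1 / (1 + 3 * Complex.normSq b) ∨
      weights v b j = Complex.normSq (1 + 3 * b) / (4 * (1 + 3 * Complex.normSq b)) ∨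
      weights v b j = Complex.normSq (1 + 3 * (-b)) / (4 * (1 + 3 * Complex.normSq b)) := by
    rw [normSq_one_add_three_mul, normSq_one_add_three_mul, Complex.normSq_neg, Complex.neg_re]
    unfold weights
    split_ifs
    · exact Or.inl rfl
    · right; left; field_simp; ring
    · right; right; field_simp; ring
  rcases e with e | e | e <;> rw [e]
  · positivity
  · exact div_nonneg (Complex.normSq_nonneg _) (by positivity)
  · exact div_nonneg (Complex.normSq_nonneg _) (by positivity)

/-- The height as a function of the coordinate `b` on the sphere: in the coordinate at the vertex
`0` it is `2 Re b / (1 + |b| ^ 2)`. -/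
noncomputable def sphereHeight (v : Fin 3) (b : ℂ) : ℝ :=
  2 * (weights v b 1 - weights v b 2) / (1 + 2 * weights v b 0)

lemma contDiff_sphereHeight (v : Fin 3) : ContDiff ℝ ∞ (sphereHeight v) := by
  refine (contDiff_const.mul ((contDiff_weights v 1).sub (contDiff_weights v 2))).div
    (contDiff_const.add (contDiff_const.mul (contDiff_weights v 0))) fun b => ?_
  have := weights_nonneg v b 0
  positivity

lemma sphereHeight_zero (b : ℂ) : sphereHeight 0 b = 2 * b.re / (1 + Complex.normSq b) := by
  have h0 := weights_self 0 b
  have h1 := weights_add_one 0 b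
  have h2 := weights_add_two 0 b
  simp only [Fin.isValue, zero_add] at h1 h2
  have hp := one_add_three_normSq_pos b
  have hq : 0 < 1 + Complex.normSq b := by have := Complex.normSq_nonneg b; positivity
  rw [sphereHeight, h0, h1, h2]
  have e : 1 + 2 * (1 / (1 + 3 * Complex.normSq b)) =
      3 * (1 + Complex.normSq b) / (1 + 3 * Complex.normSq b) := by field_simp; ring
  rw [e]; field_simp; ring

lemma sphereHeight_one (b : ℂ) : sphereHeight 1 b =
    (1 - 3 * Complex.normSq b - 2 * b.re) / (1 + 5 * Complex.normSq b - 2 * b.re) := by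
  have h1 : weights 1 b 1 = _ := weights_self 1 b
  have h2 : weights 1 b 2 = _ := weights_add_one 1 b
  have h0 : weights 1 b 0 = _ := weights_add_two 1 b
  have hp := one_add_three_normSq_pos b
  have hq : 0 < 1 + 5 * Complex.normSq b - 2 * b.re := by
    rw [Complex.normSq_apply]; nlinarith [sq_nonneg (b.re - 1), sq_nonneg b.im, sq_nonneg b.re]
  rw [sphereHeight, h0, h1, h2]
  generalize hP : 1 + 5 * Complex.normSq b - 2 * b.re = P at *
  have e : 1 + 2 * (3 / 4 - 1 / (1 + 3 * Complex.normSq b) / 2 -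
      3 / 2 * b.re * (1 / (1 + 3 * Complex.normSq b))) =
      3 / 2 * P / (1 + 3 * Complex.normSq b) := by rw [← hP]; field_simp; ring
  rw [e]; field_simp; ring

lemma sphereHeight_two (b : ℂ) : sphereHeight 2 b =
    -(1 - 3 * Complex.normSq b + 2 * b.re) / (1 + 5 * Complex.normSq b + 2 * b.re) := by
  have h2 : weights 2 b 2 = _ := weights_self 2 b
  have h0 : weights 2 b 0 = _ := weights_add_one 2 b
  have h1 : weights 2 b 1 = _ := weights_add_two 2 b
  have hp := one_add_three_normSq_pos b
  have hq : 0 < 1 + 5 * Complex.normSq b + 2 * b.re := by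
    rw [Complex.normSq_apply]; nlinarith [sq_nonneg (b.re + 1), sq_nonneg b.im, sq_nonneg b.re]
  rw [sphereHeight, h0, h1, h2]
  generalize hP : 1 + 5 * Complex.normSq b + 2 * b.re = P at *
  have e : 1 + 2 * (3 / 4 - 1 / (1 + 3 * Complex.normSq b) / 2 +
      3 / 2 * b.re * (1 / (1 + 3 * Complex.normSq b))) =
      3 / 2 * P / (1 + 3 * Complex.normSq b) := by rw [← hP]; field_simp; ring
  rw [e]; field_simp; ring

lemma hasDerivAt_sphereHeight_line (v : Fin 3) (b d : ℂ) :
    HasDerivAt (fun t : ℝ => sphereHeight v (b + t * d)) (fderiv ℝ (sphereHeight v) b d) 0 := by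
  have h1 : HasDerivAt (fun t : ℝ => b + (t : ℂ) * d) d 0 := by
    simpa using ((Complex.ofRealCLM.hasDerivAt (x := (0 : ℝ))).mul_const d).const_add b
  have h2 : HasFDerivAt (sphereHeight v) (fderiv ℝ (sphereHeight v) b) (b + ((0 : ℝ) : ℂ) * d) := by
    simpa using ((contDiff_sphereHeight v).differentiable (by simp) b).hasFDerivAt
  exact h2.comp_hasDerivAt 0 h1

/-- The derivative of the height in the radial direction. -/
lemma fderiv_sphereHeight_radial (b : ℂ) :
    fderiv ℝ (sphereHeight 0) b b =
      2 * b.re * (1 - Complex.normSq b) / (1 + Complex.normSq b) ^ 2 ∧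
    fderiv ℝ (sphereHeight 1) b b = -16 * Complex.normSq b * (1 - b.re) /
      (1 + 5 * Complex.normSq b - 2 * b.re) ^ 2 ∧
    fderiv ℝ (sphereHeight 2) b b = 16 * Complex.normSq b * (1 + b.re) /
      (1 + 5 * Complex.normSq b + 2 * b.re) ^ 2 := by
  have hre : ∀ t : ℝ, (b + t * b).re = (1 + t) * b.re := fun t => by simp; ring
  have hn : ∀ t : ℝ, Complex.normSq (b + t * b) = (1 + t) ^ 2 * Complex.normSq b := fun t => by
    simp [Complex.normSq_apply]; ring
  have hl : HasDerivAt (fun t : ℝ => (1 + t) * b.re) b.re 0 := by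
    simpa using ((hasDerivAt_id (0 : ℝ)).const_add 1).mul_const b.re
  have hs : HasDerivAt (fun t : ℝ => (1 + t) ^ 2 * Complex.normSq b) (2 * Complex.normSq b) 0 := by
    simpa using (((hasDerivAt_id (0 : ℝ)).const_add 1).pow 2).mul_const (Complex.normSq b)
  have hnn := Complex.normSq_nonneg b
  refine ⟨?_, ?_, ?_⟩
  · refine (hasDerivAt_sphereHeight_line 0 b b).unique ?_
    simp only [sphereHeight_zero, hre, hn]
    refine ((hl.const_mul 2).fun_div (hs.const_add 1) (by simp; positivity)).congr_deriv ?_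
    ring
  · have hq : 1 + 5 * Complex.normSq b - 2 * b.re ≠ 0 := by
      rw [Complex.normSq_apply]; nlinarith [sq_nonneg (b.re - 1), sq_nonneg b.im, sq_nonneg b.re]
    refine (hasDerivAt_sphereHeight_line 1 b b).unique ?_
    simp only [sphereHeight_one, hre, hn]
    refine ((((hs.const_mul 3).const_sub 1).fun_sub (hl.const_mul 2)).fun_div
      (((hs.const_mul 5).const_add 1).fun_sub (hl.const_mul 2)) (by simpa using hq)).congr_deriv ?_
    ring
  · have hq : 1 + 5 * Complex.normSq b + 2 * b.re ≠ 0 := by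
      rw [Complex.normSq_apply]; nlinarith [sq_nonneg (b.re + 1), sq_nonneg b.im, sq_nonneg b.re]
    refine (hasDerivAt_sphereHeight_line 2 b b).unique ?_
    simp only [sphereHeight_two, hre, hn]
    refine ((((hs.const_mul 3).const_sub 1).fun_add (hl.const_mul 2)).fun_neg.fun_div
      (((hs.const_mul 5).const_add 1).fun_add (hl.const_mul 2)) (by simpa using hq)).congr_deriv ?_
    ring

/-- The derivative of the height in the direction of the rotation. -/
lemma fderiv_sphereHeight_angular (b : ℂ) :
    fderiv ℝ (sphereHeight 0) b (Complex.I * b) = -2 * b.im / (1 + Complex.normSq b) := by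
  have hre : ∀ t : ℝ, (b + t * (Complex.I * b)).re = b.re - t * b.im := fun t => by simp; ring
  have hn : ∀ t : ℝ, Complex.normSq (b + t * (Complex.I * b)) =
      (1 + t ^ 2) * Complex.normSq b := fun t => by
    simp [Complex.normSq_apply]; ring
  have hl : HasDerivAt (fun t : ℝ => b.re - t * b.im) (-b.im) 0 := by
    simpa using ((hasDerivAt_id (0 : ℝ)).mul_const b.im).const_sub b.re
  have hs : HasDerivAt (fun t : ℝ => (1 + t ^ 2) * Complex.normSq b) 0 0 := by
    simpa using (((hasDerivAt_id (0 : ℝ)).pow 2).const_add 1).mul_const (Complex.normSq b)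
  have hnn := Complex.normSq_nonneg b
  refine (hasDerivAt_sphereHeight_line 0 b _).unique ?_
  simp only [sphereHeight_zero, hre, hn]
  refine ((hl.const_mul 2).fun_div (hs.const_add 1) (by simp; positivity)).congr_deriv ?_
  field_simp
  ring

lemma hasFDerivAt_sphereHeight_pow (k : ℕ) (v : Fin 3) (w : ℂ) :
    HasFDerivAt (fun w => sphereHeight v (w ^ k)) ((fderiv ℝ (sphereHeight v) (w ^ k)).comp
      ((ContinuousLinearMap.toSpanSingleton ℂ (k * w ^ (k - 1))).restrictScalars ℝ)) w := by
  have h1 : HasFDerivAt (fun w : ℂ => w ^ k)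
      ((ContinuousLinearMap.toSpanSingleton ℂ (k * w ^ (k - 1))).restrictScalars ℝ) w :=
    (hasDerivAt_pow k w).hasFDerivAt.restrictScalars ℝ
  exact (((contDiff_sphereHeight v).differentiable (by simp) _).hasFDerivAt).comp w h1

/-- Away from the vertex the derivative of the height in the half-disk does not vanish, even on
the vectors tangent to the boundary if the point is on the boundary. -/
lemma exists_fderiv_sphereHeight_pow_ne_zero {k : ℕ} (hk : 0 < k) (v : Fin 3) {w : ℂ}
    (hw : w ∈ halfDisk) (h0 : w ≠ 0) :
    ∃ d : ℂ, (w.im = 0 → d.im = 0) ∧ fderiv ℝ (fun w => sphereHeight v (w ^ k)) w d ≠ 0 := by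
  have hd : ∀ d, fderiv ℝ (fun w => sphereHeight v (w ^ k)) w (d * w) =
      k * fderiv ℝ (sphereHeight v) (w ^ k) (d * w ^ k) := by
    intro d
    rw [(hasFDerivAt_sphereHeight_pow k v w).fderiv]
    have e : ((ContinuousLinearMap.toSpanSingleton ℂ (k * w ^ (k - 1))).restrictScalars ℝ) (d * w)
        = (k : ℝ) • (d * w ^ k) := by
      have : w ^ k = w ^ (k - 1) * w := by rw [← pow_succ]; congr 1; omega
      rw [this]; simp; ring
    rw [ContinuousLinearMap.comp_apply, e, map_smul, smul_eq_mul]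
  have hk0 : (k : ℝ) ≠ 0 := by exact_mod_cast hk.ne'
  have hb0 : w ^ k ≠ 0 := pow_ne_zero _ h0
  have hn0 : 0 < Complex.normSq (w ^ k) := Complex.normSq_pos.2 hb0
  have hn1 : Complex.normSq (w ^ k) < 1 := by
    rw [map_pow]; exact pow_lt_one₀ (Complex.normSq_nonneg _) hw.2 hk.ne'
  obtain ⟨r0, r1, r2⟩ := fderiv_sphereHeight_radial (w ^ k)
  have hx : (w ^ k).re ^ 2 < 1 := by
    rw [Complex.normSq_apply] at hn1; nlinarith [sq_nonneg (w ^ k).im]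
  have hx' := abs_lt.1 ((sq_lt_one_iff_abs_lt_one _).1 hx)
  -- the rotation is used only where the zero level meets the half-disk at the vertex `0`
  by_cases hv : v = 0 ∧ (w ^ k).re = 0
  · obtain ⟨rfl, hre⟩ := hv
    refine ⟨Complex.I * w, fun him => ?_, ?_⟩
    · exfalso
      have : w = ((w.re : ℝ) : ℂ) := Complex.ext rfl him
      rw [this, ← Complex.ofReal_pow, Complex.ofReal_re, pow_eq_zero_iff hk.ne'] at hre
      exact h0 (Complex.ext hre him)
    · rw [hd, fderiv_sphereHeight_angular]
      have him : (w ^ k).im ≠ 0 := fun h => hb0 (Complex.ext hre h)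
      refine mul_ne_zero hk0 (div_ne_zero (mul_ne_zero (by norm_num) him) (by positivity))
  · refine ⟨1 * w, fun him => by simpa using him, ?_⟩
    rw [hd, one_mul]
    refine mul_ne_zero hk0 ?_
    fin_cases v
    · have hre : (w ^ k).re ≠ 0 := fun h => hv ⟨rfl, h⟩
      exact r0 ▸ div_ne_zero (mul_ne_zero (mul_ne_zero two_ne_zero hre) (by linarith))
        (by positivity)
    · refine r1 ▸ div_ne_zero (mul_ne_zero (mul_ne_zero (by norm_num) hn0.ne') (by linarith))
        (pow_ne_zero _ ?_)
      rw [Complex.normSq_apply]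
      nlinarith [sq_nonneg ((w ^ k).re - 1), sq_nonneg (w ^ k).im, sq_nonneg (w ^ k).re]
    · refine r2 ▸ div_ne_zero (mul_ne_zero (mul_ne_zero (by norm_num) hn0.ne') (by linarith))
        (pow_ne_zero _ ?_)
      rw [Complex.normSq_apply]
      nlinarith [sq_nonneg ((w ^ k).re + 1), sq_nonneg (w ^ k).im, sq_nonneg (w ^ k).re]

namespace TriangleGluing
variable {G : TriangleGluing}

/-- The height function; `σ` is a sign. -/
noncomputable def height (σ : ℝ) (P : G.Surface) : ℝ :=
  σ * (2 * (G.weight P 1 - G.weight P 2) / (1 + 2 * G.weight P 0))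

lemma height_point (σ : ℝ) {v : Fin 3} {w : ℂ} (h : w ∈ halfDisk) :
    height σ (G.point v w) = σ * sphereHeight v (w ^ G.k) := by
  rw [height, weight_point h, sphereHeight]

lemma contDiff_sphereHeight_pow (σ : ℝ) (k : ℕ) (v : Fin 3) :
    ContDiff ℝ ∞ fun w : ℂ => σ * sphereHeight v (w ^ k) :=
  contDiff_const.mul ((contDiff_sphereHeight v).comp (contDiff_id.pow k))

lemma height_comp_extChartAt_symm (σ : ℝ) (P : G.Surface) {v : Fin 3}
    (hv : chartAt (EuclideanHalfSpace 2) P = G.chart v) :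
    height σ ∘ (extChartAt (𝓡∂ 2) P).symm =ᶠ[𝓝[Set.range (𝓡∂ 2)] (extChartAt (𝓡∂ 2) P P)]
      (fun w => σ * sphereHeight v (w ^ G.k)) ∘ planeCoord := by
  filter_upwards [extChartAt_target_mem_nhdsWithin P] with x hx
  rw [extChartAt_target, hv] at hx
  have h1 : halfPlaneCoord ((𝓡∂ 2).symm x) ∈ halfDisk := hx.1
  rw [extChartAt, hv]
  show height σ (G.point v (halfPlaneCoord ((𝓡∂ 2).symm x))) = σ * sphereHeight v (planeCoord x ^ G.k)
  rw [height_point σ h1, model_symm_eq hx.2]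

lemma planeCoord_extChartAt {P : G.Surface} {v : Fin 3}
    (hv : chartAt (EuclideanHalfSpace 2) P = G.chart v) :
    1 / 4 < G.weight P v ∧ planeCoord (extChartAt (𝓡∂ 2) P P) = coord v P := by
  have hs : P ∈ (G.chart v).source := hv ▸ ChartedSpace.mem_chart_source P
  refine ⟨hs, ?_⟩
  rw [extChartAt, hv]
  exact halfPlaneCoord_chart hs

lemma contMDiff_height (σ : ℝ) : ContMDiff (𝓡∂ 2) 𝓘(ℝ, ℝ) ∞ (height (G := G) σ) := by
  intro P
  obtain ⟨v, hv⟩ := exists_chartAt_eq P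
  have hc : Continuous (height (G := G) σ) :=
    continuous_of_continuousOn fun v =>
      (contDiff_sphereHeight_pow σ G.k v).continuous.continuousOn.congr fun w hw => height_point σ hw
  rw [contMDiffAt_iff]
  refine ⟨hc.continuousAt, ?_⟩
  have h := height_comp_extChartAt_symm σ P hv
  refine ContDiffWithinAt.congr_of_eventuallyEq
    (((contDiff_sphereHeight_pow σ G.k v).comp planeCoord.contDiff).contDiffWithinAt) h ?_
  exact h.self_of_nhdsWithin (Set.mem_range_self _)

lemma mfderiv_height (σ : ℝ) (P : G.Surface) {v : Fin 3}
    (hv : chartAt (EuclideanHalfSpace 2) P = G.chart v) (u : EuclideanSpace ℝ (Fin 2)) :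
    mfderiv (𝓡∂ 2) 𝓘(ℝ, ℝ) (height σ) P u =
      σ * fderiv ℝ (fun w => sphereHeight v (w ^ G.k)) (coord v P) (planeCoord u) := by
  have hd : MDifferentiableAt (𝓡∂ 2) 𝓘(ℝ, ℝ) (height (G := G) σ) P :=
    (contMDiff_height σ).mdifferentiable (by simp) P
  have h := height_comp_extChartAt_symm σ P hv
  obtain ⟨hw, hcoord⟩ := planeCoord_extChartAt hv
  have e : fderivWithin ℝ (writtenInExtChartAt (𝓡∂ 2) 𝓘(ℝ, ℝ) P (height σ)) (Set.range (𝓡∂ 2))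
      (extChartAt (𝓡∂ 2) P P) = fderivWithin ℝ
      ((fun w => σ * sphereHeight v (w ^ G.k)) ∘ planeCoord) (Set.range (𝓡∂ 2))
      (extChartAt (𝓡∂ 2) P P) :=
    Filter.EventuallyEq.fderivWithin_eq h (h.self_of_nhdsWithin (Set.mem_range_self _))
  have hF := hasFDerivAt_sphereHeight_pow G.k v (coord v P)
  rw [hd.mfderiv, e]
  have hF1 : HasFDerivAt (fun w => σ * sphereHeight v (w ^ G.k))
      (σ • fderiv ℝ (fun w => sphereHeight v (w ^ G.k)) (coord v P))
      (planeCoord (extChartAt (𝓡∂ 2) P P)) := by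
    rw [hcoord]
    exact (hF.differentiableAt.hasFDerivAt).const_mul σ
  rw [((hF1.comp _ planeCoord.hasFDerivAt).hasFDerivWithinAt).fderivWithin
    ((𝓡∂ 2).uniqueDiffOn _ (Set.mem_range_self _))]
  rfl

lemma coord_eq_zero_iff {P : G.Surface} {v : Fin 3} (h : 1 / 4 < G.weight P v) :
    coord v P = 0 ↔ P = G.point v 0 := by
  constructor
  · intro h0; rw [← h0, point_coord h]
  · intro h0; rw [h0, coord_point zero_mem_halfDisk]

/-- A vertex belongs to its own half-disk only. -/
lemma eq_of_quarter_lt_weight_vertex {v v' : Fin 3} (h : 1 / 4 < G.weight (G.point v 0) v') :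
    v' = v := by
  by_contra hv
  rw [weight_point zero_mem_halfDisk] at h
  obtain ⟨c, -, -, ξ, hξ, -, h0⟩ := exists_ray_of_weight hv zero_mem_halfDisk h
  exact mul_ne_zero (ray_ne_zero c) hξ.1 h0.symm

lemma vertex_injective : Function.Injective fun v => G.point v 0 := fun v v' (h : _ = _) => by
  refine eq_of_quarter_lt_weight_vertex (G := G) (v := v') ?_
  rw [← show G.point v 0 = G.point v' 0 from h]
  exact quarter_lt_weight_point_self zero_mem_halfDisk

lemma mem_range_vertex_iff {P : G.Surface} {v : Fin 3} (h : 1 / 4 < G.weight P v) :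
    P ∈ Set.range (fun v => G.point v 0) ↔ coord v P = 0 := by
  rw [coord_eq_zero_iff h]
  constructor
  · rintro ⟨v', rfl⟩
    rw [eq_of_quarter_lt_weight_vertex h]
  · rintro rfl; exact ⟨v, rfl⟩

lemma criticalPoints_height {σ : ℝ} (hσ : σ ≠ 0) :
    criticalPoints (height (G := G) σ) = Set.range fun v => G.point v 0 := by
  ext P
  obtain ⟨v, hv⟩ := exists_chartAt_eq P
  obtain ⟨hw, -⟩ := planeCoord_extChartAt hv
  rw [mem_range_vertex_iff hw]
  constructor
  · intro hP
    by_contra h0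
    obtain ⟨d, -, hd⟩ := exists_fderiv_sphereHeight_pow_ne_zero G.k_pos v (coord_mem hw) h0
    have := mfderiv_height σ P hv (planeCoord.symm d)
    rw [show mfderiv (𝓡∂ 2) 𝓘(ℝ, ℝ) (height σ) P = 0 from hP,
      ContinuousLinearEquiv.apply_symm_apply] at this
    exact mul_ne_zero hσ hd this.symm
  · intro h0
    refine ContinuousLinearMap.ext fun u => ?_
    rw [mfderiv_height σ P hv u, h0, (hasFDerivAt_sphereHeight_pow G.k v 0).fderiv]
    have : G.k - 1 ≠ 0 := by have := G.three_le_k; omega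
    simp [zero_pow this]
    rfl

lemma boundaryCriticalPoints_height {σ : ℝ} (hσ : σ ≠ 0) :
    boundaryCriticalPoints (height (G := G) σ) = Set.range fun v => G.point v 0 := by
  ext P
  obtain ⟨v, hv⟩ := exists_chartAt_eq P
  obtain ⟨hw, -⟩ := planeCoord_extChartAt hv
  constructor
  · rintro ⟨hb, hP⟩
    rw [mem_range_vertex_iff hw]
    rw [mem_boundary_iff hw] at hb
    by_contra h0
    obtain ⟨d, hd0, hd⟩ := exists_fderiv_sphereHeight_pow_ne_zero G.k_pos v (coord_mem hw) h0
    have := mfderiv_height σ P hv (planeCoord.symm d)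
    rw [hP _ (hd0 hb), ContinuousLinearEquiv.apply_symm_apply] at this
    exact mul_ne_zero hσ hd this.symm
  · intro hP
    refine ⟨?_, fun u _ => ?_⟩
    · rw [mem_boundary_iff hw, (mem_range_vertex_iff hw).1 hP]; rfl
    · rw [← criticalPoints_height hσ] at hP
      rw [show mfderiv (𝓡∂ 2) 𝓘(ℝ, ℝ) (height σ) P = 0 from hP]; rfl

lemma isolatedPoints_eq_of_finite {M : Type*} [TopologicalSpace M] [T1Space M]
    [ChartedSpace (EuclideanHalfSpace 2) M] {S : Set M}
    (h : S.Finite) : isolatedPoints S = S := by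
  ext p
  refine ⟨fun h => h.1, fun hp => ⟨hp, (S \ {p})ᶜ, ?_, ?_⟩⟩
  · exact (h.subset Set.sdiff_subset).isClosed.isOpen_compl.mem_nhds (by simp)
  · ext x
    simp only [Set.mem_inter_iff, Set.mem_compl_iff, Set.mem_sdiff, Set.mem_singleton_iff]
    constructor
    · rintro ⟨h1, h2⟩; by_contra h3; exact h1 ⟨h2, h3⟩
    · rintro rfl; exact ⟨fun h => h.2 rfl, hp⟩

lemma height_mem_omegaClass {σ : ℝ} (hσ : σ ≠ 0) : height σ ∈ OmegaClass G.Surface :=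
  ⟨contMDiff_height σ, by
    rw [criticalPoints_height hσ, isolatedPoints_eq_of_finite (Set.finite_range _)],
    by rw [criticalPoints_height hσ, boundaryCriticalPoints_height hσ]⟩

lemma height_vertex (σ : ℝ) : height σ (G.point 0 0) = 0 ∧ height σ (G.point 1 0) = σ ∧
    height σ (G.point 2 0) = -σ := by
  simp [height_point σ zero_mem_halfDisk, zero_pow G.k_pos.ne', sphereHeight_zero,
    sphereHeight_one, sphereHeight_two]

lemma isSimpleFunction_height {σ : ℝ} (hσ : σ ≠ 0) : IsSimpleFunction (height (G := G) σ) := by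
  obtain ⟨h0, h1, h2⟩ := height_vertex (G := G) σ
  have hne : σ ≠ -σ := fun h => hσ (by linarith)
  rw [IsSimpleFunction, criticalPoints_height hσ]
  rintro _ ⟨v, rfl⟩ _ ⟨v', rfl⟩ h
  simp only at h ⊢
  fin_cases v <;> fin_cases v' <;>
    simp only [Fin.zero_eta, Fin.mk_one, Fin.reduceFinMk, h0, h1, h2] at h ⊢ <;> exfalso
  · exact hσ h.symm
  · exact hσ (by linarith)
  · exact hσ h
  · exact hne h
  · exact hσ (by linarith)
  · exact hne h.symm

lemma image_criticalPoints_height {σ : ℝ} (hσ : σ = 1 ∨ σ = -1) :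
    height σ '' criticalPoints (height (G := G) σ) = {-1, 0, 1} := by
  obtain ⟨h0, h1, h2⟩ := height_vertex (G := G) σ
  rw [criticalPoints_height (by rcases hσ with rfl | rfl <;> norm_num), ← Set.range_comp]
  ext x
  simp only [Set.mem_range, Function.comp_apply, Fin.exists_fin_succ]
  simp [h0, h1, h2, eq_comm (b := x)]
  rcases hσ with rfl | rfl <;> norm_num <;> tauto

lemma encard_criticalPoints_height {σ : ℝ} (hσ : σ ≠ 0) :
    (criticalPoints (height (G := G) σ)).encard = 3 := by
  rw [criticalPoints_height hσ, ← Set.image_univ, vertex_injective.encard_image,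
    Set.encard_univ]
  simp

end TriangleGluing

/-! ### Lifting circle-valued functions along a height function -/

section Lifting
variable {M : Type*} [TopologicalSpace M]

/-- If `g` has no local minima except its minimum point `p`, then its sublevel sets are
connected. -/
lemma isPreconnected_sublevel [CompactSpace M] {g : M → ℝ} (hg : Continuous g)
    {p : M} (hcl : ∀ x, x ≠ p → x ∈ closure {y | g y < g x}) (c : ℝ) :
    IsPreconnected {x | g x ≤ c} := by
  have hS : IsClosed {x | g x ≤ c} := isClosed_le hg continuous_const
  -- a closed piece `t'` without `p` would contain another local minimum
  have main : ∀ t t' : Set M, IsClosed t → IsClosed t' → {x | g x ≤ c} ⊆ t ∪ t' →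
      ({x | g x ≤ c} ∩ t').Nonempty → p ∉ {x | g x ≤ c} ∩ t' →
      ({x | g x ≤ c} ∩ (t ∩ t')).Nonempty := by
    intro t t' ht ht' hcov hne hp
    obtain ⟨b, hb, hmin⟩ := (hS.inter ht').isCompact.exists_isMinOn hne hg.continuousOn
    have hbp : b ≠ p := fun h => hp (h ▸ hb)
    by_contra hemp
    have hbt : b ∈ ({x | g x ≤ c} ∩ t)ᶜ := fun h => hemp ⟨b, hb.1, h.2, hb.2⟩
    obtain ⟨y, hy, hyb⟩ := mem_closure_iff.1 (hcl b hbp) _ (hS.inter ht).isOpen_compl hbt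
    have hyc : g y ≤ c := (le_of_lt hyb).trans hb.1
    rcases hcov hyc with h | h
    · exact hy ⟨hyc, h⟩
    · have h1 : g b ≤ g y := hmin ⟨hyc, h⟩
      have h2 : g y < g b := hyb
      linarith
  rw [isPreconnected_closed_iff]
  intro t t' ht ht' hcov hne hne'
  by_cases hp : p ∈ {x | g x ≤ c} ∩ t'
  · by_cases hp' : p ∈ {x | g x ≤ c} ∩ t
    · exact ⟨p, hp.1, hp'.2, hp.2⟩
    · rw [Set.inter_comm t t']
      exact main t' t ht' ht (by rwa [Set.union_comm]) hne hp'
  · exact main t t' ht ht' hcov hne' hp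

/-- `u` lifts to a real-valued function on the set `S`. -/
def HasLiftOn (u : M → Circle) (S : Set M) : Prop :=
  ∃ h : M → ℝ, ContinuousOn h S ∧ ∀ x ∈ S, Circle.exp (h x) = u x

lemma HasLiftOn.mono {u : M → Circle} {S T : Set M} (h : HasLiftOn u T) (hST : S ⊆ T) :
    HasLiftOn u S :=
  let ⟨f, hf, hu⟩ := h
  ⟨f, hf.mono hST, fun x hx => hu x (hST hx)⟩

/-- A lift may be prescribed at one point. -/
lemma HasLiftOn.exists_eq {u : M → Circle} {S : Set M} (h : HasLiftOn u S) {p : M} (hp : p ∈ S)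
    {θ : ℝ} (hθ : Circle.exp θ = u p) :
    ∃ h : M → ℝ, ContinuousOn h S ∧ (∀ x ∈ S, Circle.exp (h x) = u x) ∧ h p = θ := by
  obtain ⟨f, hf, hu⟩ := h
  obtain ⟨m, hm⟩ := Circle.exp_eq_exp.1 (hθ.trans (hu p hp).symm)
  refine ⟨fun x => f x + m * (2 * Real.pi), hf.add continuousOn_const, fun x hx => ?_, hm.symm⟩
  rw [Circle.exp_add, Circle.exp_int_mul_two_pi, mul_one, hu x hx]

/-- A lift on a connected set is determined by its value at one point. -/
lemma eqOn_of_lifts {u : M → Circle} {S : Set M} (hS : IsPreconnected S) {f g : M → ℝ}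
    (hf : ContinuousOn f S) (hg : ContinuousOn g S) (hfu : ∀ x ∈ S, Circle.exp (f x) = u x)
    (hgu : ∀ x ∈ S, Circle.exp (g x) = u x) {p : M} (hp : p ∈ S) (h : f p = g p) :
    S.EqOn f g :=
  Circle.isCoveringMap_exp.eqOn_of_comp_eqOn hS hf hg
    (fun x hx => (hfu x hx).trans (hgu x hx).symm) hp h

lemma continuousAt_circle_arg {u : M → Circle} (hu : Continuous u) {x : M}
    (h : (u x : ℂ) ∈ Complex.slitPlane) : ContinuousAt (fun y => Complex.arg (u y)) x :=
  ContinuousAt.comp (x := x) (f := fun y => ((u y : Circle) : ℂ)) (Complex.continuousAt_arg h)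
    (continuous_subtype_val.comp hu).continuousAt

lemma exists_local_lift {u : M → Circle} (hu : Continuous u) (x : M) :
    ∃ U, IsOpen U ∧ x ∈ U ∧ HasLiftOn u U := by
  have hq : Continuous fun y => u y / u x := by fun_prop
  refine ⟨{y | ((u y / u x : Circle) : ℂ) ∈ Complex.slitPlane},
    Complex.isOpen_slitPlane.preimage (continuous_subtype_val.comp hq), by simp,
    fun y => Complex.arg (u x) + Complex.arg ((u y / u x : Circle) : ℂ), ?_, ?_⟩
  · intro y hy
    exact (continuousAt_const.add (continuousAt_circle_arg hq hy)).continuousWithinAt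
  · intro y _
    rw [Circle.exp_add, Circle.exp_arg, Circle.exp_arg, mul_div_cancel]

/-- A lift on a sublevel set extends to a larger sublevel set. -/
lemma HasLiftOn.exists_gt [CompactSpace M] [T2Space M] {u : M → Circle} (hu : Continuous u)
    {g : M → ℝ} (hg : Continuous g) {c : ℝ} (h : HasLiftOn u {x | g x ≤ c}) :
    ∃ c' > c, HasLiftOn u {x | g x ≤ c'} := by
  obtain ⟨f, hf, hfu⟩ := h
  have hS : IsClosed {x | g x ≤ c} := isClosed_le hg continuous_const
  obtain ⟨F, hF⟩ := ContinuousMap.exists_restrict_eq hS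
    ⟨Set.domRestrict {x | g x ≤ c} f, hf.domRestrict⟩
  have hF' : ∀ x, g x ≤ c → F x = f x := fun x hx => by
    have := ContinuousMap.congr_fun hF ⟨x, hx⟩; exact this
  have hv : Continuous fun x => u x / Circle.exp (F x) := by fun_prop
  set O : Set M := {x | ((u x / Circle.exp (F x) : Circle) : ℂ) ∈ Complex.slitPlane} with hO
  have hOo : IsOpen O := Complex.isOpen_slitPlane.preimage (continuous_subtype_val.comp hv)
  have hSO : {x | g x ≤ c} ⊆ O := fun x hx => by
    show ((u x / Circle.exp (F x) : Circle) : ℂ) ∈ Complex.slitPlane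
    rw [hF' x hx, hfu x hx, div_self', Circle.coe_one]; simp
  have hlift : HasLiftOn u O := by
    refine ⟨fun x => F x + Complex.arg ((u x / Circle.exp (F x) : Circle) : ℂ), ?_, ?_⟩
    · intro y hy
      exact (F.continuous.continuousAt.add (continuousAt_circle_arg hv hy)).continuousWithinAt
    · intro y _
      rw [Circle.exp_add, Circle.exp_arg, mul_div_cancel]
  rcases Oᶜ.eq_empty_or_nonempty with hemp | hne
  · refine ⟨c + 1, by linarith, hlift.mono fun x _ => ?_⟩
    by_contra hx
    exact (Set.eq_empty_iff_forall_notMem.1 hemp x) hx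
  · obtain ⟨b, hb, hmin⟩ := hOo.isClosed_compl.isCompact.exists_isMinOn hne hg.continuousOn
    have hcb : c < g b := by
      by_contra! hle
      exact hb (hSO hle)
    refine ⟨(c + g b) / 2, by linarith, hlift.mono fun x hx => ?_⟩
    by_contra hxO
    have h1 : g b ≤ g x := hmin hxO
    have h2 : g x ≤ (c + g b) / 2 := hx
    linarith

/-- Lifts on all the smaller sublevel sets give a lift on a sublevel set. -/
lemma hasLiftOn_of_forall_lt [CompactSpace M] {u : M → Circle} (hu : Continuous u)
    {g : M → ℝ} (hg : Continuous g) {p : M} (hp : ∀ x, g p ≤ g x)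
    (hcl : ∀ x, x ≠ p → x ∈ closure {y | g y < g x})
    (hloc : ∀ x, x ≠ p → ∀ U ∈ 𝓝 x, ∃ V ∈ 𝓝 x, V ⊆ U ∧ IsPreconnected (V ∩ {y | g y < g x}))
    {c : ℝ} (hc : g p < c) (h : ∀ c' < c, HasLiftOn u {x | g x ≤ c'}) :
    HasLiftOn u {x | g x ≤ c} := by
  obtain ⟨θ, hθ⟩ := Circle.exp_surjective (u p)
  have hex : ∀ c', ∃ f : M → ℝ, g p ≤ c' → c' < c → ContinuousOn f {x | g x ≤ c'} ∧
      (∀ x ∈ {x | g x ≤ c'}, Circle.exp (f x) = u x) ∧ f p = θ := by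
    intro c'
    by_cases h1 : g p ≤ c' ∧ c' < c
    · obtain ⟨f, hf⟩ := (h c' h1.2).exists_eq h1.1 hθ
      exact ⟨f, fun _ _ => hf⟩
    · exact ⟨0, fun h2 h3 => absurd ⟨h2, h3⟩ h1⟩
  choose H hH using hex
  have hcompat : ∀ c₁ c₂, c₁ ≤ c₂ → g p ≤ c₁ → c₂ < c → ∀ x, g x ≤ c₁ → H c₁ x = H c₂ x := by
    intro c₁ c₂ h12 hp1 h2c x hx
    obtain ⟨a1, a2, a3⟩ := hH c₁ hp1 (by linarith)
    obtain ⟨b1, b2, b3⟩ := hH c₂ (by linarith) h2c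
    have hsub : {x | g x ≤ c₁} ⊆ {x | g x ≤ c₂} := fun y hy => le_trans hy h12
    exact eqOn_of_lifts (isPreconnected_sublevel hg hcl c₁) a1 (b1.mono hsub) a2
      (fun y hy => b2 y (hsub hy)) (p := p) hp1 (a3.trans b3.symm) hx
  set A : Set M := {x | g x < c} with hA
  have hAo : IsOpen A := isOpen_lt hg continuous_const
  set f : M → ℝ := fun x => H ((g x + c) / 2) x with hf
  have hfA : ∀ c', c' < c → ∀ x, g x ≤ c' → f x = H c' x := by
    intro c' hc' x hx
    have := hp x
    rcases le_total c' ((g x + c) / 2) with h1 | h1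
    · exact (hcompat c' _ h1 (by linarith) (by linarith) x hx).symm
    · exact hcompat _ c' h1 (by linarith) hc' x (by linarith)
  have hfc : ContinuousOn f A := by
    intro x hx
    have hx' : g x < c := hx
    have hpx := hp x
    have hnhds : {y | g y < (g x + c) / 2} ∈ 𝓝 x :=
      (isOpen_lt hg continuous_const).mem_nhds (by show g x < (g x + c) / 2; linarith)
    have h1 : ContinuousAt (H ((g x + c) / 2)) x :=
      (hH ((g x + c) / 2) (by linarith) (by linarith)).1.continuousAt
        (Filter.mem_of_superset hnhds fun y (hy : g y < (g x + c) / 2) =>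
          (le_of_lt hy : g y ≤ (g x + c) / 2))
    refine (h1.congr ?_).continuousWithinAt
    filter_upwards [hnhds] with y hy
    exact (hfA _ (by linarith) y (le_of_lt hy)).symm
  have hfu : ∀ x ∈ A, Circle.exp (f x) = u x := fun x hx => by
    have hx' : g x < c := hx
    have := hp x
    exact (hH ((g x + c) / 2) (by linarith) (by linarith)).2.1 x
      (by show g x ≤ (g x + c) / 2; linarith)
  have hBA : {x | g x ≤ c} ⊆ closure A := by
    intro x hx
    rcases (show g x ≤ c from hx).lt_or_eq with h1 | h1
    · exact subset_closure h1
    · have hxp : x ≠ p := by rintro rfl; linarith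
      have := hcl x hxp
      rwa [h1] at this
  have hlim : ∀ x ∈ {x | g x ≤ c}, ∃ y, Filter.Tendsto f (𝓝[A] x) (𝓝 y) := by
    intro x hx
    rcases (show g x ≤ c from hx).lt_or_eq with h1 | h1
    · exact ⟨f x, hfc x h1⟩
    have hxp : x ≠ p := by rintro rfl; linarith
    obtain ⟨U, hU, hxU, hUl⟩ := exists_local_lift hu x
    obtain ⟨V, hV, hVU, hVc⟩ := hloc x hxp U (hU.mem_nhds hxU)
    rw [h1] at hVc
    obtain ⟨y₀, hy₀⟩ : (V ∩ A).Nonempty := by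
      have := mem_closure_iff_nhds.1 (hBA hx) V hV
      exact this
    obtain ⟨l, hl, hlu, hly⟩ := hUl.exists_eq (hVU hy₀.1) (hfu y₀ hy₀.2)
    have heq : (V ∩ A).EqOn f l :=
      eqOn_of_lifts hVc (hfc.mono Set.inter_subset_right)
        (hl.mono (Set.inter_subset_left.trans hVU)) (fun y hy => hfu y hy.2)
        (fun y hy => hlu y (hVU hy.1)) hy₀ hly.symm
    refine ⟨l x, ?_⟩
    have h2 : Filter.Tendsto l (𝓝[A] x) (𝓝 (l x)) :=
      (hl.continuousAt (hU.mem_nhds hxU)).tendsto.mono_left nhdsWithin_le_nhds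
    refine h2.congr' ?_
    filter_upwards [nhdsWithin_le_nhds hV, self_mem_nhdsWithin] with y hyV hyA
    exact (heq ⟨hyV, hyA⟩).symm
  refine ⟨extendFrom A f, continuousOn_extendFrom hBA hlim, fun x hx => ?_⟩
  have hne : (𝓝[A] x).NeBot := mem_closure_iff_nhdsWithin_neBot.1 (hBA hx)
  have h1 := (Circle.exp.continuous.tendsto _).comp (tendsto_extendFrom (hlim x hx))
  have h2 : Filter.Tendsto u (𝓝[A] x) (𝓝 (u x)) := hu.continuousAt.tendsto.mono_left nhdsWithin_le_nhds
  refine tendsto_nhds_unique h1 (h2.congr' ?_)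
  filter_upwards [self_mem_nhdsWithin] with y hy
  exact (hfu y hy).symm

/-- Suppose that `g` has no local minimum except `p` and that near each other point the part
below the level of that point is connected. Then every circle-valued function lifts. -/
theorem hasLiftOn_univ [CompactSpace M] [T2Space M] {u : M → Circle} (hu : Continuous u)
    {g : M → ℝ} (hg : Continuous g) {p : M} (hp : ∀ x, g p ≤ g x)
    (hcl : ∀ x, x ≠ p → x ∈ closure {y | g y < g x})
    (hloc : ∀ x, x ≠ p → ∀ U ∈ 𝓝 x, ∃ V ∈ 𝓝 x, V ⊆ U ∧ IsPreconnected (V ∩ {y | g y < g x})) :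
    HasLiftOn u Set.univ := by
  obtain ⟨q, -, hq⟩ := isCompact_univ.exists_isMaxOn ⟨p, trivial⟩ hg.continuousOn
  have hq : ∀ x, g x ≤ g q := fun x => hq (Set.mem_univ x)
  set s : Set ℝ := {c | HasLiftOn u {x | g x ≤ c}} with hs
  have hmono : ∀ c ∈ s, ∀ c' ≤ c, c' ∈ s := fun c hc c' hcc =>
    HasLiftOn.mono hc fun x (hx : g x ≤ c') => le_trans hx hcc
  have hbase : g p ∈ s := by
    obtain ⟨θ, hθ⟩ := Circle.exp_surjective (u p)
    refine ⟨fun _ => θ, continuousOn_const, fun x hx => ?_⟩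
    have : x = p := by
      by_contra hxp
      have hx' : g x ≤ g p := hx
      obtain ⟨y, hy⟩ := closure_nonempty_iff.1 ⟨x, hcl x hxp⟩
      have h2 : g y < g x := hy
      linarith [hp y]
    rw [this, hθ]
  have hclosed : IsClosed (s ∩ Set.Icc (g p) (g q)) := by
    refine isClosed_of_closure_subset fun c hc => ?_
    have hcI : c ∈ Set.Icc (g p) (g q) :=
      isClosed_Icc.closure_subset_iff.2 Set.inter_subset_right hc
    refine ⟨?_, hcI⟩
    rcases hcI.1.lt_or_eq with h1 | h1
    · refine hasLiftOn_of_forall_lt hu hg hp hcl hloc h1 fun c' hc' => ?_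
      obtain ⟨d, hd, hds⟩ := mem_closure_iff.1 hc _ isOpen_Ioi hc'
      exact hmono d hds.1 c' (le_of_lt hd)
    · exact h1 ▸ hbase
  have hsub : Set.Icc (g p) (g q) ⊆ s := by
    refine hclosed.Icc_subset_of_forall_exists_gt hbase ?_
    rintro c ⟨hcs, hcI⟩ y hy
    obtain ⟨c', hc', h'⟩ := HasLiftOn.exists_gt hu hg hcs
    exact ⟨min c' y, hmono c' h' _ (min_le_left _ _), lt_min hc' hy, min_le_right _ _⟩
  exact HasLiftOn.mono (hsub ⟨hp q, le_rfl⟩) fun x _ => hq x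

end Lifting

/-! ### Sublevel sets near a point of a surface with boundary -/

section LocalSublevel

/-- Near a boundary point of the half-plane or an interior point, the part of the half-plane
below the level of the point is connected, if the derivative of the function along some admissible
direction `v` (tangent to the boundary at a boundary point) is negative. -/
lemma exists_nhdsWithin_isConnected_lt {G : EuclideanSpace ℝ (Fin 2) → ℝ}
    {a v : EuclideanSpace ℝ (Fin 2)} (ha : a ∈ Set.range (𝓡∂ 2))
    (hG : ContDiffWithinAt ℝ 1 G (Set.range (𝓡∂ 2)) a)
    (hd : fderivWithin ℝ G (Set.range (𝓡∂ 2)) a v < 0) (hv : a 0 = 0 → v 0 = 0)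
    {U : Set (EuclideanSpace ℝ (Fin 2))} (hU : U ∈ 𝓝[Set.range (𝓡∂ 2)] a) :
    ∃ V ∈ 𝓝[Set.range (𝓡∂ 2)] a, V ⊆ U ∧ IsConnected (V ∩ {y | G y < G a}) := by
  set R : Set (EuclideanSpace ℝ (Fin 2)) := Set.range (𝓡∂ 2) with hR
  have hR' : R = {y | 0 ≤ y 0} := range_modelWithCornersEuclideanHalfSpace 2
  have hRc : Convex ℝ R := (𝓡∂ 2).convex_range
  have hcont : ContinuousWithinAt (fun y => fderivWithin ℝ G R y v) R a :=
    ((hG.fderivWithin_right (m := 0) (𝓡∂ 2).uniqueDiffOn (by norm_num) ha).continuousWithinAt).clm_apply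
      continuousWithinAt_const
  have hdiff : ∀ᶠ y in 𝓝[R] a, DifferentiableWithinAt ℝ G R y := by
    have := hG.eventually (by simp)
    rw [Set.insert_eq_of_mem ha] at this
    filter_upwards [this] with y hy
    exact hy.differentiableWithinAt one_ne_zero
  have hneg : ∀ᶠ y in 𝓝[R] a, fderivWithin ℝ G R y v < 0 := hcont.eventually_lt_const hd
  have hpos : ∀ᶠ y in 𝓝 a, a 0 ≠ 0 → 0 ≤ y 0 := by
    by_cases h0 : a 0 = 0
    · exact Filter.Eventually.of_forall fun y h => absurd h0 h
    · have h1 : 0 < a 0 := lt_of_le_of_ne (by rw [hR'] at ha; exact ha) (Ne.symm h0)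
      have h2 : Continuous fun y : EuclideanSpace ℝ (Fin 2) => y 0 := by fun_prop
      filter_upwards [h2.continuousAt.eventually_const_lt h1] with y hy _
      exact le_of_lt hy
  obtain ⟨ε₁, hε₁, hball⟩ := Metric.mem_nhdsWithin_iff.1
    (Filter.eventually_mem_set.2 hU |>.and (hdiff.and hneg) :
      ∀ᶠ y in 𝓝[R] a, y ∈ U ∧ DifferentiableWithinAt ℝ G R y ∧ fderivWithin ℝ G R y v < 0)
  obtain ⟨ε₂, hε₂, hball'⟩ := Metric.mem_nhds_iff.1 hpos
  set ε := min ε₁ ε₂ with hεd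
  have hε : 0 < ε := lt_min hε₁ hε₂
  replace hball : Metric.ball a ε ∩ R ⊆ _ := Set.Subset.trans
    (Set.inter_subset_inter_left R (Metric.ball_subset_ball (min_le_left _ _))) hball
  replace hball' : Metric.ball a ε ⊆ _ :=
    (Metric.ball_subset_ball (min_le_right ε₁ ε₂)).trans hball'
  set C := Metric.ball a ε ∩ R with hC
  have hCc : Convex ℝ C := (convex_ball a ε).inter hRc
  have hanti : ∀ y ∈ C, ∀ s : ℝ, 0 < s → y + s • v ∈ C → G (y + s • v) < G y := by
    intro y hy s hs hys
    obtain ⟨z, hz, hzeq⟩ := domain_mvt (f := G) (f' := fun z => fderivWithin ℝ G R z) (s := C)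
      (fun z hz => ((hball hz).2.1.hasFDerivWithinAt).mono Set.inter_subset_right) hCc hy hys
    rw [add_sub_cancel_left, map_smul, smul_eq_mul] at hzeq
    have := (hball (hCc.segment_subset hy hys hz)).2.2
    nlinarith
  have hmove : ∀ y ∈ R, ∀ s : ℝ, y + s • v ∈ Metric.ball a ε → y + s • v ∈ C := by
    intro y hy s hs
    refine ⟨hs, ?_⟩
    by_cases h0 : a 0 = 0
    · rw [hR'] at hy ⊢
      simpa [hv h0] using hy
    · rw [hR']; exact hball' hs h0
  have hv0 : v ≠ 0 := by rintro rfl; simp at hd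
  have hvn : 0 < ‖v‖ := norm_pos_iff.2 hv0
  obtain ⟨r, hr, hrv⟩ : ∃ r > 0, r * ‖v‖ = ε / 2 :=
    ⟨ε / 2 / ‖v‖, by positivity, div_mul_cancel₀ _ hvn.ne'⟩
  have hnear : ∀ y ∈ Metric.ball a (ε / 2), ∀ s ∈ Set.Icc 0 r, y + s • v ∈ Metric.ball a ε := by
    intro y hy s hs
    rw [Metric.mem_ball, dist_eq_norm] at hy ⊢
    have h1 : ‖s • v‖ ≤ ε / 2 := by
      rw [norm_smul, Real.norm_of_nonneg hs.1, ← hrv]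
      exact mul_le_mul_of_nonneg_right hs.2 hvn.le
    have h2 : y + s • v - a = (y - a) + s • v := by abel
    rw [h2]
    linarith [norm_add_le (y - a) (s • v)]
  have hGc : ContinuousOn G C := fun y hy =>
    (hball hy).2.1.continuousWithinAt.mono Set.inter_subset_right
  have haC : a ∈ C := ⟨Metric.mem_ball_self hε, ha⟩
  have hab : a ∈ Metric.ball a (ε / 2) := Metric.mem_ball_self (by linarith)
  have hrI : r ∈ Set.Icc 0 r := ⟨hr.le, le_rfl⟩
  have haC' : a + r • v ∈ C := hmove a ha r (hnear a hab r hrI)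
  have hCR : C ∈ 𝓝[R] (a + r • v) :=
    Filter.inter_mem (nhdsWithin_le_nhds (Metric.isOpen_ball.mem_nhds haC'.1)) self_mem_nhdsWithin
  -- the translate of a small half-ball lies below the level of `a`
  have hlow : ∀ᶠ y in 𝓝[R] (a + r • v), G y < G a :=
    ((hGc _ haC').mono_of_mem_nhdsWithin hCR).eventually_lt_const (hanti a haC r hr haC')
  obtain ⟨δ₁, hδ₁, hlow⟩ := Metric.mem_nhdsWithin_iff.1 hlow
  set δ := min δ₁ (ε / 2) with hδd
  have hδ : 0 < δ := lt_min hδ₁ (by linarith)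
  have hδε : Metric.ball a δ ⊆ Metric.ball a (ε / 2) := Metric.ball_subset_ball (min_le_right _ _)
  set N := Metric.ball a δ ∩ R with hN
  have hNc : Convex ℝ N := (convex_ball a δ).inter hRc
  have hNC : ∀ y ∈ N, ∀ s ∈ Set.Icc 0 r, y + s • v ∈ C := fun y hy s hs =>
    hmove y hy.2 s (hnear y (hδε hy.1) s hs)
  have hbot : ∀ y ∈ N, G (y + r • v) < G a := fun y hy => by
    refine hlow ⟨?_, (hNC y hy r hrI).2⟩
    have h1 : dist y a < δ := hy.1
    rw [Metric.mem_ball, dist_add_right]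
    exact h1.trans_le (min_le_left _ _)
  set V : Set (EuclideanSpace ℝ (Fin 2)) := {z | ∃ y ∈ N, ∃ s ∈ Set.Icc 0 r, z = y + s • v} with hV
  have haN : a ∈ N := ⟨Metric.mem_ball_self hδ, ha⟩
  have hbase : a + r • v ∈ V ∩ {y | G y < G a} := ⟨⟨a, haN, r, hrI, rfl⟩, hbot a haN⟩
  refine ⟨V, ?_, ?_, ⟨_, hbase⟩, ?_⟩
  · refine Filter.mem_of_superset (Filter.inter_mem (nhdsWithin_le_nhds
      (Metric.ball_mem_nhds a hδ)) self_mem_nhdsWithin) fun y hy => ?_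
    exact ⟨y, hy, 0, ⟨le_rfl, hr.le⟩, by simp⟩
  · rintro _ ⟨y, hy, s, hs, rfl⟩
    exact (hball (hNC y hy s hs)).1
  refine isPreconnected_of_forall (a + r • v) ?_
  rintro _ ⟨⟨y, hy, s, hs, rfl⟩, hlt⟩
  refine ⟨(fun z => z + r • v) '' N ∪ (fun t : ℝ => y + t • v) '' Set.Icc s r, ?_, ?_, ?_, ?_⟩
  · rintro _ (⟨z, hz, rfl⟩ | ⟨t, ht, rfl⟩)
    · exact ⟨⟨z, hz, r, hrI, rfl⟩, hbot z hz⟩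
    · have ht0 : t ∈ Set.Icc 0 r := ⟨hs.1.trans ht.1, ht.2⟩
      refine ⟨⟨y, hy, t, ht0, rfl⟩, ?_⟩
      rcases ht.1.lt_or_eq with h1 | h1
      · have h2 : y + s • v + (t - s) • v = y + t • v := by rw [sub_smul]; abel
        have h3 := hanti _ (hNC y hy s hs) (t - s) (by linarith) (by rw [h2]; exact hNC y hy t ht0)
        rw [h2] at h3
        exact h3.trans hlt
      · rw [← h1]; exact hlt
  · exact Or.inl ⟨a, haN, rfl⟩
  · exact Or.inr ⟨s, ⟨le_rfl, hs.2⟩, rfl⟩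
  · refine IsPreconnected.union (y + r • v) ⟨y, hy, rfl⟩ ⟨r, ⟨hs.2, le_rfl⟩, rfl⟩ ?_ ?_
    · exact hNc.isPreconnected.image _ (by fun_prop)
    · exact (convex_Icc s r).isPreconnected.image _ (by fun_prop)

/-- A half-ball remains connected when its centre is removed. -/
lemma exists_nhdsWithin_isConnected_diff {a : EuclideanSpace ℝ (Fin 2)} (ha : a 0 = 0)
    {U : Set (EuclideanSpace ℝ (Fin 2))} (hU : U ∈ 𝓝[Set.range (𝓡∂ 2)] a) :
    ∃ V ∈ 𝓝[Set.range (𝓡∂ 2)] a, V ⊆ U ∧ IsConnected (V ∩ {y | y ≠ a}) := by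
  obtain ⟨ε, hε, hball⟩ := Metric.mem_nhdsWithin_iff.1 hU
  rw [range_modelWithCornersEuclideanHalfSpace] at *
  set A : Set (EuclideanSpace ℝ (Fin 2)) := Metric.ball a ε ∩ {y | 0 < y 0} with hA
  have hc : Convex ℝ {y : EuclideanSpace ℝ (Fin 2) | 0 < y 0} :=
    convex_halfSpace_gt (f := fun y : EuclideanSpace ℝ (Fin 2) => y 0) ⟨fun _ _ => rfl, fun _ _ => rfl⟩ 0
  have hAc : IsPreconnected A := ((convex_ball a ε).inter hc).isPreconnected
  set e : EuclideanSpace ℝ (Fin 2) := EuclideanSpace.single 0 1 with he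
  have hcurve : ∀ y : EuclideanSpace ℝ (Fin 2), Filter.Tendsto (fun t : ℝ => y + t • e) (𝓝[>] 0)
      (𝓝 y) := fun y => by
    have : Continuous fun t : ℝ => y + t • e := by fun_prop
    have h := this.tendsto 0
    rw [zero_smul, add_zero] at h
    exact h.mono_left nhdsWithin_le_nhds
  have hcl : Metric.ball a ε ∩ {y | 0 ≤ y 0} ⊆ closure A := by
    intro y hy
    refine mem_closure_of_tendsto (hcurve y) ?_
    filter_upwards [hcurve y (Metric.isOpen_ball.mem_nhds hy.1), self_mem_nhdsWithin] with t h1 h2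
    have h3 : 0 ≤ y 0 := hy.2
    have h4 : 0 < t := h2
    refine ⟨h1, ?_⟩
    simp [he]; linarith
  have hAne : A.Nonempty := closure_nonempty_iff.1 ⟨a, hcl ⟨Metric.mem_ball_self hε, ha.ge⟩⟩
  have hsub : A ⊆ Metric.ball a ε ∩ {y | 0 ≤ y 0} ∩ {y | y ≠ a} := fun y hy =>
    ⟨⟨hy.1, show 0 ≤ y 0 from le_of_lt hy.2⟩, fun h => by have h2 : 0 < y 0 := hy.2; rw [h, ha] at h2; exact lt_irrefl _ h2⟩
  refine ⟨Metric.ball a ε ∩ {y | 0 ≤ y 0}, Filter.inter_mem (nhdsWithin_le_nhds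
      (Metric.ball_mem_nhds a hε)) self_mem_nhdsWithin, hball, hAne.mono hsub, ?_⟩
  exact hAc.subset_closure hsub (Set.inter_subset_left.trans hcl)

end LocalSublevel

/-! ### Functions with two critical points -/

section Omega
variable {M : Type*} [TopologicalSpace M] [ChartedSpace (EuclideanHalfSpace 2) M]

lemma frontier_range_half_plane (a : EuclideanSpace ℝ (Fin 2)) :
    a ∈ frontier (Set.range (𝓡∂ 2)) ↔ a 0 = 0 := by
  rw [frontier_range_modelWithCornersEuclideanHalfSpace]
  exact eq_comm

/-- Connectedness below a level may be checked in the preferred chart. -/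
lemma exists_nhds_isConnected_lt_of_chart {g : M → ℝ} {x : M}
    (h : ∀ U ∈ 𝓝[Set.range (𝓡∂ 2)] (extChartAt (𝓡∂ 2) x x),
      U ⊆ (extChartAt (𝓡∂ 2) x).target → ∃ V ∈ 𝓝[Set.range (𝓡∂ 2)] (extChartAt (𝓡∂ 2) x x),
        V ⊆ U ∧ IsConnected (V ∩ {y | g ((extChartAt (𝓡∂ 2) x).symm y) < g x})) :
    ∀ U ∈ 𝓝 x, ∃ V ∈ 𝓝 x, V ⊆ U ∧ IsConnected (V ∩ {y | g y < g x}) := by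
  intro U hU
  set φ := extChartAt (𝓡∂ 2) x
  obtain ⟨V, hV, hVU, hc⟩ := h (φ.target ∩ φ.symm ⁻¹' U)
    (Filter.inter_mem (extChartAt_target_mem_nhdsWithin x)
      (by rw [← map_extChartAt_symm_nhdsWithin_range (I := 𝓡∂ 2) x] at hU; exact hU))
    Set.inter_subset_left
  refine ⟨φ.symm '' V, ?_, ?_, ?_⟩
  · rw [← map_extChartAt_symm_nhdsWithin_range (I := 𝓡∂ 2) x]
    exact Filter.image_mem_map hV
  · rintro _ ⟨y, hy, rfl⟩
    exact (hVU hy).2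
  · have : φ.symm '' V ∩ {y | g y < g x} = φ.symm '' (V ∩ {y | g (φ.symm y) < g x}) := by
      ext z
      constructor
      · rintro ⟨⟨y, hy, rfl⟩, hz⟩; exact ⟨y, ⟨hy, hz⟩, rfl⟩
      · rintro ⟨y, ⟨hy, hz⟩, rfl⟩; exact ⟨⟨y, hy, rfl⟩, hz⟩
    rw [this]
    exact hc.image _ ((continuousOn_extChartAt_symm x).mono fun y hy => (hVU hy.1).1)

lemma exists_nhds_isConnected_lt {g : M → ℝ} (hg : ContMDiff (𝓡∂ 2) 𝓘(ℝ, ℝ) ∞ g) {x : M}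
    (hx : x ∉ criticalPoints g) (hx' : x ∉ boundaryCriticalPoints g) :
    ∀ U ∈ 𝓝 x, ∃ V ∈ 𝓝 x, V ⊆ U ∧ IsConnected (V ∩ {y | g y < g x}) := by
  refine exists_nhds_isConnected_lt_of_chart fun U hU _ => ?_
  set φ := extChartAt (𝓡∂ 2) x with hφ
  have h1 := (contMDiffAt_iff.1 (hg x)).2
  have hG : ContDiffWithinAt ℝ 1 (g ∘ φ.symm) (Set.range (𝓡∂ 2)) (φ x) := h1.of_le (by simp)
  have hm : mfderiv (𝓡∂ 2) 𝓘(ℝ, ℝ) g x = fderivWithin ℝ (g ∘ φ.symm) (Set.range (𝓡∂ 2)) (φ x) :=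
    ((hg x).mdifferentiableAt (by simp)).mfderiv
  have hxr : φ x ∈ Set.range (𝓡∂ 2) := extChartAt_target_subset_range x (mem_extChartAt_target x)
  obtain ⟨v, hv0, hv⟩ : ∃ v : EuclideanSpace ℝ (Fin 2), (φ x 0 = 0 → v 0 = 0) ∧
      fderivWithin ℝ (g ∘ φ.symm) (Set.range (𝓡∂ 2)) (φ x) v ≠ 0 := by
    by_cases hb : φ x 0 = 0
    · by_contra! hcon
      refine hx' ⟨(frontier_range_half_plane _).2 hb, fun v hv => ?_⟩
      rw [hm]; exact hcon v fun _ => hv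
    · by_contra! hcon
      refine hx ?_
      show mfderiv (𝓡∂ 2) 𝓘(ℝ, ℝ) g x = 0
      rw [hm]
      exact ContinuousLinearMap.ext fun v => hcon v fun h => absurd h hb
  have hval : g x = (g ∘ φ.symm) (φ x) := by
    rw [Function.comp_apply, hφ, extChartAt_to_inv]
  rw [hval]
  rcases lt_or_gt_of_ne hv with h2 | h2
  · exact exists_nhdsWithin_isConnected_lt hxr hG h2 hv0 hU
  · refine exists_nhdsWithin_isConnected_lt (v := -v) hxr hG ?_ (fun h => ?_) hU
    · rw [map_neg]; linarith
    · simp [hv0 h]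

lemma mem_closure_lt_of_not_critical {g : M → ℝ} (hg : ContMDiff (𝓡∂ 2) 𝓘(ℝ, ℝ) ∞ g) {x : M}
    (hx : x ∉ criticalPoints g) (hx' : x ∉ boundaryCriticalPoints g) :
    x ∈ closure {y | g y < g x} := by
  rw [mem_closure_iff_nhds]
  intro U hU
  obtain ⟨V, -, hVU, hc⟩ := exists_nhds_isConnected_lt hg hx hx' U hU
  exact hc.nonempty.mono (Set.inter_subset_inter_left _ hVU)

lemma criticalPoints_neg (g : M → ℝ) : criticalPoints (-g) = criticalPoints g := by
  ext x
  show mfderiv (𝓡∂ 2) 𝓘(ℝ, ℝ) (-g) x = 0 ↔ mfderiv (𝓡∂ 2) 𝓘(ℝ, ℝ) g x = 0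
  rw [mfderiv_neg]
  exact neg_eq_zero

lemma boundaryCriticalPoints_neg (g : M → ℝ) :
    boundaryCriticalPoints (-g) = boundaryCriticalPoints g := by
  ext x
  refine and_congr Iff.rfl (forall₂_congr fun v _ => ?_)
  rw [mfderiv_neg]
  exact neg_eq_zero

lemma mem_criticalPoints_of_forall_le {g : M → ℝ} (hg : g ∈ OmegaClass M) {x : M}
    (hx : ∀ y, g x ≤ g y) : x ∈ criticalPoints g := by
  by_contra h
  obtain ⟨y, hy⟩ := closure_nonempty_iff.1
    ⟨x, mem_closure_lt_of_not_critical hg.1 h (hg.2.2 ▸ h)⟩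
  exact not_lt.2 (hx y) hy

lemma mem_criticalPoints_of_forall_ge {g : M → ℝ} (hg : g ∈ OmegaClass M) {x : M}
    (hx : ∀ y, g y ≤ g x) : x ∈ criticalPoints g := by
  by_contra h
  have h' : x ∉ boundaryCriticalPoints g := hg.2.2 ▸ h
  rw [← criticalPoints_neg] at h
  rw [← boundaryCriticalPoints_neg] at h'
  obtain ⟨y, hy⟩ := closure_nonempty_iff.1 ⟨x, mem_closure_lt_of_not_critical hg.1.neg h h'⟩
  have h2 : -g y < -g x := hy
  linarith [hx y]

/-- A function of the class `Ω(M)` with only two critical points forces every circle-valued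
function on `M` to lift to the line. -/
theorem hasLiftOn_of_encard_criticalPoints_lt [CompactSpace M] [T2Space M] {g : M → ℝ}
    (hg : g ∈ OmegaClass M) (hcard : (criticalPoints g).encard < 3)
    (hM : 3 ≤ (Set.univ : Set M).encard) {u : M → Circle} (hu : Continuous u) :
    HasLiftOn u Set.univ := by
  have hgc : Continuous g := hg.1.continuous
  have hne : (Set.univ : Set M).Nonempty := by
    rw [← Set.encard_pos]; exact lt_of_lt_of_le (by norm_num) hM
  obtain ⟨p, -, hp⟩ := isCompact_univ.exists_isMinOn hne hgc.continuousOn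
  obtain ⟨q, -, hq⟩ := isCompact_univ.exists_isMaxOn hne hgc.continuousOn
  replace hp : ∀ x, g p ≤ g x := fun x => hp (Set.mem_univ x)
  replace hq : ∀ x, g x ≤ g q := fun x => hq (Set.mem_univ x)
  have hlt : g p < g q := by
    by_contra! h
    have : criticalPoints g = Set.univ := Set.eq_univ_of_forall fun x =>
      mem_criticalPoints_of_forall_le hg fun y => (hq x).trans (h.trans (hp y))
    rw [this] at hcard
    exact not_lt.2 hM hcard
  have hpq : p ≠ q := fun h => by rw [h] at hlt; exact lt_irrefl _ hlt
  have hcrit : {p, q} = criticalPoints g := by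
    refine (Set.toFinite {p, q}).eq_of_subset_of_encard_le ?_ ?_
    · rintro x (rfl | rfl)
      · exact mem_criticalPoints_of_forall_le hg hp
      · exact mem_criticalPoints_of_forall_ge hg hq
    · rw [Set.encard_pair hpq]
      exact Order.le_of_lt_add_one (by simpa [two_add_one_eq_three] using hcard)
  have hnot : ∀ x, x ≠ p → x ≠ q → x ∉ criticalPoints g := fun x h1 h2 h => by
    rw [← hcrit] at h; rcases h with h | h
    · exact h1 h
    · exact h2 h
  have hloc : ∀ x, x ≠ p → ∀ U ∈ 𝓝 x, ∃ V ∈ 𝓝 x, V ⊆ U ∧ IsConnected (V ∩ {y | g y < g x}) := by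
    intro x hxp
    by_cases hxq : x = q
    · subst hxq
      have hb : x ∈ boundaryCriticalPoints g := hg.2.2 ▸ hcrit ▸ Or.inr rfl
      have hb0 : extChartAt (𝓡∂ 2) x x 0 = 0 := (frontier_range_half_plane _).1 hb.1
      refine exists_nhds_isConnected_lt_of_chart fun U hU hUt => ?_
      obtain ⟨V, hV, hVU, hc⟩ := exists_nhdsWithin_isConnected_diff hb0 hU
      refine ⟨V, hV, hVU, ?_⟩
      convert hc using 1
      ext y
      refine and_congr_right fun hy => ?_
      have hyt := hUt (hVU hy)
      constructor
      · rintro h rfl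
        rw [Set.mem_ofPred_eq, extChartAt_to_inv] at h
        exact lt_irrefl _ h
      · intro h
        refine lt_of_le_of_ne (hq _) fun heq => h ?_
        have h3 : (extChartAt (𝓡∂ 2) x).symm y ∈ criticalPoints g :=
          mem_criticalPoints_of_forall_ge hg fun z => heq ▸ hq z
        rw [← hcrit] at h3
        rcases h3 with h3 | h3
        · rw [h3] at heq; exact absurd heq hlt.ne
        · rw [Set.mem_singleton_iff] at h3
          rw [← (extChartAt (𝓡∂ 2) x).right_inv hyt, h3]
    · exact exists_nhds_isConnected_lt hg.1 (hnot x hxp hxq) (hg.2.2 ▸ hnot x hxp hxq)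
  refine hasLiftOn_univ hu hgc hp (fun x hx => ?_) fun x hx U hU => ?_
  · rw [mem_closure_iff_nhds]
    intro U hU
    obtain ⟨V, -, hVU, hc⟩ := hloc x hx U hU
    exact hc.nonempty.mono (Set.inter_subset_inter_left _ hVU)
  · obtain ⟨V, hV, hVU, hc⟩ := hloc x hx U hU
    exact ⟨V, hV, hVU, hc.isPreconnected⟩

end Omega

/-! ### Circle-valued functions defined by cochains -/

section sectors
variable {k : ℕ}

lemma continuousWithinAt_arg_upperHalfPlane {z : ℂ} (hz : z ≠ 0) :
    ContinuousWithinAt Complex.arg {w | 0 ≤ w.im} z := by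
  by_cases hs : z ∈ Complex.slitPlane
  · exact (Complex.continuousAt_arg hs).continuousWithinAt
  · rw [Complex.mem_slitPlane_iff, not_or, not_lt, not_not] at hs
    refine Complex.continuousWithinAt_arg_of_re_neg_of_im_zero (lt_of_le_of_ne hs.1 fun h0 => ?_) hs.2
    exact hz (Complex.ext h0 hs.2)

/-- The part of the half-disk that lies in a closed sector. -/
def sectorOfDisk (k s : ℕ) : Set ℂ := {w | w ∈ halfDisk ∧ s ∈ sectors k w}

lemma isPreconnected_sectorOfDisk (s : ℕ) : IsPreconnected (sectorOfDisk k s) := by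
  refine isPreconnected_of_forall 0 fun w hw => ?_
  refine ⟨(fun t : ℝ => (t : ℂ) * w) '' Set.Icc 0 1, ?_, ⟨0, by simp, by simp⟩, ⟨1, by simp, by simp⟩,
    (convex_Icc (0 : ℝ) 1).isPreconnected.image _ (by fun_prop)⟩
  rintro _ ⟨t, ht, rfl⟩
  refine ⟨⟨?_, ?_⟩, hw.2.1, ?_⟩
  · rw [Complex.im_ofReal_mul]; exact mul_nonneg ht.1 hw.1.1
  · rw [map_mul, Complex.normSq_ofReal]
    have := Complex.normSq_nonneg w
    have h2 : Complex.normSq w < 1 := hw.1.2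
    have h3 := mul_le_one₀ ht.2 ht.1 ht.2
    nlinarith
  · rcases ht.1.lt_or_eq with h0 | h0
    · rcases hw.2.2 with h | h
      · exact Or.inl (by simp [h])
      · exact Or.inr (by rw [Complex.arg_real_mul w h0]; exact h)
    · exact Or.inl (by rw [← h0]; simp)

/-- A function on the half-disk that is continuous on every sector is continuous. -/
lemma continuousOn_halfDisk_of_sectors (hk : 0 < k) {X : Type*} [TopologicalSpace X] {f : ℂ → X}
    (h : ∀ s < k, ContinuousOn f (sectorOfDisk k s)) : ContinuousOn f halfDisk := by
  have hcov : halfDisk ⊆ ⋃ s : Fin k, sectorOfDisk k s := fun w hw => by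
    obtain ⟨s, hs⟩ := sectors_nonempty hk hw.1
    exact Set.mem_iUnion.2 ⟨⟨s, hs.1⟩, hw, hs⟩
  intro w hw
  refine ContinuousWithinAt.mono ?_ hcov
  show Filter.Tendsto f (𝓝[⋃ s : Fin k, sectorOfDisk k s] w) (𝓝 (f w))
  rw [nhdsWithin_iUnion, Filter.tendsto_iSup]
  intro s
  by_cases hs : (s : ℕ) ∈ sectors k w
  · exact h s s.2 w ⟨hw, hs⟩
  have hw0 : w ≠ 0 := fun h0 => hs ⟨s.2, Or.inl h0⟩
  have hs' : ¬ (s * Real.pi / k ≤ w.arg ∧ w.arg ≤ (s + 1) * Real.pi / k) := fun h' =>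
    hs ⟨s.2, Or.inr h'⟩
  have hempty : 𝓝[sectorOfDisk k s] w = ⊥ := by
    rw [← Filter.empty_mem_iff_bot]
    have h1 : ∀ᶠ z in 𝓝[sectorOfDisk k s] w,
        ¬ (s * Real.pi / k ≤ z.arg ∧ z.arg ≤ (s + 1) * Real.pi / k) := by
      have harg : Filter.Tendsto Complex.arg (𝓝[sectorOfDisk k s] w) (𝓝 w.arg) :=
        (continuousWithinAt_arg_upperHalfPlane hw0).mono_left
          (nhdsWithin_mono w fun z hz => hz.1.1)
      exact harg.eventually ((isClosed_Icc (a := s * Real.pi / k)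
        (b := (s + 1) * Real.pi / k)).isOpen_compl.mem_nhds hs')
    have h2 : ∀ᶠ z in 𝓝[sectorOfDisk k s] w, z ≠ 0 :=
      nhdsWithin_le_nhds (isOpen_ne.mem_nhds hw0)
    filter_upwards [h1, h2, self_mem_nhdsWithin] with z h1 h2 h3
    exact h1 (h3.2.2.resolve_left h2)
  rw [hempty]
  exact Filter.tendsto_bot

/-- A point lying in two different sectors is the centre or lies on the ray between two
successive sectors. -/
lemma pow_eq_of_mem_sectors_of_lt (hk : 0 < k) {w : ℂ} {s t : ℕ} (hs : s ∈ sectors k w)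
    (ht : t ∈ sectors k w) (hst : s < t) (hw : w ≠ 0) :
    t = s + 1 ∧ w ^ k = (-1) ^ t * ((‖w‖ ^ k : ℝ) : ℂ) := by
  have hk' : (0 : ℝ) < k := by exact_mod_cast hk
  have h1 := (hs.2.resolve_left hw).2
  have h2 := (ht.2.resolve_left hw).1
  have hpi := Real.pi_pos
  rw [le_div_iff₀ hk'] at h1
  rw [div_le_iff₀ hk'] at h2
  have h3 : (t : ℝ) ≤ s + 1 := by
    have := h2.trans h1
    exact le_of_mul_le_mul_right this hpi
  have h4 : t = s + 1 := le_antisymm (by exact_mod_cast h3) hst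
  refine ⟨h4, ?_⟩
  have h5 : w.arg * k = t * Real.pi := le_antisymm (by rw [h4]; push_cast; exact h1) h2
  rw [pow_eq_polar, mul_comm (k : ℝ), h5, mul_comm]
  congr 1
  rw [← Complex.exp_pi_mul_I, ← Complex.exp_nat_mul]
  push_cast
  congr 1; ring

end sectors

/-- Partition of unity on the surface: the functions `max 0 (g j - 1 / 4)`, normalized. -/
noncomputable def barycentric (g : Fin 3 → ℝ) (j : Fin 3) : ℝ :=
  max 0 (g j - 1 / 4) / ∑ i, max 0 (g i - 1 / 4)

section barycentric
variable {g : Fin 3 → ℝ}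

lemma sum_max_pos (h : g 0 + g 1 + g 2 = 3 / 2) : 0 < ∑ i, max 0 (g i - 1 / 4) := by
  rw [Fin.sum_univ_three]
  have := fun i => le_max_right 0 (g i - 1 / 4)
  linarith [this 0, this 1, this 2]

lemma sum_barycentric (h : g 0 + g 1 + g 2 = 3 / 2) : ∑ j, barycentric g j = 1 := by
  simp_rw [barycentric]
  rw [← Finset.sum_div]
  exact div_self (sum_max_pos h).ne'

lemma barycentric_eq_zero {j : Fin 3} (h : g j ≤ 1 / 4) : barycentric g j = 0 := by
  rw [barycentric, max_eq_left (by linarith), zero_div]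

end barycentric

namespace TriangleGluing
variable {G : TriangleGluing}

lemma sum_weight (P : G.Surface) : G.weight P 0 + G.weight P 1 + G.weight P 2 = 3 / 2 := by
  obtain ⟨v, w, hw, rfl⟩ := exists_eq_point P
  rw [weight_point hw, sum_weights]

lemma sum_univ_eq (v : Fin 3) (f : Fin 3 → ℝ) : ∑ j, f j = f v + f (v + 1) + f (v + 2) := by
  rw [Fin.sum_univ_three]
  fin_cases v <;> simp <;> ring

lemma continuous_barycentric (j : Fin 3) :
    Continuous fun P : G.Surface => barycentric (G.weight P) j := by
  have h : ∀ i, Continuous fun P : G.Surface => max 0 (G.weight P i - 1 / 4) := fun i =>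
    continuous_const.max ((continuous_weight i).sub continuous_const)
  exact (h j).div (continuous_finsetSum _ fun i _ => h i) fun P => (sum_max_pos (sum_weight P)).ne'

lemma barycentric_vertex (v j : Fin 3) :
    barycentric (G.weight (G.point v 0)) j = if j = v then 1 else 0 := by
  have hw : ∀ i, i ≠ v → G.weight (G.point v 0) i ≤ 1 / 4 := fun i hi => by
    by_contra! h
    exact hi (eq_of_quarter_lt_weight_vertex h)
  have hz : ∀ i, i ≠ v → barycentric (G.weight (G.point v 0)) i = 0 := fun i hi =>
    barycentric_eq_zero (hw i hi)
  split_ifs with h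
  · subst h
    rw [← sum_barycentric (sum_weight (G.point j 0)), Finset.sum_eq_single j (fun i _ hi => hz i hi)
      (by simp)]
  · exact hz j h

/-- Integers assigned to the corners of the triangles, such that across a side of two triangles
the values at both ends of the side change by the same amount. -/
def IsCochain (G : TriangleGluing) (n : Fin 3 → ℕ → ℤ) : Prop :=
  ∀ v c, 0 < c → c < G.k → n v (G.tri v c) - n v (G.tri v (c - 1)) =
    n (opposite v c) (G.tri v c) - n (opposite v c) (G.tri v (c - 1))

/-- The affine function on the triangle `T` with the given values at the corners. -/
noncomputable def affineValue (n : Fin 3 → ℕ → ℤ) (P : G.Surface) (T : ℕ) : ℝ :=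
  ∑ j, barycentric (G.weight P) j * n j T

lemma affineValue_vertex (n : Fin 3 → ℕ → ℤ) (v : Fin 3) (T : ℕ) :
    affineValue n (G.point v 0) T = n v T := by
  simp [affineValue, barycentric_vertex]

/-- The values at a point of the affine functions on different triangles containing the point differ
by an integer. -/
lemma exists_int_affineValue_sub {n : Fin 3 → ℕ → ℤ} (hn : G.IsCochain n) {P : G.Surface} {T T' : ℕ}
    (hT : T ∈ G.triangles P) (hT' : T' ∈ G.triangles P) :
    ∃ m : ℤ, affineValue n P T = affineValue n P T' + m := by
  obtain ⟨v, w, hw, rfl⟩ := exists_eq_point P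
  rw [triangles_point hw] at hT hT'
  obtain ⟨s, hs, rfl⟩ := hT
  obtain ⟨t, ht, rfl⟩ := hT'
  by_cases hw0 : w = 0
  · subst hw0
    refine ⟨n v (G.tri v s) - n v (G.tri v t), ?_⟩
    rw [affineValue_vertex, affineValue_vertex]; push_cast; ring
  have main : ∀ s t, s ∈ sectors G.k w → t ∈ sectors G.k w → s < t →
      affineValue n (G.point v w) (G.tri v t) = affineValue n (G.point v w) (G.tri v s) +
        (n v (G.tri v t) - n v (G.tri v s) : ℤ) := by
    intro s t hs ht hst
    obtain ⟨rfl, hpow⟩ := pow_eq_of_mem_sectors_of_lt G.k_pos hs ht hst hw0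
    have hc := hn v (s + 1) (by omega) ht.1
    rw [Nat.add_sub_cancel] at hc
    have hsum := sum_barycentric (sum_weight (G.point v w))
    set x := barycentric (G.weight (G.point v w)) with hx
    have hr0 : 0 ≤ ‖w‖ ^ G.k := by positivity
    have hr1 : ‖w‖ ^ G.k ≤ 1 := pow_le_one₀ (norm_nonneg w) (by
      have h1 : Complex.normSq w < 1 := hw.2
      rw [Complex.normSq_eq_norm_sq] at h1
      nlinarith [norm_nonneg w])
    rw [affineValue, affineValue, sum_univ_eq v, sum_univ_eq v]
    rw [sum_univ_eq v] at hsum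
    rw [← hx]
    by_cases he : Even (s + 1)
    · rw [opposite, if_pos he] at hc
      have hz : x (v + 2) = 0 := barycentric_eq_zero <| not_lt.1 fun h => by
        rw [weight_point hw, quarter_lt_weights_add_two, hpow, he.neg_one_pow, one_mul,
          Complex.normSq_ofReal, Complex.ofReal_re] at h
        nlinarith
      rw [hz] at hsum ⊢
      have hc' : ((n v (G.tri v (s + 1)) : ℝ) - n v (G.tri v s)) =
        n (v + 1) (G.tri v (s + 1)) - n (v + 1) (G.tri v s) := by exact_mod_cast hc
      push_cast
      linear_combination (-x (v + 1)) * hc' +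
        ((n v (G.tri v (s + 1)) : ℝ) - n v (G.tri v s)) * hsum
    · rw [opposite, if_neg he] at hc
      have hz : x (v + 1) = 0 := barycentric_eq_zero <| not_lt.1 fun h => by
        rw [weight_point hw, quarter_lt_weights_add_one, hpow,
          (Nat.not_even_iff_odd.1 he).neg_one_pow, neg_one_mul, Complex.normSq_neg,
          Complex.normSq_ofReal, Complex.neg_re, Complex.ofReal_re] at h
        nlinarith
      rw [hz] at hsum ⊢
      have hc' : ((n v (G.tri v (s + 1)) : ℝ) - n v (G.tri v s)) =
        n (v + 2) (G.tri v (s + 1)) - n (v + 2) (G.tri v s) := by exact_mod_cast hc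
      push_cast
      linear_combination (-x (v + 2)) * hc' +
        ((n v (G.tri v (s + 1)) : ℝ) - n v (G.tri v s)) * hsum
  rcases lt_trichotomy s t with h | rfl | h
  · exact ⟨-(n v (G.tri v t) - n v (G.tri v s)), by rw [main s t hs ht h]; push_cast; ring⟩
  · exact ⟨0, by simp⟩
  · exact ⟨_, main t s ht hs h⟩

lemma triangles_nonempty (P : G.Surface) : (G.triangles P).Nonempty := by
  obtain ⟨v, w, hw, rfl⟩ := exists_eq_point P
  rw [triangles_point hw]
  exact (sectors_nonempty G.k_pos hw.1).image _

/-- The function to the circle that on each triangle is the exponential of the affine function with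
the given values at the corners. -/
noncomputable def circleMap (G : TriangleGluing) (n : Fin 3 → ℕ → ℤ) (P : G.Surface) : Circle :=
  Circle.exp (affineValue n P (triangles_nonempty P).some * (2 * Real.pi))

lemma circleMap_eq {n : Fin 3 → ℕ → ℤ} (hn : G.IsCochain n) {P : G.Surface} {T : ℕ}
    (hT : T ∈ G.triangles P) : G.circleMap n P = Circle.exp (affineValue n P T * (2 * Real.pi)) := by
  obtain ⟨m, hm⟩ := exists_int_affineValue_sub hn (triangles_nonempty P).some_mem hT
  rw [circleMap, hm, add_mul, Circle.exp_add, Circle.exp_int_mul_two_pi, mul_one]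

lemma continuous_affineValue (n : Fin 3 → ℕ → ℤ) (T : ℕ) :
    Continuous fun P : G.Surface => affineValue n P T :=
  continuous_finsetSum _ fun j _ => (continuous_barycentric j).mul continuous_const

lemma continuous_circleMap {n : Fin 3 → ℕ → ℤ} (hn : G.IsCochain n) :
    Continuous (G.circleMap n) := by
  refine continuous_of_continuousOn fun v => continuousOn_halfDisk_of_sectors G.k_pos fun s _ => ?_
  have h : ContinuousOn (fun w =>
      Circle.exp (affineValue n (G.point v w) (G.tri v s) * (2 * Real.pi))) (sectorOfDisk G.k s) :=
    (Circle.exp.continuous.comp ((continuous_affineValue n _).mul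
      continuous_const)).comp_continuousOn ((continuousOn_point v).mono fun w hw => hw.1)
  refine h.congr fun w hw => circleMap_eq hn ?_
  rw [triangles_point hw.1]
  exact ⟨s, hw.2, rfl⟩

/-- Two corners of a triangle are joined by a connected part of the triangle. -/
lemma exists_isPreconnected_subset_triangle (v : Fin 3) {s c : ℕ} (hs : s < G.k)
    (hc : c = s ∨ c = s + 1) : ∃ S : Set G.Surface, IsPreconnected S ∧ G.point v 0 ∈ S ∧
      G.point (opposite v c) 0 ∈ S ∧ ∀ P ∈ S, G.tri v s ∈ G.triangles P := by
  have hk := G.k_pos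
  have hck : c ≤ G.k := by omega
  obtain ⟨c', -, -, -, -, htrans⟩ := exists_ray_transition (G := G) v hck
  have hcen : ∀ {s}, s < G.k → (0 : ℂ) ∈ sectorOfDisk G.k s := fun h => ⟨zero_mem_halfDisk, h, Or.inl rfl⟩
  have hhalf : ((1 / 2 : ℝ) : ℂ) ∈ wedge G.k := by
    refine ⟨by norm_num, ?_⟩
    rw [Complex.arg_ofReal_of_nonneg (by norm_num), abs_zero]
    exact div_pos Real.pi_pos (by exact_mod_cast hk)
  have harg : ((1 / 2 : ℝ) : ℂ).arg = 0 := Complex.arg_ofReal_of_nonneg (by norm_num)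
  have hlens : ((1 / 2 : ℝ) : ℂ) ^ G.k ∈ lens := by
    have h0 : (0 : ℝ) < (1 / 2) ^ G.k := by positivity
    have h1 : ((1 / 2 : ℝ)) ^ G.k < 1 := pow_lt_one₀ (by norm_num) (by norm_num) hk.ne'
    rw [← Complex.ofReal_pow]
    refine ⟨?_, ?_⟩
    · rw [Complex.normSq_ofReal]; nlinarith
    · rw [Complex.normSq_ofReal, Complex.ofReal_re]; positivity
  set w := ray G.k c * ((1 / 2 : ℝ) : ℂ) with hwdef
  have hwd : w ∈ halfDisk := ⟨(im_ray_mul_nonneg_iff hk hck hhalf).2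
    ⟨fun _ => harg.ge, fun _ => harg.le⟩, (normSq_ray_mul_lt_one_iff hk c _).2 hlens.1⟩
  have hws : s ∈ sectors G.k w := (mem_sectors_ray_mul hk hck hhalf hwd.1 s).2
    ⟨hs, hc.imp (fun h => ⟨h.symm, harg.ge⟩) fun h => ⟨h.symm, harg.le⟩⟩
  obtain ⟨hw', heq⟩ := htrans _ hhalf hlens hwd
  set w' := ray G.k c' * sideRoot G.k ((1 / 2 : ℝ) : ℂ)
  have hT : G.tri v s ∈ G.triangles (G.point v w) := by
    rw [triangles_point hwd]; exact ⟨s, hws, rfl⟩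
  rw [heq, triangles_point hw'] at hT
  obtain ⟨s', hs', htri⟩ := hT
  refine ⟨G.point v '' sectorOfDisk G.k s ∪ G.point (opposite v c) '' sectorOfDisk G.k s', ?_,
    Or.inl ⟨0, hcen hs, rfl⟩, Or.inr ⟨0, hcen hs'.1, rfl⟩, ?_⟩
  · refine IsPreconnected.union (G.point v w) ⟨w, ⟨hwd, hws⟩, rfl⟩
      (heq ▸ ⟨w', ⟨hw', hs'⟩, rfl⟩) ?_ ?_
    · exact (isPreconnected_sectorOfDisk s).image _ ((continuousOn_point v).mono fun w hw => hw.1)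
    · exact (isPreconnected_sectorOfDisk s').image _ ((continuousOn_point _).mono fun w hw => hw.1)
  · rintro _ (⟨z, hz, rfl⟩ | ⟨z, hz, rfl⟩)
    · rw [triangles_point hz.1]; exact ⟨s, hz.2, rfl⟩
    · rw [triangles_point hz.1, ← htri]; exact ⟨s', hz.2, rfl⟩

/-- A lift grows along a triangle by the increments of the affine function. -/
lemma lift_vertex_sub {n : Fin 3 → ℕ → ℤ} (hn : G.IsCochain n) {h : G.Surface → ℝ}
    (hc : Continuous h) (hu : ∀ P, Circle.exp (h P) = G.circleMap n P) (v : Fin 3) {s c : ℕ}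
    (hs : s < G.k) (hsc : c = s ∨ c = s + 1) :
    h (G.point (opposite v c) 0) - h (G.point v 0) =
      (n (opposite v c) (G.tri v s) - n v (G.tri v s)) * (2 * Real.pi) := by
  obtain ⟨S, hS, hv, ho, hT⟩ := exists_isPreconnected_subset_triangle (G := G) v hs hsc
  set a := fun P : G.Surface => affineValue n P (G.tri v s) * (2 * Real.pi)
  have ha : Continuous a := (continuous_affineValue n _).mul continuous_const
  have key := eqOn_of_lifts (u := G.circleMap n) hS
    (f := fun P => h P + 0) (g := fun P => a P + (h (G.point v 0) - a (G.point v 0)))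
    (hc.add continuous_const).continuousOn (ha.add continuous_const).continuousOn
    (fun P _ => by rw [add_zero]; exact hu P) (fun P hP => by
      have e1 : Circle.exp (a (G.point v 0)) = Circle.exp (h (G.point v 0)) := by
        rw [hu, circleMap_eq hn (hT _ hv)]
      rw [Circle.exp_add, Circle.exp_sub, e1, div_self', mul_one, circleMap_eq hn (hT _ hP)])
    hv (by simp) ho
  simp only [add_zero, a, affineValue_vertex] at key
  rw [key]; ring

/-- A cochain that vanishes at the corner `0` and is not constant at another corner
gives a function without lifts. -/
lemma not_hasLiftOn_circleMap {n : Fin 3 → ℕ → ℤ} (hn : G.IsCochain n) (hn0 : ∀ T, n 0 T = 0)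
    {v : Fin 3} (hv : v ≠ 0) {s t : ℕ} (hs : s < G.k) (ht : t < G.k)
    (hne : n v (G.tri 0 s) ≠ n v (G.tri 0 t)) : ¬ HasLiftOn (G.circleMap n) Set.univ := by
  rintro ⟨h, hc, hu⟩
  rw [continuousOn_univ] at hc
  have key : ∀ s < G.k, h (G.point v 0) - h (G.point 0 0) = n v (G.tri 0 s) * (2 * Real.pi) := by
    intro s hs
    have hex : ∃ c, (c = s ∨ c = s + 1) ∧ opposite 0 c = v := by
      have hv' : ∀ v : Fin 3, v ≠ 0 → v = 0 + 1 ∨ v = 0 + 2 := by decide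
      have h1 : opposite 0 s = v ∨ opposite 0 (s + 1) = v := by
        unfold opposite
        simp only [Nat.even_add_one]
        by_cases he : Even s
        · simpa [he, eq_comm] using hv' v hv
        · simpa [he, eq_comm, or_comm] using hv' v hv
      rcases h1 with h1 | h1
      · exact ⟨s, Or.inl rfl, h1⟩
      · exact ⟨s + 1, Or.inr rfl, h1⟩
    obtain ⟨c, hsc, hcv⟩ := hex
    have := lift_vertex_sub hn hc (fun P => hu P (Set.mem_univ P)) 0 hs hsc
    rw [hcv, hn0] at this
    simpa using this
  have := (key s hs).symm.trans (key t ht)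
  rw [mul_right_cancel_iff_of_pos (by positivity)] at this
  exact hne (by exact_mod_cast this)

/-- A cochain whose function to the circle has no lift makes the height optimal. -/
lemma isOptimal_height {σ : ℝ} (hσ : σ ≠ 0) {n : Fin 3 → ℕ → ℤ} (hn : G.IsCochain n)
    (hlift : ¬ HasLiftOn (G.circleMap n) Set.univ) : IsOptimal (height (G := G) σ) := by
  refine ⟨height_mem_omegaClass hσ, fun g hg => ?_⟩
  by_contra! h
  rw [encard_criticalPoints_height hσ] at h
  exact hlift (hasLiftOn_of_encard_criticalPoints_lt hg h
    ((encard_criticalPoints_height (G := G) hσ).symm.le.trans (Set.encard_le_encard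
      (Set.subset_univ _))) (continuous_circleMap hn))

end TriangleGluing

/-! ### The polygon neighborhood of the saddle -/

/-- The radial map of the unit disk with `(stretch k z) ^ k = 2 z ^ k / (1 + ‖z ^ k‖ ^ 2)`. -/
noncomputable def stretch (k : ℕ) (z : ℂ) : ℂ :=
  (((2 / (1 + Complex.normSq z ^ k)) ^ ((k : ℝ)⁻¹) : ℝ) : ℂ) * z

/-- The inverse of `stretch`. -/
noncomputable def shrink (k : ℕ) (z : ℂ) : ℂ :=
  (((1 / (1 + √(1 - Complex.normSq z ^ k))) ^ ((k : ℝ)⁻¹) : ℝ) : ℂ) * z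

section stretch
variable {k : ℕ}

lemma normSq_pow_lt_one (hk : 0 < k) {z : ℂ} : Complex.normSq z ^ k < 1 ↔ Complex.normSq z < 1 :=
  pow_lt_one_iff_of_nonneg (Complex.normSq_nonneg _) hk.ne'

lemma normSq_mul_pow (hk : 0 < k) {a : ℝ} (ha : 0 ≤ a) (z : ℂ) :
    Complex.normSq (((a ^ ((k : ℝ)⁻¹) : ℝ) : ℂ) * z) ^ k = a ^ 2 * Complex.normSq z ^ k := by
  rw [map_mul, Complex.normSq_ofReal, mul_pow, mul_pow, Real.rpow_inv_natCast_pow ha hk.ne', sq]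

lemma stretch_pow (hk : 0 < k) (z : ℂ) :
    stretch k z ^ k = ((2 / (1 + Complex.normSq (z ^ k)) : ℝ) : ℂ) * z ^ k := by
  have := Complex.normSq_nonneg z
  rw [stretch, mul_pow, ← Complex.ofReal_pow, Real.rpow_inv_natCast_pow (by positivity) hk.ne',
    map_pow]

lemma normSq_stretch_pow (hk : 0 < k) (z : ℂ) : Complex.normSq (stretch k z) ^ k =
    (2 / (1 + Complex.normSq z ^ k)) ^ 2 * Complex.normSq z ^ k := by
  have := Complex.normSq_nonneg z
  rw [stretch, normSq_mul_pow hk (by positivity)]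

lemma normSq_shrink_pow (hk : 0 < k) {z : ℂ} (hz : Complex.normSq z < 1) :
    Complex.normSq (shrink k z) ^ k =
      (1 - √(1 - Complex.normSq z ^ k)) / (1 + √(1 - Complex.normSq z ^ k)) := by
  have h0 := Real.sqrt_nonneg (1 - Complex.normSq z ^ k)
  have h1 := Real.sq_sqrt (sub_nonneg.2 ((normSq_pow_lt_one hk).2 hz).le)
  rw [shrink, normSq_mul_pow hk (by positivity)]
  set S := √(1 - Complex.normSq z ^ k)
  rw [show Complex.normSq z ^ k = 1 - S ^ 2 by linarith]
  field_simp
  ring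

lemma shrink_stretch (hk : 0 < k) {z : ℂ} (hz : Complex.normSq z < 1) :
    shrink k (stretch k z) = z := by
  have hm : Complex.normSq z ^ k < 1 := (normSq_pow_lt_one hk).2 hz
  have hm0 : 0 ≤ Complex.normSq z ^ k := pow_nonneg (Complex.normSq_nonneg z) k
  have hs : √(1 - Complex.normSq (stretch k z) ^ k) =
      (1 - Complex.normSq z ^ k) / (1 + Complex.normSq z ^ k) := by
    rw [normSq_stretch_pow hk, ← Real.sqrt_sq (div_nonneg (sub_nonneg.2 hm.le)
      (by linarith : 0 ≤ 1 + Complex.normSq z ^ k))]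
    congr 1
    field_simp
    ring
  rw [shrink, hs, stretch, ← mul_assoc, ← Complex.ofReal_mul, ← Real.mul_rpow (by
    have : 0 ≤ 1 - Complex.normSq z ^ k := sub_nonneg.2 hm.le
    positivity) (by positivity)]
  rw [show 1 / (1 + (1 - Complex.normSq z ^ k) / (1 + Complex.normSq z ^ k)) *
      (2 / (1 + Complex.normSq z ^ k)) = 1 by field_simp; ring]
  simp

lemma stretch_shrink (hk : 0 < k) {z : ℂ} (hz : Complex.normSq z < 1) :
    stretch k (shrink k z) = z := by
  have h0 := Real.sqrt_nonneg (1 - Complex.normSq z ^ k)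
  rw [stretch, normSq_shrink_pow hk hz, shrink, ← mul_assoc, ← Complex.ofReal_mul]
  set S := √(1 - Complex.normSq z ^ k)
  have e : 2 / (1 + (1 - S) / (1 + S)) = 1 + S := by
    have : 1 + (1 - S) / (1 + S) = 2 / (1 + S) := by field_simp; ring
    rw [this]; field_simp
  rw [e, ← Real.mul_rpow (by positivity) (by positivity), mul_one_div_cancel (by positivity)]
  simp

lemma normSq_stretch_lt_one (hk : 0 < k) {z : ℂ} (hz : Complex.normSq z < 1) :
    Complex.normSq (stretch k z) < 1 := by
  have hm : Complex.normSq z ^ k < 1 := (normSq_pow_lt_one hk).2 hz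
  have hm0 : 0 ≤ Complex.normSq z ^ k := pow_nonneg (Complex.normSq_nonneg z) k
  rw [← normSq_pow_lt_one hk, normSq_stretch_pow hk, div_pow, div_mul_eq_mul_div,
    div_lt_one (by positivity)]
  nlinarith [sq_pos_of_pos (sub_pos.2 hm)]

lemma normSq_shrink_lt_one (hk : 0 < k) {z : ℂ} (hz : Complex.normSq z < 1) :
    Complex.normSq (shrink k z) < 1 := by
  have h0 : 0 < √(1 - Complex.normSq z ^ k) :=
    Real.sqrt_pos.2 (sub_pos.2 ((normSq_pow_lt_one hk).2 hz))
  rw [← normSq_pow_lt_one hk, normSq_shrink_pow hk hz, div_lt_one (by linarith)]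
  linarith

lemma continuous_stretch : Continuous (stretch k) := by
  have h : ∀ z : ℂ, 0 < 1 + Complex.normSq z ^ k := fun z => by
    have := pow_nonneg (Complex.normSq_nonneg z) k; linarith
  refine (Complex.continuous_ofReal.comp (Continuous.rpow_const ?_ fun z => Or.inr (by positivity))).mul
    continuous_id
  exact continuous_const.div (continuous_const.add (Complex.continuous_normSq.pow k)) fun z => (h z).ne'

lemma continuous_shrink : Continuous (shrink k) := by
  have h : ∀ z : ℂ, 0 < 1 + √(1 - Complex.normSq z ^ k) := fun z => by positivity
  refine (Complex.continuous_ofReal.comp (Continuous.rpow_const ?_ fun z => Or.inr (by positivity))).mul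
    continuous_id
  exact continuous_const.div (continuous_const.add
    (continuous_const.sub (Complex.continuous_normSq.pow k)).sqrt) fun z => (h z).ne'

lemma stretch_im_nonneg {z : ℂ} (hz : 0 ≤ z.im) : 0 ≤ (stretch k z).im := by
  have := Complex.normSq_nonneg z
  rw [stretch, Complex.im_ofReal_mul]; positivity

lemma shrink_im_nonneg {z : ℂ} (hz : 0 ≤ z.im) : 0 ≤ (shrink k z).im := by
  rw [shrink, Complex.im_ofReal_mul]; positivity

end stretch

/-- The map `stretch` as a homeomorphism of the open half-disk. -/
noncomputable def stretchHomeomorph {k : ℕ} (hk : 0 < k) :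
    OpenPartialHomeomorph (EuclideanHalfSpace 2) (EuclideanHalfSpace 2) where
  toFun u := ofHalfPlane (stretch k (halfPlaneCoord u))
  invFun u := ofHalfPlane (shrink k (halfPlaneCoord u))
  source := {u | halfPlaneCoord u ∈ halfDisk}
  target := {u | halfPlaneCoord u ∈ halfDisk}
  map_source' u hu := by
    have := stretch_im_nonneg (k := k) (halfPlaneCoord_im_nonneg u)
    rw [Set.mem_ofPred_eq, halfPlaneCoord_ofHalfPlane this]
    exact ⟨this, normSq_stretch_lt_one hk hu.2⟩
  map_target' u hu := by
    have := shrink_im_nonneg (k := k) (halfPlaneCoord_im_nonneg u)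
    rw [Set.mem_ofPred_eq, halfPlaneCoord_ofHalfPlane this]
    exact ⟨this, normSq_shrink_lt_one hk hu.2⟩
  left_inv' u hu := by
    rw [halfPlaneCoord_ofHalfPlane (stretch_im_nonneg (halfPlaneCoord_im_nonneg u)),
      shrink_stretch hk hu.2, ofHalfPlane_halfPlaneCoord]
  right_inv' u hu := by
    rw [halfPlaneCoord_ofHalfPlane (shrink_im_nonneg (halfPlaneCoord_im_nonneg u)),
      stretch_shrink hk hu.2, ofHalfPlane_halfPlaneCoord]
  open_source := TriangleGluing.isOpen_halfPlaneCoord_mem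
  open_target := TriangleGluing.isOpen_halfPlaneCoord_mem
  continuousOn_toFun := (continuous_ofHalfPlane.comp
    (continuous_stretch.comp continuous_halfPlaneCoord)).continuousOn
  continuousOn_invFun := (continuous_ofHalfPlane.comp
    (continuous_shrink.comp continuous_halfPlaneCoord)).continuousOn

lemma rayAngle_mem {k j : ℕ} (hj : j ≠ 0) (hjk : j ≤ k) : 0 < rayAngle k j ∧ rayAngle k j < Real.pi := by
  have hj1 : (1 : ℝ) ≤ j := by exact_mod_cast Nat.one_le_iff_ne_zero.2 hj
  have hjk' : (j : ℝ) ≤ k := by exact_mod_cast hjk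
  have hpi := Real.pi_pos
  rw [rayAngle]
  refine ⟨by apply div_pos <;> nlinarith, ?_⟩
  rw [div_lt_iff₀ (by linarith)]
  nlinarith

lemma mul_rayAngle {k : ℕ} (hk : 0 < k) (j : ℕ) : k * rayAngle k j = j * Real.pi - Real.pi / 2 := by
  have : (k : ℝ) ≠ 0 := by exact_mod_cast hk.ne'
  rw [rayAngle]; field_simp

/-- The point of the half-circle of radius `1 / 2` on the `j`-th ray of the zero level. -/
noncomputable def levelPoint (k j : ℕ) : ℂ :=
  ((1 / 2 : ℝ) : ℂ) * Complex.exp (rayAngle k j * Complex.I)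

lemma levelPoint_im_nonneg {k j : ℕ} (hj : j ≠ 0) (hjk : j ≤ k) : 0 ≤ (levelPoint k j).im := by
  obtain ⟨h1, h2⟩ := rayAngle_mem hj hjk
  rw [levelPoint, Complex.im_ofReal_mul, Complex.exp_ofReal_mul_I_im]
  exact mul_nonneg (by norm_num) (Real.sin_nonneg_of_nonneg_of_le_pi h1.le h2.le)

lemma levelPoint_mem_halfDisk {k j : ℕ} (hj : j ≠ 0) (hjk : j ≤ k) : levelPoint k j ∈ halfDisk := by
  refine ⟨levelPoint_im_nonneg hj hjk, ?_⟩
  rw [levelPoint, Complex.normSq_eq_norm_sq, norm_mul, Complex.norm_exp_ofReal_mul_I,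
    Complex.norm_real]
  norm_num

lemma shrink_mem_halfDisk {k : ℕ} (hk : 0 < k) {z : ℂ} (hz : z ∈ halfDisk) : shrink k z ∈ halfDisk :=
  ⟨shrink_im_nonneg hz.1, normSq_shrink_lt_one hk hz.2⟩

namespace TriangleGluing
variable {G : TriangleGluing}

/-- The chart at the saddle in which the height is `± Re z ^ k`. -/
noncomputable def polygonChart (G : TriangleGluing) :
    OpenPartialHomeomorph G.Surface (EuclideanHalfSpace 2) :=
  (G.chart 0).trans (stretchHomeomorph G.k_pos)

lemma mem_polygonChart_source {P : G.Surface} :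
    P ∈ G.polygonChart.source ↔ 1 / 4 < G.weight P 0 := by
  rw [polygonChart, OpenPartialHomeomorph.trans_source]
  refine ⟨fun h => h.1, fun h => ⟨h, ?_⟩⟩
  show halfPlaneCoord (G.chart 0 P) ∈ halfDisk
  rw [halfPlaneCoord_chart h]
  exact coord_mem h

lemma mem_polygonChart_target {u : EuclideanHalfSpace 2} :
    u ∈ G.polygonChart.target ↔ halfPlaneCoord u ∈ halfDisk := by
  rw [polygonChart, OpenPartialHomeomorph.trans_target]
  refine ⟨fun h => h.1, fun h => ⟨h, ?_⟩⟩
  exact (stretchHomeomorph G.k_pos).map_target h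

lemma halfPlaneCoord_polygonChart {P : G.Surface} (h : 1 / 4 < G.weight P 0) :
    halfPlaneCoord (G.polygonChart P) = stretch G.k (coord 0 P) := by
  show halfPlaneCoord (ofHalfPlane (stretch G.k (halfPlaneCoord (G.chart 0 P)))) = _
  rw [halfPlaneCoord_chart h, halfPlaneCoord_ofHalfPlane (stretch_im_nonneg (coord_mem h).1)]

lemma halfPlaneCoord_polygonChart_point {w : ℂ} (hw : w ∈ halfDisk) :
    halfPlaneCoord (G.polygonChart (G.point 0 w)) = stretch G.k w := by
  rw [halfPlaneCoord_polygonChart (quarter_lt_weight_point_self hw), coord_point hw]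

lemma height_eq_re_stretch (σ : ℝ) {w : ℂ} (hw : w ∈ halfDisk) :
    height σ (G.point 0 w) = σ * (stretch G.k w ^ G.k).re := by
  rw [height_point σ hw, sphereHeight_zero, stretch_pow G.k_pos, Complex.re_ofReal_mul]
  ring

/-- The polygon neighborhood of the saddle. -/
noncomputable def polygonNeighborhood (G : TriangleGluing) {σ : ℝ} (hσ : σ = 1 ∨ σ = -1) :
    PolygonNeighborhood (height (G := G) σ) (G.point 0 0) G.k where
  chart := G.polygonChart
  mem_source := mem_polygonChart_source.2 (quarter_lt_weight_point_self zero_mem_halfDisk)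
  coord_center := by
    rw [halfPlaneCoord_polygonChart_point zero_mem_halfDisk, stretch, mul_zero]
  sign := σ
  sign_eq := hσ
  eq_re P hP := by
    rw [mem_polygonChart_source] at hP
    rw [(height_vertex σ).1, zero_add, halfPlaneCoord_polygonChart hP,
      ← height_eq_re_stretch σ (coord_mem hP), point_coord hP]
  radius := 1 / 2
  radius_pos := by norm_num
  halfDisk_subset u hu := by
    rw [mem_polygonChart_target, halfPlaneCoord_mem_halfDisk, Complex.normSq_eq_norm_sq]
    nlinarith [norm_nonneg (halfPlaneCoord u)]
  matched j := if j = 0 then G.point 0 0 else G.point 0 (shrink G.k (levelPoint G.k j))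
  matched_zero := if_pos rfl
  matched_mem j := by
    rw [mem_polygonChart_source]
    split_ifs with hj
    · exact quarter_lt_weight_point_self zero_mem_halfDisk
    · exact quarter_lt_weight_point_self (shrink_mem_halfDisk G.k_pos (levelPoint_mem_halfDisk
        (fun h => hj (Fin.ext h)) (Nat.lt_succ_iff.1 j.2)))
  coord_matched j hj := by
    have h := levelPoint_mem_halfDisk (k := G.k) (j := j) (fun h => hj (Fin.ext h))
      (Nat.lt_succ_iff.1 j.2)
    rw [if_neg hj, halfPlaneCoord_polygonChart_point (shrink_mem_halfDisk G.k_pos h),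
      stretch_shrink G.k_pos h.2, levelPoint]

lemma polygonNeighborhood_matched {σ : ℝ} (hσ : σ = 1 ∨ σ = -1) {j : Fin (G.k + 1)} (hj : j ≠ 0) :
    (G.polygonNeighborhood hσ).matched j = G.point 0 (shrink G.k (levelPoint G.k j)) :=
  if_neg hj

/-- On the arc number `j` of the half-circle the sign of the height is `(-1) ^ j`. -/
lemma height_arc_pos {σ : ℝ} {j : ℕ} {P : G.Surface} (hP : 1 / 4 < G.weight P 0)
    (hr : ‖halfPlaneCoord (G.polygonChart P)‖ = 1 / 2)
    (h1 : rayAngle G.k j < (halfPlaneCoord (G.polygonChart P)).arg)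
    (h2 : (halfPlaneCoord (G.polygonChart P)).arg < rayAngle G.k (j + 1)) :
    ∃ a > 0, height σ P = σ * (-1) ^ j * a := by
  have hk : (0 : ℝ) < G.k := by exact_mod_cast G.k_pos
  have he : height σ P = σ * (halfPlaneCoord (G.polygonChart P) ^ G.k).re := by
    rw [halfPlaneCoord_polygonChart hP, ← height_eq_re_stretch σ (coord_mem hP), point_coord hP]
  rw [he, pow_eq_polar, hr, Complex.re_ofReal_mul, Complex.exp_ofReal_mul_I_re]
  set θ := (halfPlaneCoord (G.polygonChart P)).arg
  refine ⟨(1 / 2) ^ G.k * Real.cos (G.k * θ - j * Real.pi), ?_, ?_⟩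
  · refine mul_pos (by positivity) (Real.cos_pos_of_mem_Ioo ⟨?_, ?_⟩)
    · have := mul_lt_mul_of_pos_left h1 hk
      rw [mul_rayAngle G.k_pos] at this; linarith
    · have := mul_lt_mul_of_pos_left h2 hk
      rw [mul_rayAngle G.k_pos] at this; push_cast at this; linarith
  · rw [Real.cos_sub_nat_mul_pi]
    have : ((-1 : ℝ) ^ j) * (-1) ^ j = 1 := by rw [← mul_pow]; simp
    linear_combination (-σ * (1 / 2) ^ G.k * Real.cos (G.k * θ)) * this

/-- The vertex `0` is a saddle. -/
lemma isSaddle_height {σ : ℝ} (hσ : σ ≠ 0) : IsSaddle (height (G := G) σ) (G.point 0 0) := by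
  have hk := G.k_pos
  have hsign : ∀ c ≤ 1, ∃ᶠ P in 𝓝 (G.point 0 0), ∃ a > 0, height σ P = σ * (-1) ^ c * a := by
    intro c hc
    have hck : c ≤ G.k := hc.trans (by omega)
    have hmem : ∀ᶠ t : ℝ in 𝓝[>] 0, ray G.k c * (t : ℂ) ∈ halfDisk ∧ 0 < t := by
      filter_upwards [Ioo_mem_nhdsGT (show (0 : ℝ) < 1 by norm_num)] with t ht
      have hw : (t : ℂ) ∈ wedge G.k := by
        refine ⟨by exact_mod_cast ht.1.ne', ?_⟩
        rw [Complex.arg_ofReal_of_nonneg ht.1.le, abs_zero]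
        exact div_pos Real.pi_pos (by exact_mod_cast hk)
      have harg : (t : ℂ).arg = 0 := Complex.arg_ofReal_of_nonneg ht.1.le
      refine ⟨⟨(im_ray_mul_nonneg_iff hk hck hw).2 ⟨fun _ => harg.ge, fun _ => harg.le⟩, ?_⟩, ht.1⟩
      rw [map_mul, Complex.normSq_eq_norm_sq, norm_ray, Complex.normSq_ofReal]
      nlinarith [ht.1, ht.2]
    have hlim : Filter.Tendsto (fun t : ℝ => G.point 0 (ray G.k c * (t : ℂ))) (𝓝[>] 0)
        (𝓝 (G.point 0 0)) := by
      have h1 := continuousOn_point (G := G) 0 0 zero_mem_halfDisk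
      refine h1.tendsto.comp (tendsto_nhdsWithin_iff.2 ⟨?_, hmem.mono fun t h => h.1⟩)
      have h2 : Continuous fun t : ℝ => ray G.k c * (t : ℂ) := by fun_prop
      have h3 := h2.tendsto 0
      simp only [Complex.ofReal_zero, mul_zero] at h3
      exact h3.mono_left nhdsWithin_le_nhds
    refine hlim.frequently (Filter.Eventually.frequently ?_)
    filter_upwards [hmem] with t ht
    refine ⟨2 * t ^ G.k / (1 + Complex.normSq ((ray G.k c * (t : ℂ)) ^ G.k)), ?_, ?_⟩
    · have := Complex.normSq_nonneg ((ray G.k c * (t : ℂ)) ^ G.k)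
      have := pow_pos ht.2 G.k
      positivity
    · rw [height_point σ ht.1, sphereHeight_zero]
      have : ((ray G.k c * (t : ℂ)) ^ G.k).re = (-1) ^ c * t ^ G.k := by
        rw [mul_pow, ray_pow hk, show ((-1 : ℂ) ^ c * (t : ℂ) ^ G.k) =
          (((-1) ^ c * t ^ G.k : ℝ) : ℂ) by push_cast; ring, Complex.ofReal_re]
      rw [this]; ring
  have h0 := (height_vertex (G := G) σ).1
  have hboth : ∀ ε : ℝ, ε ≠ 0 → ∃ᶠ P in 𝓝 (G.point 0 0), height σ P * ε < 0 := by
    intro ε hε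
    have hprod : σ * ε ≠ 0 := mul_ne_zero hσ hε
    rcases lt_or_gt_of_ne hprod with h | h
    · refine (hsign 0 (by norm_num)).mono ?_
      rintro P ⟨a, ha, he⟩
      rw [he, pow_zero]; nlinarith
    · refine (hsign 1 le_rfl).mono ?_
      rintro P ⟨a, ha, he⟩
      rw [he, pow_one]; nlinarith
  refine ⟨by rw [criticalPoints_height hσ]; exact ⟨0, rfl⟩, fun hmin => ?_, fun hmax => ?_⟩
  · obtain ⟨P, h1, h2⟩ := ((hboth 1 one_ne_zero).and_eventually hmin).exists
    rw [h0] at h2; linarith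
  · obtain ⟨P, h1, h2⟩ := ((hboth (-1) (by norm_num)).and_eventually hmax).exists
    rw [h0] at h2; linarith

end TriangleGluing

/-! ### The zero level -/

/-- The circle through `-1` and `1 / 3` without the point `-1`. In the coordinate `b` in which the
vertices `1`, `2`, `0` are `0`, `1`, `-1` it is the zero level of the height without the saddle. -/
def levelCircle : Set ℂ := {b | 1 - 3 * Complex.normSq b - 2 * b.re = 0 ∧ Complex.normSq b < 1}

lemma levelCircle_subset_lens : levelCircle ⊆ lens := by
  rintro b ⟨h1, h2⟩
  refine ⟨h2, ?_⟩
  rw [Complex.normSq_apply] at *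
  have : -1 < b.re := by nlinarith [mul_self_nonneg b.im]
  linarith

lemma isPathConnected_levelCircle : IsPathConnected levelCircle := by
  have himage : levelCircle =
      (fun t : ℝ => (-1 / 3 + 2 / 3 * Complex.exp (t * Complex.I) : ℂ)) ''
        Set.Ioo (-Real.pi) Real.pi := by
    ext b
    constructor
    · rintro ⟨h1, h2⟩
      have hb : Complex.normSq (b + 1 / 3) = (2 / 3) ^ 2 := by
        rw [Complex.normSq_apply] at *
        simp
        linarith
      have hn : ‖b + 1 / 3‖ = 2 / 3 := by
        rw [Complex.normSq_eq_norm_sq] at hb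
        exact (pow_left_inj₀ (norm_nonneg _) (by norm_num) two_ne_zero).1 hb
      have he := Complex.norm_mul_exp_arg_mul_I (b + 1 / 3)
      rw [hn] at he
      push_cast at he
      have he' : -1 / 3 + 2 / 3 * Complex.exp ((b + 1 / 3).arg * Complex.I) = b := by
        rw [he]; ring
      refine ⟨(b + 1 / 3).arg, ⟨Complex.neg_pi_lt_arg _, lt_of_le_of_ne (Complex.arg_le_pi _)
        fun hpi => ?_⟩, he'⟩
      rw [hpi, Complex.exp_pi_mul_I] at he'
      rw [← he'] at h2
      norm_num at h2
    · rintro ⟨t, ht, rfl⟩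
      have hre : (-1 / 3 + 2 / 3 * Complex.exp (t * Complex.I) : ℂ).re =
          -1 / 3 + 2 / 3 * Real.cos t := by
        rw [show (-1 / 3 + 2 / 3 * Complex.exp (t * Complex.I) : ℂ) = ((-1 / 3 : ℝ) : ℂ) +
          ((2 / 3 : ℝ) : ℂ) * Complex.exp (t * Complex.I) by push_cast; ring, Complex.add_re,
          Complex.ofReal_re, Complex.re_ofReal_mul, Complex.exp_ofReal_mul_I_re]
      have him : (-1 / 3 + 2 / 3 * Complex.exp (t * Complex.I) : ℂ).im = 2 / 3 * Real.sin t := by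
        rw [show (-1 / 3 + 2 / 3 * Complex.exp (t * Complex.I) : ℂ) = ((-1 / 3 : ℝ) : ℂ) +
          ((2 / 3 : ℝ) : ℂ) * Complex.exp (t * Complex.I) by push_cast; ring, Complex.add_im,
          Complex.ofReal_im, Complex.im_ofReal_mul, Complex.exp_ofReal_mul_I_im, zero_add]
      have hsc := Real.sin_sq_add_cos_sq t
      have hcos : -1 < Real.cos t := by
        have h1 : |t| < Real.pi := abs_lt.2 ht
        rw [← Real.cos_abs, ← Real.cos_pi]
        exact Real.cos_lt_cos_of_nonneg_of_le_pi (abs_nonneg t) le_rfl h1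
      refine ⟨?_, ?_⟩
      · rw [Complex.normSq_apply, hre, him]; linear_combination (-4 / 3) * hsc
      · rw [Complex.normSq_apply, hre, him]; nlinarith
  rw [himage]
  exact ((convex_Ioo _ _).isPathConnected ⟨0, by simp [Real.pi_pos]⟩).image (by fun_prop)

lemma even_ray_injective {k : ℕ} (hk : Odd k) {c c' : ℕ} (hc : c ≤ k) (hc' : c' ≤ k) (he : Even c)
    (he' : Even c') {ξ ξ' : ℂ} (hξ : ξ ∈ wedge k) (hξ' : ξ' ∈ wedge k)
    (h : ray k c * ξ = ray k c' * ξ') : c = c' := by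
  have hk0 : 0 < k := hk.pos
  have hk' : (0 : ℝ) < k := by exact_mod_cast hk0
  have hne : ∀ c, Even c → c ≠ k := fun c h1 h2 => Nat.not_even_iff_odd.2 hk (h2 ▸ h1)
  have h1 := arg_ray_mul_of_mem_wedge hk0 hc hξ fun h => absurd h (hne c he)
  have h2 := arg_ray_mul_of_mem_wedge hk0 hc' hξ' fun h => absurd h (hne c' he')
  rw [h, h2] at h1
  have h3 := abs_lt.1 hξ.2
  have h4 := abs_lt.1 hξ'.2
  have hpi : 0 < Real.pi / k := div_pos Real.pi_pos hk'
  rw [mul_div_assoc, mul_div_assoc] at h1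
  have h5 : (c' : ℝ) < c + 2 := by
    have : (c' : ℝ) * (Real.pi / k) < (c + 2) * (Real.pi / k) := by linarith
    exact lt_of_mul_lt_mul_right this hpi.le
  have h6 : (c : ℝ) < c' + 2 := by
    have : (c : ℝ) * (Real.pi / k) < (c' + 2) * (Real.pi / k) := by linarith
    exact lt_of_mul_lt_mul_right this hpi.le
  have h7 : c' < c + 2 := by exact_mod_cast h5
  have h8 : c < c' + 2 := by exact_mod_cast h6
  obtain ⟨m, rfl⟩ := he
  obtain ⟨m', rfl⟩ := he'
  omega

namespace TriangleGluing
variable {G : TriangleGluing}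

/-- The zero level of the height without the saddle. -/
def levelSet (G : TriangleGluing) (σ : ℝ) : Set G.Surface :=
  height σ ⁻¹' {height σ (G.point 0 0)} \ {G.point 0 0}

lemma pow_ray_mul_even {c : ℕ} (he : Even c) (ξ : ℂ) : (ray G.k c * ξ) ^ G.k = ξ ^ G.k := by
  rw [mul_pow, ray_pow G.k_pos, he.neg_one_pow, one_mul]

lemma height_eq_zero_iff {σ : ℝ} (hσ : σ ≠ 0) {P : G.Surface} :
    height σ P = 0 ↔ G.weight P 1 = G.weight P 2 := by
  have hpos : 1 + 2 * G.weight P 0 ≠ 0 := by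
    obtain ⟨v, w, hw, rfl⟩ := exists_eq_point P
    rw [weight_point hw]
    have := weights_nonneg v (w ^ G.k) 0
    positivity
  rw [height, mul_eq_zero, or_iff_right hσ, div_eq_zero_iff, or_iff_left hpos, mul_eq_zero,
    or_iff_right two_ne_zero, sub_eq_zero]

lemma height_point_one_eq_zero_iff {σ : ℝ} (hσ : σ ≠ 0) {w : ℂ} (hw : w ∈ halfDisk) :
    height σ (G.point 1 w) = 0 ↔ w ^ G.k ∈ levelCircle := by
  have hq : Complex.normSq (w ^ G.k) < 1 := by
    rw [map_pow]; exact (normSq_pow_lt_one G.k_pos).2 hw.2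
  have hden : 1 + 5 * Complex.normSq (w ^ G.k) - 2 * (w ^ G.k).re ≠ 0 := by
    rw [Complex.normSq_apply]
    nlinarith [sq_nonneg ((w ^ G.k).re * 5 - 1), mul_self_nonneg (w ^ G.k).im]
  rw [height_point σ hw, sphereHeight_one, mul_eq_zero, or_iff_right hσ, div_eq_zero_iff,
    or_iff_left hden]
  exact ⟨fun h => ⟨h, hq⟩, fun h => h.1⟩

/-- The zero level without the saddle lies along the even rays of the vertex `1`. -/
lemma mem_levelSet_iff {σ : ℝ} (hσ : σ ≠ 0) {P : G.Surface} :
    P ∈ G.levelSet σ ↔ ∃ c ≤ G.k, Even c ∧ ∃ ξ ∈ wedge G.k, ξ ^ G.k ∈ levelCircle ∧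
      ray G.k c * ξ ∈ halfDisk ∧ P = G.point 1 (ray G.k c * ξ) := by
  rw [levelSet, (height_vertex σ).1]
  constructor
  · rintro ⟨h0, hne⟩
    have h0 : height σ P = 0 := h0
    have h12 := (height_eq_zero_iff hσ).1 h0
    have hP1 : 1 / 4 < G.weight P 1 := by
      by_contra! hle
      have hs := sum_weight P
      have hP0 : 1 / 4 < G.weight P 0 := by linarith
      obtain ⟨w, hw, rfl⟩ := exists_point_eq hP0
      rw [weight_point hw] at hle hs h12
      have e := weights_self 0 (w ^ G.k)
      have hp := one_add_three_normSq_pos (w ^ G.k)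
      have h1 : 1 ≤ 1 / (1 + 3 * Complex.normSq (w ^ G.k)) := by rw [← e]; linarith
      rw [le_div_iff₀ hp] at h1
      have h3 : w ^ G.k = 0 := Complex.normSq_eq_zero.1
        (le_antisymm (by linarith) (Complex.normSq_nonneg _))
      exact hne (by rw [(pow_eq_zero_iff G.k_pos.ne').1 h3]; rfl)
    obtain ⟨w, hw, rfl⟩ := exists_point_eq hP1
    have hb := (height_point_one_eq_zero_iff hσ hw).1 h0
    have hsl := lens_subset_slitPlane (levelCircle_subset_lens hb)
    have hw0 : w ≠ 0 := fun h => by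
      rw [h, zero_pow G.k_pos.ne'] at hsl
      exact Complex.slitPlane_ne_zero hsl rfl
    obtain ⟨c, hc, hpar, ξ, hξ, rfl⟩ := exists_eq_ray_mul (k := G.k) (p := 0)
      (by have := G.three_le_k; omega) hw0 hw.1 (by simpa using hsl)
    have he : Even c := hpar.2 (by simp)
    rw [pow_ray_mul_even he] at hb
    exact ⟨c, hc, he, ξ, hξ, hb, hw, rfl⟩
  · rintro ⟨c, hc, he, ξ, hξ, hb, hw, rfl⟩
    refine ⟨(height_point_one_eq_zero_iff hσ hw).2 (by rwa [pow_ray_mul_even he]), fun h => ?_⟩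
    have h1 := quarter_lt_weight_point_self (G := G) (v := 1) hw
    rw [show G.point 1 (ray G.k c * ξ) = G.point 0 0 from h] at h1
    exact absurd (eq_of_quarter_lt_weight_vertex h1) (by decide)

/-- The part of the half-disk at the vertex `1` along the ray `c`. -/
def rayNeighborhood (G : TriangleGluing) (c : ℕ) : Set G.Surface :=
  {P | 1 / 4 < G.weight P 1 ∧ coord 1 P ∈
    {z | (ray G.k c)⁻¹ * z ∈ wedge G.k ∧ ((ray G.k c)⁻¹ * z) ^ G.k ∈ lens}}

lemma point_mem_rayNeighborhood_iff {c : ℕ} {w : ℂ} (hw : w ∈ halfDisk) :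
    G.point 1 w ∈ G.rayNeighborhood c ↔
      ∃ ξ ∈ wedge G.k, ξ ^ G.k ∈ lens ∧ w = ray G.k c * ξ := by
  rw [rayNeighborhood, Set.mem_ofPred_eq, coord_point hw,
    and_iff_right (quarter_lt_weight_point_self hw)]
  constructor
  · rintro ⟨h1, h2⟩
    exact ⟨_, h1, h2, by rw [mul_inv_cancel_left₀ (ray_ne_zero c)]⟩
  · rintro ⟨ξ, h1, h2, rfl⟩
    rw [Set.mem_ofPred_eq, inv_mul_cancel_left₀ (ray_ne_zero c)]
    exact ⟨h1, h2⟩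

/-- Points of the zero level that are joined within it without passing through the saddle lie
along the same ray. -/
lemma eq_of_joinedIn_levelSet {σ : ℝ} (hσ : σ ≠ 0) {c c' : ℕ} (hc : c ≤ G.k) (hc' : c' ≤ G.k)
    (he : Even c) (he' : Even c') {P Q : G.Surface} (hP : P ∈ G.rayNeighborhood c)
    (hQ : Q ∈ G.rayNeighborhood c') (h : JoinedIn (G.levelSet σ) P Q) : c = c' := by
  by_contra hne
  have hdisj : ∀ R, ∀ a ≤ G.k, Even a → ∀ b ≤ G.k, Even b → R ∈ G.rayNeighborhood a →
      R ∈ G.rayNeighborhood b → a = b := by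
    intro R a ha hae b hb hbe h1 h2
    refine even_ray_injective G.odd_k ha hb hae hbe h1.2.1 h2.2.1 ?_
    rw [mul_inv_cancel_left₀ (ray_ne_zero a), mul_inv_cancel_left₀ (ray_ne_zero b)]
  obtain ⟨γ, hγ⟩ := h
  have hopen : ∀ c, IsOpen (G.rayNeighborhood c) := fun c =>
    isOpen_coord_preimage 1 (isOpen_ray_wedge G.k_pos c)
  set B : Set G.Surface := ⋃ a ∈ {a | a ≤ G.k ∧ Even a ∧ a ≠ c}, G.rayNeighborhood a with hB
  have hBo : IsOpen B := isOpen_biUnion fun a _ => hopen a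
  have hcov : Set.range γ ⊆ G.rayNeighborhood c ∪ B := by
    rintro _ ⟨t, rfl⟩
    obtain ⟨a, ha, hae, ξ, hξ, hb, hw, heq⟩ := (mem_levelSet_iff hσ).1 (hγ t)
    have hmem : γ t ∈ G.rayNeighborhood a := by
      rw [heq, point_mem_rayNeighborhood_iff hw]
      exact ⟨ξ, hξ, levelCircle_subset_lens hb, rfl⟩
    by_cases hac : a = c
    · exact Or.inl (hac ▸ hmem)
    · exact Or.inr (Set.mem_biUnion (show a ∈ {a | a ≤ G.k ∧ Even a ∧ a ≠ c} from ⟨ha, hae, hac⟩) hmem)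
  have hd : Disjoint (G.rayNeighborhood c) B := by
    rw [Set.disjoint_left]
    intro R h1 h2
    obtain ⟨a, ha, h3⟩ := Set.mem_iUnion₂.1 h2
    exact ha.2.2 (hdisj R a ha.1 ha.2.1 c hc he h3 h1)
  have hsub := (isPreconnected_range γ.continuous).subset_left_of_subset_union (hopen c) hBo hd hcov
    ⟨P, ⟨0, γ.source⟩, hP⟩
  exact hne (hdisj Q c hc he c' hc' he' (hsub ⟨1, γ.target⟩) hQ)

/-- An inner even ray is surrounded by an arc of the zero level. -/
lemma joinedIn_levelSet {σ : ℝ} (hσ : σ ≠ 0) {c : ℕ} (hc0 : 0 < c) (hc : c < G.k) (he : Even c)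
    {ξ ξ' : ℂ} (hξ : ξ ∈ wedge G.k) (hξ' : ξ' ∈ wedge G.k) (hb : ξ ^ G.k ∈ levelCircle)
    (hb' : ξ' ^ G.k ∈ levelCircle) :
    JoinedIn (G.levelSet σ) (G.point 1 (ray G.k c * ξ)) (G.point 1 (ray G.k c * ξ')) := by
  have hk := G.k_pos
  set φ : ℂ → ℂ := fun b => ray G.k c * b ^ ((G.k : ℂ)⁻¹) with hφ
  have hφd : ∀ b ∈ levelCircle, φ b ∈ halfDisk := fun b hb =>
    ⟨(im_ray_mul_nonneg_iff hk hc.le (root_mem_wedge hk (lens_subset_slitPlane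
      (levelCircle_subset_lens hb)))).2 ⟨fun h => by omega, fun h => by omega⟩,
      (normSq_ray_mul_lt_one_iff hk c _).2 (by rw [root_pow hk]; exact hb.2)⟩
  have hφc : ContinuousOn φ levelCircle := fun b hb =>
    (continuousAt_const.mul (continuousAt_id.cpow continuousAt_const (lens_subset_slitPlane
      (levelCircle_subset_lens hb)))).continuousWithinAt
  have hpc : IsPathConnected ((fun b => G.point 1 (φ b)) '' levelCircle) :=
    isPathConnected_levelCircle.image' ((continuousOn_point 1).comp hφc hφd)
  have hsub : (fun b => G.point 1 (φ b)) '' levelCircle ⊆ G.levelSet σ := by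
    rintro _ ⟨b, hb, rfl⟩
    exact (mem_levelSet_iff hσ).2 ⟨c, hc.le, he, _, root_mem_wedge hk (lens_subset_slitPlane
      (levelCircle_subset_lens hb)), by rwa [root_pow hk], hφd b hb, rfl⟩
  have hmem : ∀ ξ ∈ wedge G.k, ξ ^ G.k ∈ levelCircle →
      G.point 1 (ray G.k c * ξ) ∈ (fun b => G.point 1 (φ b)) '' levelCircle := fun ξ hξ hb =>
    ⟨_, hb, by simp only [hφ, pow_cpow_of_mem_wedge hk hξ]⟩
  exact (hpc.joinedIn _ (hmem ξ hξ hb) _ (hmem ξ' hξ' hb')).mono hsub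

/-- A matched point lies on the zero level in the interior of one triangle. -/
lemma matched_mem_levelSet (σ : ℝ) {j : ℕ} (hj : j ≠ 0) (hjk : j ≤ G.k) :
    G.point 0 (shrink G.k (levelPoint G.k j)) ∈ G.levelSet σ ∧
      G.triangles (G.point 0 (shrink G.k (levelPoint G.k j))) = {G.tri 0 (j - 1)} := by
  have hk := G.k_pos
  have hk' : (0 : ℝ) < G.k := by exact_mod_cast hk
  obtain ⟨h1, h2⟩ := rayAngle_mem hj hjk
  have hw := shrink_mem_halfDisk hk (levelPoint_mem_halfDisk hj hjk)
  have hne : levelPoint G.k j ≠ 0 := mul_ne_zero (by norm_num) (Complex.exp_ne_zero _)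
  have harg0 : (levelPoint G.k j).arg = rayAngle G.k j := by
    rw [levelPoint, Complex.arg_real_mul _ (by norm_num), Complex.arg_exp_mul_I,
      toIocMod_eq_self]
    exact ⟨by linarith, by linarith⟩
  obtain ⟨a, ha, hsh⟩ : ∃ a : ℝ, 0 < a ∧ shrink G.k (levelPoint G.k j) = a * levelPoint G.k j :=
    ⟨_, by positivity, rfl⟩
  have hwne : shrink G.k (levelPoint G.k j) ≠ 0 := by
    rw [hsh]; exact mul_ne_zero (by exact_mod_cast ha.ne') hne
  have harg : (shrink G.k (levelPoint G.k j)).arg = rayAngle G.k j := by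
    rw [hsh, Complex.arg_real_mul _ ha, harg0]
  have hj1 : ((j - 1 : ℕ) : ℝ) = j - 1 := by
    rw [Nat.cast_sub (Nat.one_le_iff_ne_zero.2 hj), Nat.cast_one]
  have hmul := mul_rayAngle hk j
  have hpi := Real.pi_pos
  refine ⟨⟨?_, fun h => ?_⟩, ?_⟩
  · show height σ _ = height σ _
    rw [(height_vertex σ).1, height_eq_re_stretch σ hw,
      stretch_shrink hk (levelPoint_mem_halfDisk hj hjk).2, pow_eq_polar, harg0,
      Complex.re_ofReal_mul, Complex.exp_ofReal_mul_I_re, hmul, Real.cos_sub_pi_div_two,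
      Real.sin_nat_mul_pi]
    ring
  · exact hwne (injOn_point 0 hw zero_mem_halfDisk h)
  · rw [triangles_point hw]
    have : sectors G.k (shrink G.k (levelPoint G.k j)) = {j - 1} := by
      ext s
      rw [sectors, Set.mem_ofPred_eq, or_iff_right hwne, harg, Set.mem_singleton_iff,
        div_le_iff₀ hk', le_div_iff₀ hk', mul_comm (rayAngle G.k j), hmul]
      constructor
      · rintro ⟨-, h3, h4⟩
        have h5 : (s : ℝ) < j := by nlinarith
        have h6 : (j : ℝ) < s + 2 := by nlinarith
        have h7 : s < j := by exact_mod_cast h5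
        have h8 : j < s + 2 := by exact_mod_cast h6
        omega
      · rintro rfl
        refine ⟨by omega, ?_, ?_⟩ <;> rw [hj1] <;> linarith
    rw [this, Set.image_singleton]

/-- Two triangles are adjacent if they have a common side joining the vertices `1` and `2`. -/
def Adjacent (G : TriangleGluing) (T T' : ℕ) : Prop :=
  ∃ c, Even c ∧ 0 < c ∧ c < G.k ∧
    (T = G.tri 1 (c - 1) ∧ T' = G.tri 1 c ∨ T = G.tri 1 c ∧ T' = G.tri 1 (c - 1))

/-- Two matched points are joined by the zero level if and only if they lie in adjacent
triangles. -/
lemma joinedIn_matched_iff {σ : ℝ} (hσ : σ ≠ 0) {i j : ℕ} (hi : i ≠ 0) (hik : i ≤ G.k) (hj : j ≠ 0)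
    (hjk : j ≤ G.k) (hij : i ≠ j) :
    JoinedIn (G.levelSet σ) (G.point 0 (shrink G.k (levelPoint G.k i)))
      (G.point 0 (shrink G.k (levelPoint G.k j))) ↔
      G.Adjacent (G.tri 0 (i - 1)) (G.tri 0 (j - 1)) := by
  have hk := G.k_pos
  have hloc : ∀ i, i ≠ 0 → i ≤ G.k → ∃ c ≤ G.k, Even c ∧ ∃ ξ ∈ wedge G.k, ξ ^ G.k ∈ levelCircle ∧
      ray G.k c * ξ ∈ halfDisk ∧
      G.point 0 (shrink G.k (levelPoint G.k i)) = G.point 1 (ray G.k c * ξ) ∧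
      ∃ s < G.k, (s = c ∨ s + 1 = c) ∧ G.tri 0 (i - 1) = G.tri 1 s := by
    intro i hi hik
    obtain ⟨hL, hT⟩ := matched_mem_levelSet σ hi hik
    obtain ⟨c, hc, he, ξ, hξ, hb, hw, heq⟩ := (mem_levelSet_iff hσ).1 hL
    refine ⟨c, hc, he, ξ, hξ, hb, hw, heq, ?_⟩
    have hmem : G.tri 0 (i - 1) ∈ G.triangles (G.point 1 (ray G.k c * ξ)) := by
      rw [← heq, hT]; rfl
    rw [triangles_point hw] at hmem
    obtain ⟨s, hs, hst⟩ := hmem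
    obtain ⟨h1, h2⟩ := (mem_sectors_ray_mul hk hc hξ hw.1 s).1 hs
    exact ⟨s, h1, h2.imp (fun h => h.1) (fun h => h.1), hst.symm⟩
  obtain ⟨c, hc, he, ξ, hξ, hb, hw, heq, s, hs, hsc, hst⟩ := hloc i hi hik
  obtain ⟨c', hc', he', ξ', hξ', hb', hw', heq', s', hs', hsc', hst'⟩ := hloc j hj hjk
  have hne : G.tri 0 (i - 1) ≠ G.tri 0 (j - 1) := fun h => by
    have := G.injOn_tri 0 (show i - 1 < G.k by omega) (show j - 1 < G.k by omega) h
    omega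
  constructor
  · intro h
    have hmem : ∀ {c ξ}, ξ ∈ wedge G.k → ξ ^ G.k ∈ levelCircle → ray G.k c * ξ ∈ halfDisk →
        G.point 1 (ray G.k c * ξ) ∈ G.rayNeighborhood c := fun hξ hb hw =>
      (point_mem_rayNeighborhood_iff hw).2 ⟨_, hξ, levelCircle_subset_lens hb, rfl⟩
    have hcc : c = c' := eq_of_joinedIn_levelSet hσ hc hc' he he'
      (heq ▸ hmem hξ hb hw) (heq' ▸ hmem hξ' hb' hw') h
    subst hcc
    rw [hst, hst'] at hne ⊢
    have hss : s ≠ s' := fun h => hne (by rw [h])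
    rcases hsc with h1 | h1 <;> rcases hsc' with h2 | h2
    · omega
    · exact ⟨c, he, by omega, by omega, Or.inr ⟨by rw [h1], by rw [← h2]; rfl⟩⟩
    · exact ⟨c, he, by omega, by omega, Or.inl ⟨by rw [← h1]; rfl, by rw [h2]⟩⟩
    · omega
  · rintro ⟨a, hae, ha0, hak, hT⟩
    rw [hst, hst'] at hT
    have hinj : ∀ {x y}, x < G.k → y < G.k → G.tri 1 x = G.tri 1 y → x = y := fun hx hy h =>
      G.injOn_tri 1 hx hy h
    have hsa : (s = a - 1 ∧ s' = a) ∨ (s = a ∧ s' = a - 1) :=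
      hT.imp (fun h => ⟨hinj hs (by omega) h.1, hinj hs' hak h.2⟩)
        fun h => ⟨hinj hs hak h.1, hinj hs' (by omega) h.2⟩
    have hac : a = c ∧ a = c' := by
      obtain ⟨m, rfl⟩ := hae
      obtain ⟨m₁, rfl⟩ := he
      obtain ⟨m₂, rfl⟩ := he'
      omega
    obtain ⟨rfl, rfl⟩ := hac
    rw [heq, heq']
    exact joinedIn_levelSet hσ ha0 hak hae hξ hξ' hb hb'

end TriangleGluing

/-! ### The gluing defined by two full ways -/

/-- Two full ways from `0` to `e` in opposite directions, as sequences of natural numbers. -/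
structure FullWayPair (k : ℕ) where
  odd_k : Odd k
  three_le_k : 3 ≤ k
  /-- the other free point -/
  e : ℕ
  /-- the involution that exchanges the ends of the chords -/
  chord : ℕ → ℕ
  /-- the way running through the arcs in the positive direction -/
  fwd : ℕ → ℕ
  /-- the way running through the arcs in the negative direction -/
  bwd : ℕ → ℕ
  fwd_bijOn : Set.BijOn fwd (Set.Iic k) (Set.Iic k)
  bwd_bijOn : Set.BijOn bwd (Set.Iic k) (Set.Iic k)
  fwd_zero : fwd 0 = 0
  bwd_zero : bwd 0 = 0
  fwd_last : fwd k = e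
  bwd_last : bwd k = e
  even_fwd : ∀ t ≤ k, (Even (fwd t) ↔ Even t)
  even_bwd : ∀ t ≤ k, (Even (bwd t) ↔ Even t)
  fwd_arc : ∀ t < k, Even t → fwd (t + 1) = fwd t + 1
  bwd_one : bwd 1 = k
  bwd_arc : ∀ t < k, 0 < t → Even t → bwd (t + 1) + 1 = bwd t
  fwd_chord : ∀ t < k, ¬ Even t → fwd (t + 1) = chord (fwd t)
  bwd_chord : ∀ t < k, ¬ Even t → bwd (t + 1) = chord (bwd t)

namespace FullWayPair
variable {k : ℕ} (W : FullWayPair k)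

lemma fwd_le {t : ℕ} (ht : t ≤ k) : W.fwd t ≤ k := W.fwd_bijOn.mapsTo ht

lemma bwd_le {t : ℕ} (ht : t ≤ k) : W.bwd t ≤ k := W.bwd_bijOn.mapsTo ht

lemma fwd_inj {t t' : ℕ} (ht : t ≤ k) (ht' : t' ≤ k) (h : W.fwd t = W.fwd t') : t = t' :=
  W.fwd_bijOn.injOn ht ht' h

lemma bwd_inj {t t' : ℕ} (ht : t ≤ k) (ht' : t' ≤ k) (h : W.bwd t = W.bwd t') : t = t' :=
  W.bwd_bijOn.injOn ht ht' h

lemma fwd_pos {t : ℕ} (ht : t ≤ k) (h0 : 0 < t) : 0 < W.fwd t :=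
  Nat.pos_of_ne_zero fun h => h0.ne' (W.fwd_inj ht (Nat.zero_le k) (h.trans W.fwd_zero.symm))

lemma bwd_pos {t : ℕ} (ht : t ≤ k) (h0 : 0 < t) : 0 < W.bwd t :=
  Nat.pos_of_ne_zero fun h => h0.ne' (W.bwd_inj ht (Nat.zero_le k) (h.trans W.bwd_zero.symm))

lemma exists_fwd {x : ℕ} (hx : x ≤ k) : ∃ t ≤ k, W.fwd t = x := W.fwd_bijOn.surjOn hx

lemma exists_bwd {x : ℕ} (hx : x ≤ k) : ∃ t ≤ k, W.bwd t = x := W.bwd_bijOn.surjOn hx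

/-- The triangle containing the matched point `Q_j` has the label `j - 1`. At the vertices `1` and
`2` the triangles follow each other as the matched points in the two full ways. -/
def tri (v : Fin 3) (s : ℕ) : ℕ :=
  if v = 0 then s else if v = 1 then W.fwd (k - s) - 1 else W.bwd (s + 1) - 1

lemma tri_zero (s : ℕ) : W.tri 0 s = s := rfl

lemma tri_one (s : ℕ) : W.tri 1 s = W.fwd (k - s) - 1 := rfl

lemma tri_two (s : ℕ) : W.tri 2 s = W.bwd (s + 1) - 1 := rfl

lemma injOn_tri (v : Fin 3) : Set.InjOn (W.tri v) (Set.Iio k) := by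
  intro s hs t ht h
  rw [Set.mem_Iio] at hs ht
  fin_cases v
  · exact h
  · change W.fwd (k - s) - 1 = W.fwd (k - t) - 1 at h
    have h1 := W.fwd_pos (t := k - s) (by omega) (by omega)
    have h2 := W.fwd_pos (t := k - t) (by omega) (by omega)
    have := W.fwd_inj (t := k - s) (t' := k - t) (by omega) (by omega) (by omega)
    omega
  · change W.bwd (s + 1) - 1 = W.bwd (t + 1) - 1 at h
    have h1 := W.bwd_pos (t := s + 1) (by omega) (by omega)
    have h2 := W.bwd_pos (t := t + 1) (by omega) (by omega)
    have := W.bwd_inj (t := s + 1) (t' := t + 1) (by omega) (by omega) (by omega)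
    omega

/-- The ray `c` at `v` and the ray `c'` at `v'` have the same triangles on their sides. -/
def Linked (v : Fin 3) (c : ℕ) (v' : Fin 3) (c' : ℕ) : Prop :=
  (c < k ↔ 0 < c') ∧ (0 < c ↔ c' < k) ∧ (c < k → W.tri v c = W.tri v' (c' - 1)) ∧
    (0 < c → W.tri v (c - 1) = W.tri v' c')

variable {W} in
lemma Linked.symm {v v' : Fin 3} {c c' : ℕ} (h : W.Linked v c v' c') : W.Linked v' c' v c :=
  ⟨h.2.1.symm, h.1.symm, fun h' => (h.2.2.2 (h.2.1.2 h')).symm, fun h' => (h.2.2.1 (h.1.2 h')).symm⟩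

lemma not_even_k (W : FullWayPair k) : ¬ Even k := Nat.not_even_iff_odd.2 W.odd_k

lemma lt_of_even (W : FullWayPair k) {t : ℕ} (ht : t ≤ k) (he : Even t) : t < k :=
  lt_of_le_of_ne ht fun h => W.not_even_k (h ▸ he)

lemma pos_of_not_even {t : ℕ} (he : ¬ Even t) : 0 < t :=
  Nat.pos_of_ne_zero fun h => he (h ▸ Even.zero)

/-- The sides joining `0` and `1` are crossed by the arcs of the positive way. -/
lemma linked_zero_one {t : ℕ} (ht : t ≤ k) (he : Even t) : W.Linked 0 (W.fwd t) 1 (k - t) := by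
  have hlt := W.lt_of_even ht he
  have hft := W.lt_of_even (W.fwd_le ht) ((W.even_fwd t ht).2 he)
  have harc := W.fwd_arc t hlt he
  refine ⟨by omega, ⟨fun h => ?_, fun h => W.fwd_pos ht (by omega)⟩, fun _ => ?_, fun _ => ?_⟩
  · have : t ≠ 0 := fun h0 => by rw [h0, W.fwd_zero] at h; exact lt_irrefl _ h
    omega
  · rw [tri_zero, tri_one, show k - (k - t - 1) = t + 1 by omega, harc, Nat.add_sub_cancel]
  · rw [tri_zero, tri_one, show k - (k - t) = t by omega]

/-- The sides joining `1` and `2` are crossed by the chords. -/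
lemma linked_one_two {t t' : ℕ} (ht : t ≤ k) (ht' : t' ≤ k) (he : ¬ Even t)
    (h : W.fwd t = W.bwd t') : W.Linked 1 (k - t) 2 t' := by
  have he' : ¬ Even t' := by rw [← W.even_bwd t' ht', ← h, W.even_fwd t ht]; exact he
  have h0 := pos_of_not_even he
  have h0' := pos_of_not_even he'
  have hiff : t = k ↔ t' = k := by
    constructor
    · rintro rfl
      exact W.bwd_inj ht' le_rfl (by rw [← h, W.fwd_last, W.bwd_last])
    · rintro rfl
      exact W.fwd_inj ht le_rfl (by rw [h, W.fwd_last, W.bwd_last])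
  refine ⟨by omega, by omega, fun _ => ?_, fun hc => ?_⟩
  · rw [tri_one, tri_two, show k - (k - t) = t by omega, show t' - 1 + 1 = t' by omega, h]
  · rw [tri_one, tri_two, show k - (k - t - 1) = t + 1 by omega,
      W.fwd_chord t (by omega) he, W.bwd_chord t' (by omega) he', h]

/-- The sides joining `2` and `0` are crossed by the arcs of the negative way. -/
lemma linked_two_zero {t : ℕ} (ht : t ≤ k) (he : Even t) : W.Linked 2 t 0 (W.bwd (t + 1)) := by
  have hlt := W.lt_of_even ht he
  have hpos := W.bwd_pos (t := t + 1) hlt (by omega)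
  have hle := W.bwd_le (t := t + 1) hlt
  refine ⟨by omega, ⟨fun h => ?_, fun h => ?_⟩, fun _ => ?_, fun h => ?_⟩
  · refine lt_of_le_of_ne hle fun h' => ?_
    have := W.bwd_inj hlt (by omega) (h'.trans W.bwd_one.symm)
    omega
  · refine Nat.pos_of_ne_zero fun h0 => ?_
    rw [h0, zero_add, W.bwd_one] at h
    exact lt_irrefl _ h
  · rw [tri_two, tri_zero]
  · have := W.bwd_arc t hlt h he
    rw [tri_two, tri_zero, show t - 1 + 1 = t by omega]
    omega

lemma exists_linked (W : FullWayPair k) (v : Fin 3) (c : ℕ) (hc : c ≤ k) : ∃ c' ≤ k, (Even c' ↔ ¬ Even c) ∧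
    W.Linked v c (if Even c then v + 1 else v + 2) c' := by
  have hk := W.not_even_k
  by_cases he : Even c
  · simp only [he, if_true, not_true_eq_false, iff_false]
    fin_cases v
    · obtain ⟨t, ht, rfl⟩ := W.exists_fwd hc
      rw [W.even_fwd t ht] at he
      exact ⟨k - t, by omega, by rw [Nat.even_sub ht]; tauto, W.linked_zero_one ht he⟩
    · have hodd : ¬ Even (k - c) := by rw [Nat.even_sub hc]; tauto
      obtain ⟨t', ht', h⟩ := W.exists_bwd (W.fwd_le (t := k - c) (by omega))
      have := W.linked_one_two (t := k - c) (by omega) ht' hodd h.symm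
      rw [show k - (k - c) = c by omega] at this
      refine ⟨t', ht', ?_, this⟩
      rw [← W.even_bwd t' ht', h, W.even_fwd _ (by omega)]
      exact hodd
    · have hlt := W.lt_of_even hc he
      refine ⟨W.bwd (c + 1), W.bwd_le hlt, ?_, W.linked_two_zero hc he⟩
      rw [W.even_bwd _ hlt, Nat.even_add_one]
      exact not_not.2 he
  · simp only [he, if_false, not_false_eq_true, iff_true]
    have h0 := pos_of_not_even he
    fin_cases v
    · obtain ⟨t, ht, rfl⟩ := W.exists_bwd hc
      rw [W.even_bwd t ht] at he
      have h0t := pos_of_not_even he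
      obtain ⟨t, rfl⟩ : ∃ s, t = s + 1 := ⟨t - 1, by omega⟩
      rw [Nat.even_add_one, not_not] at he
      exact ⟨t, by omega, he, (W.linked_two_zero (by omega) he).symm⟩
    · have heven : Even (k - c) := by rw [Nat.even_sub hc]; tauto
      have := W.linked_zero_one (t := k - c) (by omega) heven
      rw [show k - (k - c) = c by omega] at this
      exact ⟨_, W.fwd_le (by omega), (W.even_fwd _ (by omega)).2 heven, this.symm⟩
    · obtain ⟨t, ht, h⟩ := W.exists_fwd (W.bwd_le hc)
      have hodd : ¬ Even t := by rwa [← W.even_fwd t ht, h, W.even_bwd c hc]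
      exact ⟨k - t, by omega, by rw [Nat.even_sub ht]; tauto, (W.linked_one_two ht hc hodd h).symm⟩

/-- The gluing of triangles in which the sides at the saddle are glued along the chords. -/
def gluing : TriangleGluing where
  k := k
  odd_k := W.odd_k
  three_le_k := W.three_le_k
  tri := W.tri
  injOn_tri := W.injOn_tri
  link v c hc := by
    obtain ⟨c', h1, h2, h3, h4, h5, h6⟩ := W.exists_linked v c hc
    exact ⟨c', h1, h2, h3, h4, h5, h6⟩

/-- The common sides of the triangles that join `1` and `2` correspond to the chords. -/
lemma adjacent_iff (hinv : ∀ i ≤ k, W.chord (W.chord i) = i) (hfree : W.chord W.e = W.e) {i j : ℕ}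
    (hi : i ≠ 0) (hik : i ≤ k) (hj : j ≠ 0) (hjk : j ≤ k) :
    W.gluing.Adjacent (W.gluing.tri 0 (i - 1)) (W.gluing.tri 0 (j - 1)) ↔
      i ≠ j ∧ W.chord i = j ∧ (Even i ↔ ¬ Even j) := by
  constructor
  · rintro ⟨c, hce, hc0, hck, h⟩
    have hck : c < k := hck
    change i - 1 = W.fwd (k - (c - 1)) - 1 ∧ j - 1 = W.fwd (k - c) - 1 ∨
      i - 1 = W.fwd (k - c) - 1 ∧ j - 1 = W.fwd (k - (c - 1)) - 1 at h
    rw [show k - (c - 1) = k - c + 1 by omega] at h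
    have hodd : ¬ Even (k - c) := by
      have := W.not_even_k
      rw [Nat.even_sub hck.le]; tauto
    have h1 := W.fwd_pos (t := k - c) (by omega) (by omega)
    have h2 := W.fwd_pos (t := k - c + 1) (by omega) (by omega)
    have h3 := W.fwd_chord (k - c) (by omega) hodd
    have h4 : ¬ Even (W.fwd (k - c)) := by rwa [W.even_fwd _ (by omega)]
    have h5 : Even (W.fwd (k - c + 1)) := by
      rw [W.even_fwd _ (by omega), Nat.even_add_one]; exact hodd
    have h6 : W.fwd (k - c) ≠ W.fwd (k - c + 1) := fun h => h4 (h ▸ h5)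
    rcases h with ⟨ha, hb⟩ | ⟨ha, hb⟩
    · obtain rfl : i = W.fwd (k - c + 1) := by omega
      obtain rfl : j = W.fwd (k - c) := by omega
      exact ⟨h6.symm, by rw [h3, hinv _ (W.fwd_le (by omega))], by tauto⟩
    · obtain rfl : i = W.fwd (k - c) := by omega
      obtain rfl : j = W.fwd (k - c + 1) := by omega
      exact ⟨h6, h3.symm, by tauto⟩
  · rintro ⟨hij, hch, hpar⟩
    have main : ∀ i j, i ≠ 0 → i ≤ k → j ≠ 0 → i ≠ j → W.chord i = j → ¬ Even i →
        ∃ c, Even c ∧ 0 < c ∧ c < k ∧ i - 1 = W.tri 1 c ∧ j - 1 = W.tri 1 (c - 1) := by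
      intro i j hi hik hj hij hch hodd
      obtain ⟨t, ht, rfl⟩ := W.exists_fwd hik
      rw [W.even_fwd t ht] at hodd
      have ht0 := pos_of_not_even hodd
      have htk : t ≠ k := fun h => by
        rw [h, W.fwd_last] at hch hij
        exact hij (hfree.symm.trans hch)
      have hne := W.not_even_k
      refine ⟨k - t, by rw [Nat.even_sub ht]; tauto, by omega, by omega, ?_, ?_⟩
      · rw [tri_one, show k - (k - t) = t by omega]
      · rw [tri_one, show k - (k - t - 1) = t + 1 by omega, W.fwd_chord t (by omega) hodd, hch]
    by_cases he : Even i
    · obtain ⟨c, h1, h2, h3, h4, h5⟩ := main j i hj hjk hi hij.symm (by rw [← hch, hinv i hik])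
        (hpar.1 he)
      exact ⟨c, h1, h2, h3, Or.inl ⟨h5, h4⟩⟩
    · obtain ⟨c, h1, h2, h3, h4, h5⟩ := main i j hi hik hj hij hch he
      exact ⟨c, h1, h2, h3, Or.inr ⟨h4, h5⟩⟩

/-- The cochain that jumps at the triangle with the free matched point. -/
def jump (v : Fin 3) (T : ℕ) : ℤ :=
  if v = 0 then 0 else if v = 1 then (if W.e ≤ T then 1 else 0) else if W.e ≤ T + 1 then 1 else 0

lemma not_even_e : ¬ Even W.e := by
  rw [← W.fwd_last, W.even_fwd k le_rfl]; exact W.not_even_k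

lemma jump_eq_of_ne {T : ℕ} (h : T + 1 ≠ W.e) : W.jump 1 T = W.jump 2 T := by
  change (if W.e ≤ T then (1 : ℤ) else 0) = if W.e ≤ T + 1 then 1 else 0
  have : W.e ≤ T ↔ W.e ≤ T + 1 := by omega
  simp only [this]

lemma jump_one_eq {T : ℕ} (h : T + 1 ≠ W.e) : W.jump 1 T = W.jump 1 (T + 1) := by
  change (if W.e ≤ T then (1 : ℤ) else 0) = if W.e ≤ T + 1 then 1 else 0
  have : W.e ≤ T ↔ W.e ≤ T + 1 := by omega
  simp only [this]

lemma jump_two_eq {T : ℕ} (h : T + 2 ≠ W.e) : W.jump 2 T = W.jump 2 (T + 1) := by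
  change (if W.e ≤ T + 1 then (1 : ℤ) else 0) = if W.e ≤ T + 1 + 1 then 1 else 0
  have : W.e ≤ T + 1 ↔ W.e ≤ T + 1 + 1 := by omega
  simp only [this]

lemma isCochain_jump : W.gluing.IsCochain W.jump := by
  intro v c hc0 hck
  have hck : c < k := hck
  have hk := W.not_even_k
  have he := W.not_even_e
  change W.jump v (W.tri v c) - W.jump v (W.tri v (c - 1)) =
    W.jump (if Even c then v + 1 else v + 2) (W.tri v c) -
      W.jump (if Even c then v + 1 else v + 2) (W.tri v (c - 1))
  have h0 : ∀ T, W.jump 0 T = 0 := fun T => rfl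
  by_cases hc : Even c
  · simp only [hc, if_true]
    fin_cases v <;> simp only [Fin.zero_eta, Fin.mk_one, Fin.reduceFinMk, Fin.isValue, zero_add,
      Fin.reduceAdd, h0]
    · have h1 := W.jump_one_eq (T := c - 1) (fun h => he (h ▸ (by rwa [Nat.sub_add_cancel hc0])))
      rw [Nat.sub_add_cancel hc0] at h1
      rw [tri_zero, tri_zero, h1]; ring
    · have h1 : ∀ t ≤ k, t ≠ k → 0 < t → W.fwd t - 1 + 1 ≠ W.e := fun t ht htk ht0 h => by
        have := W.fwd_pos ht ht0
        rw [Nat.sub_add_cancel this, ← W.fwd_last] at h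
        exact htk (W.fwd_inj ht le_rfl h)
      have hc1 : c ≠ 1 := fun h => by rw [h] at hc; exact absurd hc (by decide)
      rw [tri_one, tri_one, W.jump_eq_of_ne (h1 (k - c) (by omega) (by omega) (by omega)),
        W.jump_eq_of_ne (h1 (k - (c - 1)) (by omega) (by omega) (by omega))]
    · have harc := W.bwd_arc c hck hc0 hc
      have hpos := W.bwd_pos (t := c + 1) (by omega) (by omega)
      have hne : W.bwd c ≠ W.e := fun h => by
        have := W.bwd_inj hck.le le_rfl (h.trans W.bwd_last.symm)
        omega
      have h1 := W.jump_two_eq (T := W.bwd (c + 1) - 1) (by omega)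
      rw [tri_two, tri_two, Nat.sub_add_cancel hc0, h1,
        show W.bwd (c + 1) - 1 + 1 = W.bwd c - 1 by omega]
      ring
  · simp only [hc, if_false]
    fin_cases v <;> simp only [Fin.zero_eta, Fin.mk_one, Fin.reduceFinMk, Fin.isValue, zero_add,
      Fin.reduceAdd, h0]
    · have h1 := W.jump_two_eq (T := c - 1) (fun h => he (by
        rw [← h, show c - 1 + 2 = c + 1 by omega, Nat.even_add_one]; exact hc))
      rw [Nat.sub_add_cancel hc0] at h1
      rw [tri_zero, tri_zero, h1]; ring
    · have heven : Even (k - c) := by rw [Nat.even_sub hck.le]; tauto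
      have harc := W.fwd_arc (k - c) (by omega) heven
      have hpos := W.fwd_pos (t := k - c) (by omega) (by omega)
      have hne : W.fwd (k - c) ≠ W.e := fun h => by
        have := W.fwd_inj (by omega) le_rfl (h.trans W.fwd_last.symm)
        omega
      have h1 := W.jump_one_eq (T := W.fwd (k - c) - 1) (by omega)
      rw [tri_one, tri_one, show k - (c - 1) = k - c + 1 by omega, harc, h1,
        Nat.sub_add_cancel hpos, Nat.add_sub_cancel]
      ring
    · have h1 : ∀ t ≤ k, t ≠ k → 0 < t → W.bwd t - 1 + 1 ≠ W.e := fun t ht htk ht0 h => by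
        have := W.bwd_pos ht ht0
        rw [Nat.sub_add_cancel this, ← W.bwd_last] at h
        exact htk (W.bwd_inj ht le_rfl h)
      have hc1 : c + 1 ≠ k := fun h => by
        rw [← h, Nat.even_add_one, not_not] at hk; exact hc hk
      rw [tri_two, tri_two, W.jump_eq_of_ne (h1 (c + 1) (by omega) (by omega) (by omega)),
        W.jump_eq_of_ne (h1 (c - 1 + 1) (by omega) (by omega) (by omega))]

lemma not_hasLiftOn_jump : ¬ HasLiftOn (W.gluing.circleMap W.jump) Set.univ := by
  have h3 := W.three_le_k
  have he := W.fwd_le (t := k) le_rfl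
  rw [W.fwd_last] at he
  have he0 : 0 < W.e := pos_of_not_even W.not_even_e
  by_cases h1 : W.e = 1
  · refine W.gluing.not_hasLiftOn_circleMap W.isCochain_jump (fun _ => rfl) (v := 1) (by decide)
      (s := 0) (t := k - 1) (show 0 < k by omega) (show k - 1 < k by omega) ?_
    change (if W.e ≤ 0 then (1 : ℤ) else 0) ≠ if W.e ≤ k - 1 then 1 else 0
    rw [if_neg (by omega), if_pos (by omega)]; decide
  · refine W.gluing.not_hasLiftOn_circleMap W.isCochain_jump (fun _ => rfl) (v := 2) (by decide)
      (s := 0) (t := k - 1) (show 0 < k by omega) (show k - 1 < k by omega) ?_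
    change (if W.e ≤ 0 + 1 then (1 : ℤ) else 0) ≠ if W.e ≤ k - 1 + 1 then 1 else 0
    rw [if_neg (by omega), if_pos (by omega)]; decide

end FullWayPair

/-! ### The full ways of a chord diagram -/

namespace ChordDiagram
variable {D : ChordDiagram}

/-- The ends of a chord have different parity. -/
lemma even_iff_of_isChord (h1 : D.ChordsSplitEvenly) {i j : Fin (D.k + 1)} (h : D.IsChord i j) :
    (Even (j : ℕ) ↔ ¬ Even (i : ℕ)) := by
  have main : ∀ i j : Fin (D.k + 1), i < j → D.IsChord i j → (Even (j : ℕ) ↔ ¬ Even (i : ℕ)) := by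
    intro i j hij h
    have h2 := (h1 i j hij h).1
    have h3 : {m | i < m ∧ m < j} = ((Finset.Ioo i j : Finset (Fin (D.k + 1))) : Set _) := by
      ext m; simp
    rw [h3, Set.ncard_coe_finset, Fin.card_Ioo] at h2
    have h4 : (j : ℕ) = (j - i - 1) + i + 1 := by
      have : (i : ℕ) < j := hij
      omega
    rw [h4, Nat.even_add_one, Nat.even_add]
    simp only [h2, true_iff]
  rcases lt_or_gt_of_ne h.1 with hij | hij
  · exact main i j hij h
  · have := main j i hij ⟨h.1.symm, by rw [← h.2, D.subst_subst]⟩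
    tauto

/-- A full way whose arcs are run through in the direction `d`. -/
def IsFullWayInDirection (D : ChordDiagram) (e d : Fin (D.k + 1)) (w : Fin (D.k + 1) → Fin (D.k + 1)) :
    Prop :=
  Function.Injective w ∧ w 0 = 0 ∧ w (Fin.last D.k) = e ∧
    ∀ t : Fin D.k, (Even (t : ℕ) → w t.succ = w t.castSucc + d) ∧
      (Odd (t : ℕ) → D.IsChord (w t.castSucc) (w t.succ))

/-- A full way is determined by its direction. -/
lemma IsFullWayInDirection.unique {e d : Fin (D.k + 1)} {w w' : Fin (D.k + 1) → Fin (D.k + 1)}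
    (h : D.IsFullWayInDirection e d w) (h' : D.IsFullWayInDirection e d w') : w = w' := by
  funext t
  induction t using Fin.induction with
  | zero => rw [h.2.1, h'.2.1]
  | succ t ih =>
    rcases Nat.even_or_odd (t : ℕ) with ht | ht
    · rw [(h.2.2.2 t).1 ht, (h'.2.2.2 t).1 ht, ih]
    · rw [← ((h.2.2.2 t).2 ht).2, ← ((h'.2.2.2 t).2 ht).2, ih]

lemma exists_fullWays (h3 : D.HasTwoFullWays) : ∃ e, D.IsFree e ∧
    ∃ w w', D.IsFullWayInDirection e 1 w ∧ D.IsFullWayInDirection e (-1) w' := by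
  obtain ⟨e, -, hfree, w₁, w₂, hne, ⟨a1, a2, a3, d₁, hd₁, a4⟩, b1, b2, b3, d₂, hd₂, b4⟩ := h3
  have ha : D.IsFullWayInDirection e d₁ w₁ := ⟨a1, a2, a3, a4⟩
  have hb : D.IsFullWayInDirection e d₂ w₂ := ⟨b1, b2, b3, b4⟩
  refine ⟨e, hfree, ?_⟩
  rcases hd₁ with rfl | rfl <;> rcases hd₂ with rfl | rfl
  · exact absurd (ha.unique hb) hne
  · exact ⟨_, _, ha, hb⟩
  · exact ⟨_, _, hb, ha⟩
  · exact absurd (ha.unique hb) hne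

/-- Along a full way the parity of the matched points alternates. -/
lemma IsFullWayInDirection.even_iff (h1 : D.ChordsSplitEvenly) (hk : Odd D.k) {e d : Fin (D.k + 1)}
    (hd : d = 1 ∨ d = -1) {w : Fin (D.k + 1) → Fin (D.k + 1)} (h : D.IsFullWayInDirection e d w)
    (t : Fin (D.k + 1)) : Even (w t : ℕ) ↔ Even (t : ℕ) := by
  have hk1 : 1 ≤ D.k := D.one_le_k
  have hstep : ∀ x : Fin (D.k + 1), Even ((x + d : Fin (D.k + 1)) : ℕ) ↔ ¬ Even (x : ℕ) := by
    have hne := Nat.not_even_iff_odd.2 hk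
    intro x
    rcases hd with rfl | rfl
    · by_cases hx : x = Fin.last D.k
      · subst hx; simp [hne]
      · rw [Fin.val_add_one_of_lt (Fin.lt_last_iff_ne_last.2 hx), Nat.even_add_one]
    · rw [← sub_eq_add_neg]
      by_cases hx : x = 0
      · subst hx
        simp [hne]
      · rw [Fin.val_sub_one_of_ne_zero hx]
        have : (x : ℕ) ≠ 0 := fun h => hx (Fin.ext h)
        rw [Nat.even_sub (by omega)]
        simp
  induction t using Fin.induction with
  | zero => rw [h.2.1]
  | succ t ih =>
    have ih' : Even (w t.castSucc : ℕ) ↔ Even (t : ℕ) := ih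
    rw [Fin.val_succ, Nat.even_add_one, ← ih']
    rcases Nat.even_or_odd (t : ℕ) with ht | ht
    · rw [(h.2.2.2 t).1 ht, hstep]
    · exact even_iff_of_isChord h1 ((h.2.2.2 t).2 ht)

/-- A self-map of `Fin (k + 1)` as a function on the natural numbers. -/
def toNat {k : ℕ} (w : Fin (k + 1) → Fin (k + 1)) (t : ℕ) : ℕ := w (Fin.ofNat (k + 1) t)

lemma toNat_val {k : ℕ} (w : Fin (k + 1) → Fin (k + 1)) (t : Fin (k + 1)) :
    toNat w t = w t := by
  rw [toNat]
  congr 2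
  exact Fin.ext (Nat.mod_eq_of_lt t.2)

lemma toNat_of_lt {k : ℕ} (w : Fin (k + 1) → Fin (k + 1)) {t : ℕ} (ht : t < k + 1) :
    toNat w t = w ⟨t, ht⟩ := toNat_val w ⟨t, ht⟩

lemma bijOn_toNat {k : ℕ} {w : Fin (k + 1) → Fin (k + 1)} (hw : Function.Injective w) :
    Set.BijOn (toNat w) (Set.Iic k) (Set.Iic k) := by
  refine ⟨fun t _ => Nat.lt_succ_iff.1 (w _).2, fun t ht t' ht' h => ?_, fun x hx => ?_⟩
  · rw [toNat_of_lt w (Nat.lt_succ_iff.2 ht), toNat_of_lt w (Nat.lt_succ_iff.2 ht')] at h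
    exact congrArg Fin.val (hw (Fin.ext h))
  · obtain ⟨t, ht⟩ := (Finite.injective_iff_surjective.1 hw) ⟨x, Nat.lt_succ_iff.2 hx⟩
    exact ⟨t, Nat.lt_succ_iff.1 t.2, by rw [toNat_val, ht]⟩

/-- Two different full ways to the same free point run in opposite directions, since a full way is
determined by its direction. -/
lemma exists_fullWayPair (h1 : D.ChordsSplitEvenly) (h2 : D.HasTwoFreePoints)
    (h3 : D.HasTwoFullWays) : ∃ W : FullWayPair D.k, W.chord = toNat D.subst ∧
      W.chord W.e = W.e := by
  obtain ⟨⟨n, hn, hkn⟩, -⟩ := h2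
  obtain ⟨e, hfree, w, w', hw, hw'⟩ := exists_fullWays h3
  have hodd : Odd D.k := ⟨2 * n, by omega⟩
  have hlast : ∀ u : Fin (D.k + 1) → Fin (D.k + 1), toNat u D.k = u (Fin.last D.k) := fun u =>
    toNat_val u (Fin.last D.k)
  have hzero : ∀ u : Fin (D.k + 1) → Fin (D.k + 1), toNat u 0 = u 0 := fun u => toNat_val u 0
  have hsucc : ∀ (u : Fin (D.k + 1) → Fin (D.k + 1)) (t : Fin D.k), toNat u (t + 1) = u t.succ :=
    fun u t => toNat_val u t.succ
  have hcast : ∀ (u : Fin (D.k + 1) → Fin (D.k + 1)) (t : Fin D.k), toNat u t = u t.castSucc :=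
    fun u t => toNat_val u t.castSucc
  have hpar : ∀ {d u}, d = 1 ∨ d = -1 → D.IsFullWayInDirection e d u → ∀ t ≤ D.k,
      (Even (toNat u t) ↔ Even t) := fun hd hu t ht => by
    rw [toNat_of_lt _ (Nat.lt_succ_iff.2 ht)]
    exact hu.even_iff h1 hodd hd _
  have hchord : ∀ {d u}, D.IsFullWayInDirection e d u → ∀ t < D.k, ¬ Even t →
      toNat u (t + 1) = toNat D.subst (toNat u t) := fun hu t ht he => by
    have h := ((hu.2.2.2 ⟨t, ht⟩).2 (Nat.not_even_iff_odd.1 he)).2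
    rw [hsucc _ ⟨t, ht⟩, hcast _ ⟨t, ht⟩, toNat_val, h]
  have hne : ∀ {d u}, D.IsFullWayInDirection e d u → ∀ t : Fin D.k, (t : ℕ) ≠ 0 →
      u t.castSucc ≠ 0 := fun hu t h0 h => by
    have := hu.1 (h.trans hu.2.1.symm)
    exact h0 (congrArg Fin.val this)
  refine ⟨
    { odd_k := hodd
      three_le_k := by omega
      e := e
      chord := toNat D.subst
      fwd := toNat w
      bwd := toNat w'
      fwd_bijOn := bijOn_toNat hw.1
      bwd_bijOn := bijOn_toNat hw'.1
      fwd_zero := by rw [hzero, hw.2.1]; rfl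
      bwd_zero := by rw [hzero, hw'.2.1]; rfl
      fwd_last := by rw [hlast, hw.2.2.1]
      bwd_last := by rw [hlast, hw'.2.2.1]
      even_fwd := hpar (Or.inl rfl) hw
      even_bwd := hpar (Or.inr rfl) hw'
      fwd_arc := fun t ht he => ?_
      bwd_one := ?_
      bwd_arc := fun t ht h0 he => ?_
      fwd_chord := hchord hw
      bwd_chord := hchord hw' }, rfl, ?_⟩
  · have hwe := (hpar (Or.inl rfl) hw t ht.le).2 he
    rw [hcast _ ⟨t, ht⟩] at hwe ⊢
    rw [hsucc _ ⟨t, ht⟩, (hw.2.2.2 ⟨t, ht⟩).1 he, Fin.val_add_one_of_lt]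
    refine Fin.lt_last_iff_ne_last.2 fun h => ?_
    rw [h] at hwe
    exact Nat.not_even_iff_odd.2 hodd hwe
  · have ht : 0 < D.k := D.one_le_k
    rw [← zero_add 1, hsucc _ ⟨0, ht⟩, (hw'.2.2.2 ⟨0, ht⟩).1 Even.zero,
      show (⟨0, ht⟩ : Fin D.k).castSucc = 0 from rfl, hw'.2.1, zero_add]
    simp
  · rw [hcast _ ⟨t, ht⟩, hsucc _ ⟨t, ht⟩, (hw'.2.2.2 ⟨t, ht⟩).1 he, ← sub_eq_add_neg,
      Fin.val_sub_one_of_ne_zero (hne hw' ⟨t, ht⟩ h0.ne')]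
    have : ((w' (⟨t, ht⟩ : Fin D.k).castSucc : Fin (D.k + 1)) : ℕ) ≠ 0 := fun h =>
      hne hw' ⟨t, ht⟩ h0.ne' (Fin.ext h)
    omega
  · show toNat D.subst e = e
    rw [toNat_val]
    by_contra h
    exact hfree (D.subst e) ⟨fun h' => h (congrArg Fin.val h'.symm), rfl⟩

/-- The sign of the height on the arc `0`. -/
noncomputable def arcSign (D : ChordDiagram) : ℝ := if D.color 0 = true then 1 else -1

lemma arcSign_eq : D.arcSign = 1 ∨ D.arcSign = -1 := by
  unfold arcSign; split_ifs <;> simp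

lemma color_eq (j : ℕ) (hj : j < D.k + 1) :
    (if D.color ⟨j, hj⟩ = true then (1 : ℝ) else -1) = D.arcSign * (-1) ^ j := by
  induction j with
  | zero => rw [pow_zero, mul_one]; rfl
  | succ j ih =>
    have hne : (⟨j + 1, hj⟩ : Fin (D.k + 1)) ≠ 0 := fun h => by
      have := congrArg Fin.val h
      simp at this
    have hsub : (⟨j + 1, hj⟩ : Fin (D.k + 1)) - 1 = ⟨j, by omega⟩ := by
      apply Fin.ext
      rw [Fin.val_sub_one_of_ne_zero hne]
      rfl
    have hc := D.color_ne _ hne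
    rw [hsub] at hc
    rw [pow_succ, ← mul_assoc, ← ih (by omega)]
    revert hc
    cases D.color ⟨j, by omega⟩ <;> cases D.color ⟨j + 1, hj⟩ <;> simp

lemma isChordDiagramOfLevel_height {W : FullWayPair D.k} (h1 : D.ChordsSplitEvenly)
    (hch : W.chord = toNat D.subst) (hfree : W.chord W.e = W.e) :
    IsChordDiagramOfLevel D (TriangleGluing.height (G := W.gluing) D.arcSign)
      (W.gluing.point 0 0) := by
  have hσ := D.arcSign_eq
  have hσ0 : D.arcSign ≠ 0 := by rcases hσ with h | h <;> rw [h] <;> norm_num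
  have hinv : ∀ i, i ≤ D.k → W.chord (W.chord i) = i := fun i hi => by
    rw [hch, toNat_of_lt _ (Nat.lt_succ_iff.2 hi), toNat_val, D.subst_subst]
  refine ⟨W.gluing.polygonNeighborhood hσ, fun i j hi hj hij => ?_, fun j P hP hr ha hb => ?_⟩
  · have hi0 : (i : ℕ) ≠ 0 := fun h => hi (Fin.ext h)
    have hj0 : (j : ℕ) ≠ 0 := fun h => hj (Fin.ext h)
    have hik : (i : ℕ) ≤ D.k := Nat.lt_succ_iff.1 i.2
    have hjk : (j : ℕ) ≤ D.k := Nat.lt_succ_iff.1 j.2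
    have hij' : (i : ℕ) ≠ j := fun h => hij (Fin.ext h)
    have e1 := W.gluing.polygonNeighborhood_matched hσ (j := i) hi
    have e2 := W.gluing.polygonNeighborhood_matched hσ (j := j) hj
    have e3 := TriangleGluing.joinedIn_matched_iff (G := W.gluing) hσ0 hi0 hik hj0 hjk hij'
    have e4 := W.adjacent_iff hinv hfree hi0 hik hj0 hjk
    rw [e1, e2]
    refine Iff.trans ?_ e3.symm
    rw [e4, hch, toNat_val]
    constructor
    · intro h
      have := even_iff_of_isChord h1 h
      exact ⟨hij', congrArg Fin.val h.2, by tauto⟩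
    · rintro ⟨-, h, -⟩
      exact ⟨hij, Fin.ext h⟩
  · have hP' := TriangleGluing.mem_polygonChart_source.1 hP
    obtain ⟨a, ha, he⟩ := TriangleGluing.height_arc_pos (G := W.gluing) (σ := D.arcSign) (j := j)
      hP' hr ha hb
    have hc := D.color_eq j j.2
    rw [(TriangleGluing.height_vertex _).1, he, ← hc]
    constructor
    · intro h
      rw [if_pos h]; linarith
    · intro h
      rw [if_neg (by rw [h]; decide)]; linarith

end ChordDiagram

theorem theorem4p4 (D : ChordDiagram) (h1 : D.ChordsSplitEvenly) (h2 : D.HasTwoFreePoints)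
    (h3 : D.HasTwoFullWays) :
    ∃ (M : Type) (_ : TopologicalSpace M) (_ : ChartedSpace (EuclideanHalfSpace 2) M),
      IsManifold (𝓡∂ 2) ∞ M ∧ T2Space M ∧ SecondCountableTopology M ∧
      CompactSpace M ∧ ConnectedSpace M ∧
      IsOrientableSurface M ∧ IsConnected ((𝓡∂ 2).boundary M) ∧
      ∃ f : M → ℝ, IsOptimal f ∧ IsSimpleFunction f ∧ f '' criticalPoints f = {-1, 0, 1} ∧
        ∃ p₀ : M, IsSaddle f p₀ ∧ f p₀ = 0 ∧ IsChordDiagramOfLevel D f p₀ := by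
  obtain ⟨W, hch, hfree⟩ := ChordDiagram.exists_fullWayPair h1 h2 h3
  have hσ := D.arcSign_eq
  have hσ0 : D.arcSign ≠ 0 := by rcases hσ with h | h <;> rw [h] <;> norm_num
  exact ⟨W.gluing.Surface, inferInstance, inferInstance, inferInstance, inferInstance,
    inferInstance, inferInstance, inferInstance, TriangleGluing.isOrientableSurface _,
    TriangleGluing.isConnected_boundary, TriangleGluing.height D.arcSign,
    TriangleGluing.isOptimal_height hσ0 W.isCochain_jump W.not_hasLiftOn_jump,
    TriangleGluing.isSimpleFunction_height hσ0, TriangleGluing.image_criticalPoints_height hσ,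
    W.gluing.point 0 0, TriangleGluing.isSaddle_height hσ0, (TriangleGluing.height_vertex _).1,
    ChordDiagram.isChordDiagramOfLevel_height h1 hch hfree⟩
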